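/- **Setting.** Formulae of modal dependence logic $\mathrm{MDL}$ (with dependence disjunction $\vee$ and classical disjunction $\vee_{\mathrm c}$) over a set $AP$ of atomic propositions are built by $$\varphi ::= \top\mid\bot\mid q\mid\neg q\mid \mathrm{dep}(p_1,\dots,p_n;q)\mid\neg\,\mathrm{dep}(p_1,\dots,p_n;q)\mid\varphi\vee\varphi\mid\varphi\mathbin{\vee_{\mathrm c}}\varphi\mid\varphi\wedge\varphi\mid\Box\varphi\mid\Diamond\varphi ,$$ with $p_1,\dots,p_n,q\in AP$, $n\ge 0$; $n$ is the arity of the dependence atom. For $k\ge 0$ and a set $M$ of operators from $\{\Box,\Diamond,\wedge,\vee,\vee_{\mathrm c},\neg,\top,\bot,\mathrm{dep}\}$, $\mathrm{MDL}_k[M]$ is the set of formulae that use only operators from $M$ and all of whose dependence atoms have arity at most $k$. Formulae are evaluated on teams $T\subseteq S$ of Kripke structures $W=(S,R,\pi)$ with $S\neq\emptyset$, $R\subseteq S\times S$, $\pi:S\to\mathcal P(AP)$: - $W,T\models\top$ always; $W,T\models\bot$ iff $T=\emptyset$; $W,T\models q$ iff $q\in\pi(s)$ for all $s\in T$; $W,T\models\neg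 q$ iff $q\notin\pi(s)$ for all $s\in T$; - $W,T\models\mathrm{dep}(p_1,\dots,p_n;q)$ iff any two worlds of $T$ that agree on $p_1,\dots,p_n$ agree on $q$; $W,T\models\neg\,\mathrm{dep}(p_1,\dots,p_n;q)$ iff $T=\emptyset$; - $W,T\models\varphi\vee\psi$ iff $T=T_1\cup T_2$ for some $T_1,T_2$ with $W,T_1\models\varphi$ and $W,T_2\models\psi$; $W,T\models\varphi\mathbin{\vee_{\mathrm c}}\psi$ iff $W,T\models\varphi$ or $W,T\models\psi$; $W,T\models\varphi\wedge\psi$ iff $W,T\models\varphi$ and $W,T\models\psi$; - $W,T\models\Box\varphi$ iff $W,\{s'\mid\exists s\in T:(s,s')\in R\}\models\varphi$; $W,T\models\Diamond\varphi$ iff $W,T'\models\varphi$ for some $T'\subseteq S$ such that every $s\in T$ has an $R$-successor in $T'$. The model checking problem for $\mathrm{MDL}_k[M]$ is the language of all (standard) encodings of triples $(W,T,\varphi)$, with $W=(S,R,\pi)$ a finite Kripke structure whose worlds have finitely many labels, $T\subseteq S$ and $\varphi\in\mathrm{MDL}_k[M]$, such that $W,T\models\varphi$; atomic propositions are given by names,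 which are finite bit strings. **Theorem.** Let $M\subseteq\{\vee,\neg,\mathrm{dep}\}$ and $k\ge 0$. Then the model checking problem for $\mathrm{MDL}_k[M]$ is in $\mathrm P$. Moreover, for every Kripke structure $W=(S,R,\pi)$ with $S$ finite and non-empty and every $\varphi\in\mathrm{MDL}_k[M]$ in which the number of occurrences of positive (that is, non-negated) dependence atoms is greater than $\log_2|S|$, we have $W,T\models\varphi$ for all $T\subseteq S$. -/

import Mathlib

namespace MDL

/-- The operators from which fragments of modal dependence logic are formed. -/
inductive Op
  | box | dia | and | or | cor | neg | top | bot | dep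

/-- Formulae of modal dependence logic over the atomic propositions `AP`. Negation is atomic:
it is applied to propositions (`nprop`) and to dependence atoms (`ndep`) only. The operator `or` is
the (splitting) dependence disjunction, `cor` the classical disjunction. -/
inductive Fml (AP : Type*)
  | top : Fml AP
  | bot : Fml AP
  | prop (q : AP) : Fml AP
  | nprop (q : AP) : Fml AP
  | dep (ps : List AP) (q : AP) : Fml AP
  | ndep (ps : List AP) (q : AP) : Fml AP
  | or (φ ψ : Fml AP) : Fml AP
  | cor (φ ψ : Fml AP) : Fml AP
  | and (φ ψ : Fml AP) : Fml AP
  | box (φ : Fml AP) : Fml AP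
  | dia (φ : Fml AP) : Fml AP

namespace Fml

variable {AP : Type*}

/-- The set of operators that occur in a formula. -/
def ops : Fml AP → Set Op
  | top => {Op.top}
  | bot => {Op.bot}
  | prop _ => ∅
  | nprop _ => {Op.neg}
  | dep _ _ => {Op.dep}
  | ndep _ _ => {Op.neg, Op.dep}
  | or φ ψ => {Op.or} ∪ φ.ops ∪ ψ.ops
  | cor φ ψ => {Op.cor} ∪ φ.ops ∪ ψ.ops
  | and φ ψ => {Op.and} ∪ φ.ops ∪ ψ.ops
  | box φ => {Op.box} ∪ φ.ops
  | dia φ => {Op.dia} ∪ φ.ops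

/-- Every dependence atom of the formula has arity at most `k`, where the arity of
`dep(p₁, …, pₙ; q)` is `n`. -/
def ArityLE (k : ℕ) : Fml AP → Prop
  | top | bot | prop _ | nprop _ => True
  | dep ps _ | ndep ps _ => ps.length ≤ k
  | or φ ψ | cor φ ψ | and φ ψ => φ.ArityLE k ∧ ψ.ArityLE k
  | box φ | dia φ => φ.ArityLE k

/-- The number of (occurrences of) positive dependence atoms in a formula. -/
def numDep : Fml AP → ℕ
  | top | bot | prop _ | nprop _ | ndep _ _ => 0
  | dep _ _ => 1
  | or φ ψ | cor φ ψ | and φ ψ => φ.numDep + ψ.numDep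
  | box φ | dia φ => φ.numDep

end Fml

/-- The fragment `MDL_k[M]`: formulae that use only operators from `M` and whose dependence atoms
have arity at most `k`. -/
def fragment (AP : Type*) (k : ℕ) (M : Set Op) : Set (Fml AP) :=
  {φ | φ.ops ⊆ M ∧ φ.ArityLE k}

/-- A Kripke structure with set of worlds `S`. (Non-emptiness of `S` is required where Kripke
structures are used.) -/
structure Kripke (AP : Type*) (S : Type*) where
  /-- accessibility relation -/
  R : S → S → Prop
  /-- labeling function -/
  π : S → Set AP

/-- Team semantics: `W.Sat T φ` means that `φ` is true in the team `T` of `W`. -/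
def Kripke.Sat {AP S : Type*} (W : Kripke AP S) : Set S → Fml AP → Prop
  | _, .top => True
  | T, .bot => T = ∅
  | T, .prop q => ∀ s ∈ T, q ∈ W.π s
  | T, .nprop q => ∀ s ∈ T, q ∉ W.π s
  | T, .dep ps q => ∀ s₁ ∈ T, ∀ s₂ ∈ T,
      W.π s₁ ∩ {p | p ∈ ps} ≠ W.π s₂ ∩ {p | p ∈ ps} ∨ W.π s₁ ∩ {q} = W.π s₂ ∩ {q}
  | T, .ndep _ _ => T = ∅
  | T, .or φ ψ => ∃ T₁ T₂ : Set S, T = T₁ ∪ T₂ ∧ W.Sat T₁ φ ∧ W.Sat T₂ ψ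
  | T, .cor φ ψ => W.Sat T φ ∨ W.Sat T ψ
  | T, .and φ ψ => W.Sat T φ ∧ W.Sat T ψ
  | T, .box φ => W.Sat {s' | ∃ s ∈ T, W.R s s'} φ
  | T, .dia φ => ∃ T' : Set S, W.Sat T' φ ∧ ∀ s ∈ T, ∃ s' ∈ T', W.R s s'

/-- For inputs of algorithms, atomic propositions are given by their names, which are arbitrary
finite bit strings. -/
abbrev Name : Type := List Bool

/-- The finite alphabet over which inputs are written. -/
inductive Token
  | bit (b : Bool)
  | endName | sep
  | prop | neg | dep | top | bot | or | cor | and | box | dia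
  deriving DecidableEq, Fintype

/-- The bits of the name, followed by an end marker. -/
def encodeName (p : Name) : List Token :=
  p.map Token.bit ++ [Token.endName]

/-- Formulae are written in prefix notation. -/
def encodeFml : Fml Name → List Token
  | .top => [Token.top]
  | .bot => [Token.bot]
  | .prop q => Token.prop :: encodeName q
  | .nprop q => Token.neg :: Token.prop :: encodeName q
  | .dep ps q => Token.dep :: ps.flatMap encodeName ++ Token.sep :: encodeName q
  | .ndep ps q => Token.neg :: Token.dep :: ps.flatMap encodeName ++ Token.sep :: encodeName q
  | .or φ ψ => Token.or :: encodeFml φ ++ encodeFml ψ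
  | .cor φ ψ => Token.cor :: encodeFml φ ++ encodeFml ψ
  | .and φ ψ => Token.and :: encodeFml φ ++ encodeFml ψ
  | .box φ => Token.box :: encodeFml φ
  | .dia φ => Token.dia :: encodeFml φ

/-- An input `(W, T, φ)` of the model checking problem: a finite non-empty Kripke structure with
finitely many labels at every world, a team of it and a formula, as explicit finite data. -/
structure Input where
  /-- the number of worlds; the worlds are the elements of `Fin n` -/
  n : ℕ
  n_pos : 0 < n
  /-- adjacency matrix of the accessibility relation -/
  adj : Fin n → Fin n → Bool
  /-- a list of the propositions that hold at a world -/
  labels : Fin n → List Name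
  /-- characteristic function of the team -/
  team : Fin n → Bool
  /-- the formula -/
  fml : Fml Name

namespace Input

/-- The Kripke structure `W` of the input `(W, T, φ)`. -/
def kripke (I : Input) : Kripke Name (Fin I.n) where
  R i j := I.adj i j = true
  π i := {p | p ∈ I.labels i}

/-- The team `T` of the input `(W, T, φ)`. -/
def teamSet (I : Input) : Set (Fin I.n) :=
  {i | I.team i = true}

/-- The record of one world: the bit that tells whether it is in the team, its row of the adjacency
matrix, and its labels. -/
def encodeWorld (I : Input) (i : Fin I.n) : List Token :=
  Token.bit (I.team i) :: (List.ofFn fun j => Token.bit (I.adj i j)) ++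
    Token.sep :: (I.labels i).flatMap encodeName ++ [Token.sep]

/-- The string that encodes the input: the records of all worlds, followed by the formula. -/
def encode (I : Input) : List Token :=
  (List.finRange I.n).flatMap I.encodeWorld ++ encodeFml I.fml

end Input

/-- The model checking problem for `MDL_k[M]` as a formal language: the set of all strings that
encode some `(W, T, φ)` with `φ ∈ MDL_k[M]` such that `φ` is true in the team `T` of `W`. -/
def modelChecking (k : ℕ) (M : Set Op) : Language Token :=
  {w | ∃ I : Input, I.encode = w ∧ I.fml ∈ fragment Name k M ∧ I.kripke.Sat I.teamSet I.fml}

/-- The complexity class `P`: the characteristic function of the language, on all strings over the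
alphabet, is computed by a deterministic (multi-stack) Turing machine in a number of steps that is
bounded by a polynomial in the length of the string. -/
def InP {Γ : Type} (L : Language Γ) : Prop :=
  ∃ f : List Γ → Bool, (∀ w, f w = true ↔ w ∈ L) ∧
    Nonempty (Turing.TM2ComputableInPolyTime (id : List Γ → List Γ) Computability.encodeBool f)

end MDL

/-! Without conjunction and modalities a formula is a dependence disjunction of literals and of
positive or negated dependence atoms. A team satisfies `dep(p₁, …, pₙ; q)` exactly when a single
Boolean function of the values of `p₁, …, pₙ` yields the value of `q` at all of its worlds. A letter
is such a function, of `k` variables. Once a letter is chosen for every occurrence of a positive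
atom, truth becomes a condition on each world separately: some disjunct must cover it. Hence the
formula is true iff some string of `φ.numDep` letters covers all worlds of the team
(`Kripke.sat_iff_exists_covers`).

The second claim is a halving argument. The larger of the two subteams on which `q` is constant
satisfies the atom, so every positive atom can absorb at least half of what the earlier disjuncts
have left over. With more than `log₂ |S|` positive atoms less than one world remains
(`Kripke.exists_sat_subset`, `Kripke.sat_of_card_lt`).

Both facts together give a polynomial algorithm. There are `2 ^ 2 ^ k` letters, hence `(2 ^ 2 ^ k) ^
d = (2 ^ d) ^ 2 ^ k` strings for `d` positive atoms; this is at most `N ^ 2 ^ k` if `2 ^ d ≤ N`,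
where `N` is the length of the input. The machine therefore makes `N ^ 2 ^ k` rounds, by a nest of
`2 ^ k` loops of `N` rounds each. Every round tests one string and passes to the next one as a
counter does. It never compares `d` with a logarithm: it accepts if a string passed the test or if
the counter did not overflow. In the latter case `N < 2 ^ d`, and `N` is at least the number of
worlds, so the halving argument shows that the formula is true (`searchStep_iterate_iff`,
`Input.sat_iff`).

To obtain a Turing machine, the algorithm is written in a small language whose only loops run `N`
times. Its programs have polynomial running time by construction, and their translation into
multi-stack machines is verified once and for all (`Prog.runsIn_eval`,
`Prog.nonempty_tm2ComputableInPolyTime`). A parser, specified as an automaton with four counters,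
recognises the encodings of inputs with a formula of the fragment (`Config.accepts_init`,
`Input.accepts_iff`). -/

/-! ### Programs with bounded loops over finitely many stacks -/

namespace StackProg

open Turing

/-- Programs over registers with values in `σ` and contents, indexed by `K`, over the alphabet `Γ`.
The only loops are `rep p`: they run `p` as often as the input is long. -/
inductive Prog (σ K Γ : Type)
  | load (f : σ → σ)
  | push (k : K) (a : Γ)
  | pop (k : K) (b : Option Γ → Prog σ K Γ)
  | cases (b : σ → Prog σ K Γ)
  | seq (p q : Prog σ K Γ)
  | rep (p : Prog σ K Γ)

/-- A type `M` of memory states that hold one stack for each element of `K`. -/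
structure Store (K Γ M : Type) [DecidableEq K] where
  /-- the content of a stack -/
  get : M → K → List Γ
  /-- replaces the content of a stack -/
  set : M → K → List Γ → M
  get_set : ∀ m k l, get (set m k l) = Function.update (get m) k l

namespace Prog

variable {σ K Γ M : Type} [DecidableEq K] (St : Store K Γ M)

/-- The state transformation of a program, where all loops are run `N` times. -/
def eval (N : ℕ) : Prog σ K Γ → σ × M → σ × M
  | load f, c => (f c.1, c.2)
  | push k a, c => (c.1, St.set c.2 k (a :: St.get c.2 k))
  | pop k b, c => (b (St.get c.2 k).head?).eval N (c.1, St.set c.2 k (St.get c.2 k).tail)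
  | cases b, c => (b c.1).eval N c
  | seq p q, c => q.eval N (p.eval N c)
  | rep p, c => (p.eval N)^[N] c

/-- A bound on the running time of a program, as a polynomial in the number of repetitions. -/
noncomputable def cost [Fintype σ] [Fintype Γ] : Prog σ K Γ → Polynomial ℕ
  | load _ => 1
  | push _ _ => 1
  -- The branch taken depends on the data; the sum over all branches bounds each of them by one
  -- polynomial.
  | pop _ b => 1 + ∑ o, (b o).cost
  | cases b => 1 + ∑ s, (b s).cost
  | seq p q => p.cost + q.cost
  -- Each of the `N` rounds costs one step at the loop head besides the body, leaving the loop costs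
  -- one more, and refilling the counter takes `N + 1` steps.
  | rep p => Polynomial.X * p.cost + 2 * Polynomial.X + 2

/-- The control points of a program. -/
inductive Lab : Prog σ K Γ → Type
  | load {f} : Lab (.load f)
  | push {k a} : Lab (.push k a)
  | pop {k b} : Lab (.pop k b)
  | popBody {k b} (o : Option Γ) (l : Lab (b o)) : Lab (.pop k b)
  | cases {b} : Lab (.cases b)
  | casesBody {b} (s : σ) (l : Lab (b s)) : Lab (.cases b)
  | seqLeft {p q} (l : Lab p) : Lab (.seq p q)
  | seqRight {p q} (l : Lab q) : Lab (.seq p q)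
  | repHead {p} : Lab (.rep p)
  | repReset {p} : Lab (.rep p)
  | repBody {p} (l : Lab p) : Lab (.rep p)

/-- The control point at which a program starts. -/
def entry : (p : Prog σ K Γ) → p.Lab
  | load _ => .load
  | push _ _ => .push
  | pop _ _ => .pop
  | cases _ => .cases
  | seq p _ => .seqLeft p.entry
  | rep _ => .repHead

instance finite_lab [Finite σ] [Finite Γ] : (p : Prog σ K Γ) → Finite p.Lab
  | load _ => Finite.of_surjective (fun _ : Unit => Lab.load) fun l => by cases l; exact ⟨(), rfl⟩
  | push _ _ =>
    Finite.of_surjective (fun _ : Unit => Lab.push) fun l => by cases l; exact ⟨(), rfl⟩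
  | pop _ b => by
    have := fun o => finite_lab (b o)
    refine Finite.of_surjective
      (fun x : Option (Σ o, (b o).Lab) => x.elim Lab.pop fun y => Lab.popBody y.1 y.2) fun l => ?_
    cases l with
    | pop => exact ⟨none, rfl⟩
    | popBody o l => exact ⟨some ⟨o, l⟩, rfl⟩
  | cases b => by
    have := fun o => finite_lab (b o)
    refine Finite.of_surjective
      (fun x : Option (Σ o, (b o).Lab) => x.elim Lab.cases fun y => Lab.casesBody y.1 y.2)
      fun l => ?_
    cases l with
    | cases => exact ⟨none, rfl⟩
    | casesBody o l => exact ⟨some ⟨o, l⟩, rfl⟩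
  | seq p q => by
    have := finite_lab p
    have := finite_lab q
    refine Finite.of_surjective (Sum.elim (Lab.seqLeft (q := q)) (Lab.seqRight (p := p)))
      fun l => ?_
    cases l with
    | seqLeft l => exact ⟨Sum.inl l, rfl⟩
    | seqRight l => exact ⟨Sum.inr l, rfl⟩
  | rep p => by
    have := finite_lab p
    refine Finite.of_surjective
      (Sum.elim (fun b : Bool => if b then Lab.repHead else Lab.repReset) (Lab.repBody (p := p)))
      fun l => ?_
    cases l with
    | repHead => exact ⟨Sum.inl true, rfl⟩
    | repReset => exact ⟨Sum.inl false, rfl⟩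
    | repBody l => exact ⟨Sum.inr l, rfl⟩

/-- Each unit of cost pays for at most one pushed symbol. The bound limits the time needed to empty
the stacks at the end. -/
theorem length_get_eval_le [Fintype σ] [Fintype Γ] (N : ℕ) (p : Prog σ K Γ) (c : σ × M) (k : K) :
    (St.get (p.eval St N c).2 k).length ≤ (St.get c.2 k).length + p.cost.eval N := by
  induction p generalizing c with
  | load f => simp [eval]
  | push k' a =>
    by_cases h : k = k'
    · subst h; simp [eval, cost, St.get_set]
    · simp [eval, cost, St.get_set, Function.update_of_ne h]
  | pop k' b ih =>
    have h1 := ih (St.get c.2 k').head? (c.1, St.set c.2 k' (St.get c.2 k').tail)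
    have h2 : (St.get (St.set c.2 k' (St.get c.2 k').tail) k).length ≤ (St.get c.2 k).length := by
      by_cases h : k = k'
      · subst h; simp [St.get_set]
      · simp [St.get_set, Function.update_of_ne h]
    have h3 : (b (St.get c.2 k').head?).cost.eval N ≤ ∑ o, (b o).cost.eval N :=
      Finset.single_le_sum (f := fun o => (b o).cost.eval N) (fun _ _ => Nat.zero_le _)
        (Finset.mem_univ _)
    simp only [eval, cost, Polynomial.eval_add, Polynomial.eval_finsetSum, Polynomial.eval_one]
    simp only at h1
    omega
  | cases b ih =>
    have h1 := ih c.1 c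
    have h3 : (b c.1).cost.eval N ≤ ∑ o, (b o).cost.eval N :=
      Finset.single_le_sum (f := fun o => (b o).cost.eval N) (fun _ _ => Nat.zero_le _)
        (Finset.mem_univ _)
    simp only [eval, cost, Polynomial.eval_add, Polynomial.eval_finsetSum, Polynomial.eval_one]
    omega
  | seq p q ihp ihq =>
    have h1 := ihp c
    have h2 := ihq (p.eval St N c)
    simp only [eval, cost, Polynomial.eval_add]
    omega
  | rep p ih =>
    have h : ∀ n, (St.get ((p.eval St N)^[n] c).2 k).length
        ≤ (St.get c.2 k).length + n * p.cost.eval N := by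
      intro n
      induction n with
      | zero => simp
      | succ n ihn =>
        rw [Function.iterate_succ_apply']
        have := ih ((p.eval St N)^[n] c)
        rw [Nat.add_one_mul]
        omega
    have := h N
    simp only [eval, cost, Polynomial.eval_add, Polynomial.eval_mul, Polynomial.eval_X]
    omega

end Prog

/-! ### Translation into stack machines -/

/-- The stacks of the machine that runs a program: an input and an output stack, the stacks of the
program, and two unary counters for each control point. -/
inductive Stack (K L : Type)
  | inp
  | out
  | var (k : K)
  | ctr (l : L) (b : Bool)
  deriving DecidableEq

instance {K L : Type} [Finite K] [Finite L] : Finite (Stack K L) := by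
  let f : Stack K L → Option (Option (K ⊕ (L × Bool)))
    | .inp => none
    | .out => some none
    | .var k => some (some (Sum.inl k))
    | .ctr l b => some (some (Sum.inr (l, b)))
  refine Finite.of_injective f ?_
  intro a b h
  cases a <;> cases b <;> simp_all [f]

/-- The alphabets of the stacks of the machine. -/
@[reducible] def Alph (Tok Γ : Type) {K L : Type} : Stack K L → Type
  | .inp => Tok
  | .out => Bool
  | .var _ => Γ
  | .ctr _ _ => Unit

/-- The stacks of the machine, given the input, the memory and the counters. -/
def contents {Tok K Γ L : Type} (w : List Tok) (g : K → List Γ) (ctr : L → Bool → ℕ) :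
    (k : Stack K L) → List (Alph Tok Γ k)
  | .inp => w
  | .out => []
  | .var k => g k
  | .ctr l b => List.replicate (ctr l b) ()

section Stacks

variable {Tok K Γ L : Type} [DecidableEq K] [DecidableEq L] (w : List Tok) (g : K → List Γ)
  (ctr : L → Bool → ℕ)

theorem update_contents_inp (w' : List Tok) :
    Function.update (contents w g ctr) .inp w' = contents w' g ctr := by
  funext k
  cases k <;> simp [Function.update, contents]

theorem update_contents_var (k : K) (l : List Γ) :
    Function.update (contents w g ctr) (.var k) l = contents w (Function.update g k l) ctr := by
  funext k'
  cases k' with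
  | var k' =>
    by_cases h : k' = k
    · subst h; simp [contents]
    · simp [Function.update, contents, h]
  | _ => simp [Function.update, contents]

theorem update_contents_ctr (l : L) (b : Bool) (n : ℕ) :
    Function.update (contents w g ctr) (.ctr l b) (List.replicate n ()) =
      contents w g (Function.update ctr l (Function.update (ctr l) b n)) := by
  funext k'
  cases k' with
  | ctr l' b' =>
    by_cases h : l' = l
    · subst h
      by_cases h : b' = b
      · subst h; simp [contents]
      · simp [Function.update, contents, h]
    · simp [Function.update, contents, h]
  | _ => simp [Function.update, contents]

end Stacks

/-- `b` is the configuration reached from `a` after some number `n ≤ t` of steps. -/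
def RunsIn {C : Type} (f : C → Option C) (a : C) (b : Option C) (t : ℕ) : Prop :=
  ∃ n ≤ t, (flip bind f)^[n] (some a) = b

namespace RunsIn

variable {C : Type} {f : C → Option C} {a b : C} {c : Option C} {t u : ℕ}

theorem refl (a : C) : RunsIn f a (some a) 0 := ⟨0, le_rfl, rfl⟩

theorem trans (h : RunsIn f a (some b) t) (h' : RunsIn f b c u) : RunsIn f a c (t + u) := by
  obtain ⟨n, hn, e⟩ := h
  obtain ⟨m, hm, e'⟩ := h'
  exact ⟨m + n, by omega, by rw [Function.iterate_add_apply, e, e']⟩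

theorem mono (h : RunsIn f a c t) (htu : t ≤ u) : RunsIn f a c u := by
  obtain ⟨n, hn, e⟩ := h
  exact ⟨n, by omega, e⟩

theorem step (h : f a = c) : RunsIn f a c 1 := ⟨1, le_rfl, h⟩

theorem head (h : f a = some b) (h' : RunsIn f b c t) : RunsIn f a c (t + 1) :=
  ((RunsIn.step h).trans h').mono (by omega)

end RunsIn

namespace Prog

variable {σ K Γ M Tok L : Type} [DecidableEq K] [DecidableEq L]

/-- The internal states of the machine: the registers of the program, the symbol popped last, and
a flag. -/
abbrev Var (σ Γ : Type) : Type := σ × Option Γ × Bool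

/-- The machine code at the control points of a program that occurs in a larger program with
control points `L`; it continues at `exit` after termination. -/
def code : {p : Prog σ K Γ} → p.Lab → (p.Lab → L) → L →
    TM2.Stmt (Alph Tok Γ : Stack K L → Type) L (Var σ Γ)
  | .load f, .load, _, exit => .load (fun v => (f v.1, v.2)) (.goto fun _ => exit)
  | .push k a, .push, _, exit => .push (.var k) (fun _ => a) (.goto fun _ => exit)
  | .pop k b, .pop, e, _ =>
      .pop (.var k) (fun v o => (v.1, o, v.2.2)) (.goto fun v => e (.popBody v.2.1 (b v.2.1).entry))
  | .pop _ _, .popBody o l, e, exit => code l (fun l' => e (.popBody o l')) exit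
  | .cases b, .cases, e, _ => .goto fun v => e (.casesBody v.1 (b v.1).entry)
  | .cases _, .casesBody s l, e, exit => code l (fun l' => e (.casesBody s l')) exit
  | .seq _ q, .seqLeft l, e, _ => code l (fun l' => e (.seqLeft l')) (e (.seqRight q.entry))
  | .seq _ _, .seqRight l, e, exit => code l (fun l' => e (.seqRight l')) exit
  | .rep p, .repHead, e, _ =>
      .pop (.ctr (e .repHead) false) (fun v o => (v.1, v.2.1, o.isSome))
        (.branch (fun v => v.2.2)
          (.push (.ctr (e .repHead) true) (fun _ => ()) (.goto fun _ => e (.repBody p.entry)))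
          (.goto fun _ => e .repReset))
  | .rep _, .repReset, e, exit =>
      .pop (.ctr (e .repHead) true) (fun v o => (v.1, v.2.1, o.isSome))
        (.branch (fun v => v.2.2)
          (.push (.ctr (e .repHead) false) (fun _ => ()) (.goto fun _ => e .repReset))
          (.goto fun _ => exit))
  | .rep _, .repBody l, e, _ => code l (fun l' => e (.repBody l')) (e .repHead)

variable [Fintype σ] [Fintype Γ] (St : Store K Γ M)
  (m : L → TM2.Stmt (Alph Tok Γ : Stack K L → Type) L (Var σ Γ))

/-- A loop has two counters, for the rounds to come and the rounds done. They are back at `N` and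
`0` on exit, so that an enclosing loop finds them ready for its next round. Injectivity of `e`
separates the counters of a loop from those of the loops in its body. The last popped symbol and the
flag are scratch space, hence the unspecified `h'`. -/
theorem runsIn_eval (N : ℕ) (p : Prog σ K Γ) (e : p.Lab → L) (he : Function.Injective e)
    (exit : L) (hm : ∀ l, m (e l) = code l e exit) (w : List Tok) (ctr : L → Bool → ℕ)
    (hctr : ∀ l, ctr (e l) false = N ∧ ctr (e l) true = 0) (c : σ × M) (h : Option Γ × Bool) :
    ∃ h' : Option Γ × Bool, RunsIn (TM2.step m)
      ⟨some (e p.entry), (c.1, h), contents w (St.get c.2) ctr⟩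
      (some ⟨some exit, ((p.eval St N c).1, h'), contents w (St.get (p.eval St N c).2) ctr⟩)
      (p.cost.eval N) := by
  induction p generalizing exit ctr c h with
  | load f =>
    refine ⟨h, ?_⟩
    simp only [cost, Polynomial.eval_one]
    apply RunsIn.step
    simp [entry, hm, code, eval]
  | push k a =>
    refine ⟨h, ?_⟩
    simp only [cost, Polynomial.eval_one]
    apply RunsIn.step
    simp [entry, hm, code, eval, contents, update_contents_var, St.get_set]
  | pop k b ih =>
    obtain ⟨h', H⟩ := ih (St.get c.2 k).head? (fun l' => e (.popBody _ l'))
      (fun x y hxy => by simpa using he hxy) exit (fun l => hm _) ctr (fun l => hctr _)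
      (c.1, St.set c.2 k (St.get c.2 k).tail) ((St.get c.2 k).head?, h.2)
    refine ⟨h', ?_⟩
    have h3 : (b (St.get c.2 k).head?).cost.eval N ≤ ∑ o, (b o).cost.eval N :=
      Finset.single_le_sum (f := fun o => (b o).cost.eval N) (fun _ _ => Nat.zero_le _)
        (Finset.mem_univ _)
    simp only [eval, cost, Polynomial.eval_add, Polynomial.eval_finsetSum, Polynomial.eval_one]
    refine (RunsIn.head ?_ H).mono (by omega)
    simp [entry, hm, code, contents, update_contents_var, St.get_set]
  | cases b ih =>
    obtain ⟨h', H⟩ := ih c.1 (fun l' => e (.casesBody _ l'))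
      (fun x y hxy => by simpa using he hxy) exit (fun l => hm _) ctr (fun l => hctr _) c h
    refine ⟨h', ?_⟩
    have h3 : (b c.1).cost.eval N ≤ ∑ o, (b o).cost.eval N :=
      Finset.single_le_sum (f := fun o => (b o).cost.eval N) (fun _ _ => Nat.zero_le _)
        (Finset.mem_univ _)
    simp only [eval, cost, Polynomial.eval_add, Polynomial.eval_finsetSum, Polynomial.eval_one]
    refine (RunsIn.head ?_ H).mono (by omega)
    simp [entry, hm, code]
  | seq p q ihp ihq =>
    obtain ⟨h1, H1⟩ := ihp (fun l' => e (.seqLeft l')) (fun x y hxy => by simpa using he hxy)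
      (e (.seqRight q.entry)) (fun l => hm _) ctr (fun l => hctr _) c h
    obtain ⟨h2, H2⟩ := ihq (fun l' => e (.seqRight l')) (fun x y hxy => by simpa using he hxy)
      exit (fun l => hm _) ctr (fun l => hctr _) (p.eval St N c) h1
    exact ⟨h2, by simpa [eval, cost, entry] using H1.trans H2⟩
  | rep p ih =>
    have hm1 := hm .repHead
    have hm2 := hm .repReset
    simp only [code] at hm1 hm2
    -- The counters with `a` rounds of this loop to come and `b` rounds done; all other loops are as
    -- in `ctr`.
    let C : ℕ → ℕ → L → Bool → ℕ := fun a b =>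
      Function.update ctr (e .repHead) (fun x => if x then b else a)
    have hC : C N 0 = ctr := by
      funext l x
      by_cases hl : l = (e .repHead)
      · subst hl
        cases x <;> simp [C, hctr .repHead]
      · simp [C, Function.update_of_ne hl]
    have hup : ∀ a b n x, Function.update (C a b) (e .repHead) (Function.update (C a b (e .repHead)) x n) =
        if x then C a n else C n b := by
      intro a b n x
      funext l y
      by_cases hl : l = (e .repHead)
      · subst hl; cases x <;> cases y <;> simp [C]
      · cases x <;> simp [C, Function.update_of_ne hl]
    -- One round: the head shifts a tick to the second counter. The induction hypothesis applies to
    -- the body because its control points differ from the head, so `C` leaves their counters alone.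
    have body : ∀ a b (c : σ × M) h, ∃ h' : Option Γ × Bool, RunsIn (TM2.step m)
        ⟨some (e (.repHead)), (c.1, h), contents w (St.get c.2) (C (a + 1) b)⟩
        (some ⟨some (e (.repHead)), ((p.eval St N c).1, h'),
          contents w (St.get (p.eval St N c).2) (C a (b + 1))⟩) (p.cost.eval N + 1) := by
      intro a b c h
      obtain ⟨h', R⟩ := ih (fun l' => e (.repBody l')) (fun x y hxy => by simpa using he hxy)
        (e (.repHead)) (fun l => hm _) (C a (b + 1)) (fun l => by
          have : e (.repBody l) ≠ (e .repHead) := fun h => by simpa using he h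
          simp only [C, Function.update_of_ne this]
          exact hctr _) c (h.1, true)
      refine ⟨h', RunsIn.head ?_ R⟩
      have h1 : contents w (St.get c.2) (C (a + 1) b) (.ctr (e .repHead) false) =
        () :: List.replicate a () := by simp [contents, C, List.replicate_succ]
      have h2 : () :: contents w (St.get c.2) (C a b) (.ctr (e .repHead) true) =
        List.replicate (b + 1) () := by simp [contents, C, List.replicate_succ]
      have h3 := update_contents_ctr w (St.get c.2) (C (a + 1) b) (e .repHead) false a
      have h4 := update_contents_ctr w (St.get c.2) (C a b) (e .repHead) true (b + 1)
      rw [hup] at h3 h4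
      simp only [Bool.false_eq_true, if_false, if_true] at h3 h4
      simp only [TM2.step, hm1, TM2.stepAux, h1, List.head?_cons, Option.isSome_some,
        cond_true, List.tail_cons, h3, h2, h4]
    have loop : ∀ a b (c : σ × M) h, ∃ h' : Option Γ × Bool, RunsIn (TM2.step m)
        ⟨some (e (.repHead)), (c.1, h), contents w (St.get c.2) (C a b)⟩
        (some ⟨some (e (.repReset)), (((p.eval St N)^[a] c).1, h'),
          contents w (St.get ((p.eval St N)^[a] c).2) (C 0 (a + b))⟩)
        (a * (p.cost.eval N + 1) + 1) := by
      intro a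
      induction a with
      | zero =>
        intro b c h
        refine ⟨(h.1, false), (RunsIn.step ?_).mono (by omega)⟩
        have h1 : contents w (St.get c.2) (C 0 b) (.ctr (e .repHead) false) = [] := by simp [contents, C]
        have h2 := update_contents_ctr w (St.get c.2) (C 0 b) (e .repHead) false 0
        rw [hup] at h2
        simp only [List.replicate_zero, Bool.false_eq_true, if_false] at h2
        simp only [TM2.step, hm1, TM2.stepAux, h1, List.head?_nil, Option.isSome_none,
          cond_false, List.tail_nil, Function.iterate_zero, id, zero_add, h2]
      | succ a iha =>
        intro b c h
        obtain ⟨h1, R1⟩ := body a b c h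
        obtain ⟨h2, R2⟩ := iha (b + 1) (p.eval St N c) h1
        refine ⟨h2, ?_⟩
        rw [Function.iterate_succ_apply, show a + 1 + b = a + (b + 1) by omega]
        exact (R1.trans R2).mono (by rw [Nat.add_one_mul]; omega)
    -- The ticks are poured back into the first counter, one per step.
    have back : ∀ a b (c : σ × M) h, ∃ h' : Option Γ × Bool, RunsIn (TM2.step m)
        ⟨some (e (.repReset)), (c.1, h), contents w (St.get c.2) (C a b)⟩
        (some ⟨some exit, (c.1, h'), contents w (St.get c.2) (C (a + b) 0)⟩) (b + 1) := by
      intro a b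
      induction b generalizing a with
      | zero =>
        intro c h
        refine ⟨(h.1, false), RunsIn.step ?_⟩
        have h1 : contents w (St.get c.2) (C a 0) (.ctr (e .repHead) true) = [] := by simp [contents, C]
        have h2 := update_contents_ctr w (St.get c.2) (C a 0) (e .repHead) true 0
        rw [hup] at h2
        simp only [List.replicate_zero, if_true] at h2
        simp only [TM2.step, hm2, TM2.stepAux, h1, List.head?_nil, Option.isSome_none,
          cond_false, List.tail_nil, add_zero, h2]
      | succ b ihb =>
        intro c h
        obtain ⟨h', R⟩ := ihb (a + 1) c (h.1, true)
        rw [show a + (b + 1) = a + 1 + b by omega]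
        refine ⟨h', RunsIn.head ?_ R⟩
        have h1 : contents w (St.get c.2) (C a (b + 1)) (.ctr (e .repHead) true) =
          () :: List.replicate b () := by simp [contents, C, List.replicate_succ]
        have h2 : () :: contents w (St.get c.2) (C a b) (.ctr (e .repHead) false) =
          List.replicate (a + 1) () := by simp [contents, C, List.replicate_succ]
        have h3 := update_contents_ctr w (St.get c.2) (C a (b + 1)) (e .repHead) true b
        have h4 := update_contents_ctr w (St.get c.2) (C a b) (e .repHead) false (a + 1)
        rw [hup] at h3 h4
        simp only [Bool.false_eq_true, if_false, if_true] at h3 h4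
        simp only [TM2.step, hm2, TM2.stepAux, h1, List.head?_cons, Option.isSome_some,
          cond_true, List.tail_cons, h3, h2, h4]
    obtain ⟨h1, R1⟩ := loop N 0 c h
    obtain ⟨h2, R2⟩ := back 0 (N + 0) ((p.eval St N)^[N] c) h1
    refine ⟨h2, ?_⟩
    simp only [add_zero, zero_add, hC] at R1 R2
    simp only [eval, cost, Polynomial.eval_add, Polynomial.eval_mul, Polynomial.eval_X,
      Polynomial.eval_ofNat]
    exact (R1.trans R2).mono (by rw [Nat.mul_add]; omega)

end Prog

end StackProg

namespace StackProg

open Turing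

/-! ### The complete machine -/

namespace Prog

variable {σ K Γ M Tok : Type} [DecidableEq K]

/-- The labels of the complete machine. -/
inductive MainLab (p : Prog σ K Γ)
  | start
  | run (l : p.Lab)
  | clean

instance (p : Prog σ K Γ) [Finite σ] [Finite Γ] : Finite p.MainLab :=
  Finite.of_surjective
    (fun x : Option (Option p.Lab) => x.elim .start fun y => y.elim .clean .run) fun l => by
      cases l with
      | start => exact ⟨none, rfl⟩
      | clean => exact ⟨some none, rfl⟩
      | run l => exact ⟨some (some l), rfl⟩

section

variable {L : Type} [DecidableEq L]

/-- Increments the first counters of the given control points. -/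
def pushCounters (ls : List L) (q : TM2.Stmt (Alph Tok Γ : Stack K L → Type) L (Var σ Γ)) :
    TM2.Stmt (Alph Tok Γ : Stack K L → Type) L (Var σ Γ) :=
  ls.foldr (fun l q => .push (.ctr l false) (fun _ => ()) q) q

/-- A single machine statement may act on many stacks, so all counters grow within one step per
input symbol. This is how they come to hold the length of the input. -/
theorem stepAux_pushCounters (ls : List L)
    (q : TM2.Stmt (Alph Tok Γ : Stack K L → Type) L (Var σ Γ)) (v : Var σ Γ) (w : List Tok)
    (g : K → List Γ) (ctr : L → Bool → ℕ) :
    TM2.stepAux (pushCounters ls q) v (contents w g ctr) =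
      TM2.stepAux q v (contents w g fun l b => if b then ctr l b else ctr l b + ls.count l) := by
  induction ls generalizing ctr with
  | nil => simp [pushCounters]
  | cons l ls ih =>
    have h1 : () :: contents w g ctr (.ctr l false) = List.replicate (ctr l false + 1) () := by
      simp [contents, List.replicate_succ]
    have h2 := update_contents_ctr w g ctr l false (ctr l false + 1)
    have h3 : TM2.stepAux (pushCounters (l :: ls) q) v (contents w g ctr) =
        TM2.stepAux (pushCounters ls q) v (contents w g (Function.update ctr l
          (Function.update (ctr l) false (ctr l false + 1)))) := by
      rw [← h2, ← h1]
      rfl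
    rw [h3, ih]
    congr 2
    funext l' b
    cases b
    · by_cases h : l' = l
      · subst h; simp; omega
      · simp [Function.update_of_ne h, List.count_cons_of_ne (Ne.symm h)]
    · by_cases h : l' = l
      · subst h; simp
      · simp [Function.update_of_ne h]

/-- Pops the given stacks and records in the flag whether one of them was nonempty. -/
def popAll (ks : List (Stack K L)) (q : TM2.Stmt (Alph Tok Γ : Stack K L → Type) L (Var σ Γ)) :
    TM2.Stmt (Alph Tok Γ : Stack K L → Type) L (Var σ Γ) :=
  ks.foldr (fun k q => .pop k (fun v o => (v.1, v.2.1, v.2.2 || o.isSome)) q) q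

/-- The absence of repetitions ensures that every listed stack loses just one symbol, and that the
flag reports about the stacks as they were at the start. -/
theorem stepAux_popAll (ks : List (Stack K L)) (hks : ks.Nodup)
    (q : TM2.Stmt (Alph Tok Γ : Stack K L → Type) L (Var σ Γ)) (v : Var σ Γ)
    (S : (k : Stack K L) → List (Alph Tok Γ k)) :
    TM2.stepAux (popAll ks q) v S =
      TM2.stepAux q (v.1, v.2.1, v.2.2 || ks.any fun k => (S k).head?.isSome)
        fun k => if k ∈ ks then (S k).tail else S k := by
  induction ks generalizing v S with
  | nil => simp [popAll]
  | cons k ks ih =>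
    rw [List.nodup_cons] at hks
    have h3 : TM2.stepAux (popAll (k :: ks) q) v S =
        TM2.stepAux (popAll ks q) (v.1, v.2.1, v.2.2 || (S k).head?.isSome)
          (Function.update S k (S k).tail) := rfl
    rw [h3, ih hks.2]
    congr 1
    · simp only [List.any_cons, Bool.or_assoc, Prod.mk.injEq, true_and]
      congr 2
      rw [Bool.eq_iff_iff, List.any_eq_true, List.any_eq_true]
      refine exists_congr fun k' => and_congr_right fun hk' => ?_
      have hne : k' ≠ k := by rintro rfl; exact hks.1 hk'
      rw [Function.update_of_ne hne]
    · funext k'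
      by_cases h : k' = k
      · subst h; simp [hks.1]
      · simp [h]

end

open scoped Classical in
/-- The code of the complete machine: it moves its input to the stack `V` while setting the
counters, runs the program, empties all stacks and writes the answer. -/
noncomputable def mainCode [Fintype σ] [Finite K] [Finite Γ] [Inhabited Γ] (p : Prog σ K Γ) (V : K)
    (emb : Tok → Γ) (s₀ : σ) (acc : σ → Bool) :
    p.MainLab → TM2.Stmt (Alph Tok Γ : Stack K p.MainLab → Type) p.MainLab (Var σ Γ)
  | .start => .pop .inp (fun v o => (v.1, o.map emb, o.isSome)) <|
      .branch (fun v => v.2.2)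
        (.push (.var V) (fun v => v.2.1.getD default) <|
          pushCounters (Fintype.ofFinite p.MainLab).elems.toList <| .goto fun _ => .start)
        (.goto fun _ => .run p.entry)
  | .run l => code l .run .clean
  | .clean => .load (fun v => (v.1, v.2.1, false)) <|
      popAll (Fintype.ofFinite (Stack K p.MainLab)).elems.toList <|
      .branch (fun v => v.2.2) (.goto fun _ => .clean) <|
      -- The final configuration must carry the initial internal state, so the registers are reset
      -- once the answer has been pushed.
      .push .out (fun v => acc v.1) <| .load (fun _ => (s₀, none, false)) .halt

/-! ### Loading the input, cleaning up, and the polynomial time bound -/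

section

variable [Fintype σ] [Finite K] [Fintype Γ] [Inhabited Γ] (p : Prog σ K Γ) (V : K)
    (emb : Tok → Γ) (s₀ : σ) (acc : σ → Bool)

open scoped Classical in
-- Every round moves one symbol, which reverses the input, and adds one tick to each first counter.
-- The counter value `n` and the content `g` are general for the sake of the induction.
theorem runsIn_start (w : List Tok) (g : K → List Γ) (n : ℕ) (v : Var σ Γ) (hv : v.1 = s₀) :
    ∃ h, RunsIn (TM2.step (p.mainCode V emb s₀ acc))
      ⟨some .start, v, contents w g fun _ b => if b then 0 else n⟩
      (some ⟨some (.run p.entry), (s₀, h), contents []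
        (Function.update g V ((w.map emb).reverse ++ g V)) fun _ b => if b then 0 else n + w.length⟩)
      (w.length + 1) := by
  induction w generalizing g n v with
  | nil =>
    refine ⟨(none, false), RunsIn.step ?_⟩
    have h1 : ∀ ctr, contents ([] : List Tok) g ctr (.inp : Stack K p.MainLab) = [] := fun _ => rfl
    have h2 := update_contents_inp ([] : List Tok) g
      (fun (_ : p.MainLab) b => if b then 0 else n) []
    simp only [TM2.step, mainCode, TM2.stepAux, h1, List.head?_nil, Option.isSome_none,
      cond_false, List.tail_nil, h2, hv]
    simp
  | cons a w ih =>
    obtain ⟨h, R⟩ := ih (Function.update g V (emb a :: g V)) (n + 1) (s₀, some (emb a), true) rfl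
    refine ⟨h, ?_⟩
    have e : (((a :: w).map emb).reverse ++ g V) = (w.map emb).reverse ++ emb a :: g V := by simp
    rw [e, List.length_cons, show n + (w.length + 1) = n + 1 + w.length by omega]
    simp only [Function.update_self, Function.update_idem] at R
    refine RunsIn.head ?_ R
    set ctr : p.MainLab → Bool → ℕ := fun _ b => if b then 0 else n
    have h1 : contents (a :: w) g ctr (.inp : Stack K p.MainLab) = a :: w := rfl
    have h2 := update_contents_inp (a :: w) g ctr w
    have h3 : emb a :: contents w g ctr (.var V) = emb a :: g V := rfl
    have h4 := update_contents_var w g ctr V (emb a :: g V)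
    simp only [TM2.step, mainCode, TM2.stepAux, h1, List.head?_cons, Option.isSome_some,
      cond_true, List.tail_cons, h2, h3, h4, Option.map_some, Option.getD_some,
      stepAux_pushCounters, hv]
    congr 3
    funext l b
    have : List.count l (Fintype.ofFinite p.MainLab).elems.toList = 1 :=
      List.count_eq_one_of_mem (Finset.nodup_toList _)
        (by rw [Finset.mem_toList]; exact (Fintype.ofFinite p.MainLab).complete l)
    cases b <;> simp [ctr, this]

open scoped Classical in
-- Every round shortens all stacks at once, so a common bound on their heights bounds the number of
-- rounds; the extra one notices that nothing was left.
theorem runsIn_clean (s : σ) (h : Option Γ × Bool) (B : ℕ) (g : K → List Γ)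
    (ctr : p.MainLab → Bool → ℕ) (hg : ∀ k, (g k).length ≤ B) (hctr : ∀ l b, ctr l b ≤ B) :
    RunsIn (TM2.step (p.mainCode V emb s₀ acc)) ⟨some .clean, (s, h), contents ([] : List Tok) g ctr⟩
      (some ⟨none, (s₀, none, false), Function.update (fun _ => []) .out [acc s]⟩) (B + 1) := by
  have key : ∀ (g : K → List Γ) (ctr : p.MainLab → Bool → ℕ),
      (fun k : Stack K p.MainLab =>
        if k ∈ (Fintype.ofFinite (Stack K p.MainLab)).elems.toList
          then (contents ([] : List Tok) g ctr k).tail else contents ([] : List Tok) g ctr k) =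
      contents ([] : List Tok) (fun k => (g k).tail) (fun l b => ctr l b - 1) := by
    intro g ctr
    funext k
    rw [if_pos (by rw [Finset.mem_toList]; exact (Fintype.ofFinite _).complete _)]
    cases k with
    | inp => rfl
    | out => rfl
    | var k => rfl
    | ctr l b => simp [contents]
  have step : ∀ (h : Option Γ × Bool) (g : K → List Γ) (ctr : p.MainLab → Bool → ℕ),
      TM2.step (p.mainCode V emb s₀ acc) ⟨some .clean, (s, h), contents ([] : List Tok) g ctr⟩ =
      some (if (Fintype.ofFinite (Stack K p.MainLab)).elems.toList.any
          (fun k => (contents ([] : List Tok) g ctr k).head?.isSome)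
        then ⟨some .clean, (s, h.1, true),
          contents ([] : List Tok) (fun k => (g k).tail) (fun l b => ctr l b - 1)⟩
        else ⟨none, (s₀, none, false),
          Function.update (contents ([] : List Tok) (fun k => (g k).tail) (fun l b => ctr l b - 1))
            .out [acc s]⟩) := by
    intro h g ctr
    have hout : ∀ (P : Prop) [Decidable P], (if P
        then (contents ([] : List Tok) g ctr (.out : Stack K p.MainLab)).tail
        else contents ([] : List Tok) g ctr .out) = [] := by
      intro P _
      split <;> rfl
    simp only [TM2.step, mainCode, TM2.stepAux, stepAux_popAll _ (Finset.nodup_toList _), key,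
      Bool.false_or, hout]
    cases (Fintype.ofFinite (Stack K p.MainLab)).elems.toList.any
          (fun k => (contents ([] : List Tok) g ctr k).head?.isSome) <;> rfl
  have empty : ∀ (g : K → List Γ) (ctr : p.MainLab → Bool → ℕ),
      (Fintype.ofFinite (Stack K p.MainLab)).elems.toList.any
        (fun k => (contents ([] : List Tok) g ctr k).head?.isSome) = false →
      contents ([] : List Tok) (fun k => (g k).tail) (fun l b => ctr l b - 1) = fun _ => [] := by
    intro g ctr h
    rw [List.any_eq_false] at h
    rw [← key]
    funext k
    have := h k (by rw [Finset.mem_toList]; exact (Fintype.ofFinite _).complete _)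
    rw [if_pos (by rw [Finset.mem_toList]; exact (Fintype.ofFinite _).complete _)]
    cases hk : contents ([] : List Tok) g ctr k with
    | nil => rfl
    | cons a l => simp [hk] at this
  induction B generalizing h g ctr with
  | zero =>
    have hany : (Fintype.ofFinite (Stack K p.MainLab)).elems.toList.any
        (fun k => (contents ([] : List Tok) g ctr k).head?.isSome) = false := by
      rw [List.any_eq_false]
      intro k _
      cases k with
      | inp => simp [contents]
      | out => simp [contents]
      | var k => simpa [contents] using hg k
      | ctr l b => simpa [contents] using hctr l b
    refine RunsIn.step ?_
    rw [step, hany, empty _ _ hany]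
    rfl
  | succ B ih =>
    cases hany : (Fintype.ofFinite (Stack K p.MainLab)).elems.toList.any
        (fun k => (contents ([] : List Tok) g ctr k).head?.isSome) with
    | false =>
      refine (RunsIn.step ?_).mono (by omega)
      rw [step, hany, empty _ _ hany]
      rfl
    | true =>
      refine RunsIn.head ?_ (ih (h.1, true) (fun k => (g k).tail) (fun l b => ctr l b - 1)
        (fun k => ?_) fun l b => ?_)
      · rw [step, hany]
        rfl
      · have := hg k
        simp only [List.length_tail]
        omega
      · have := hctr l b
        change ctr l b - 1 ≤ B
        omega

/-- A function that is computed by a program is computable in polynomial time. -/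
theorem nonempty_tm2ComputableInPolyTime [Fintype Tok] (St : Store K Γ M) (m₀ : M)
    (hm₀ : ∀ k, St.get m₀ k = []) (f : List Tok → Bool)
    (hf : ∀ w, f w = acc (p.eval St w.length (s₀, St.set m₀ V (w.map emb).reverse)).1) :
    Nonempty (TM2ComputableInPolyTime (id : List Tok → List Tok) Computability.encodeBool f) := by
  classical
  have : Fintype K := Fintype.ofFinite K
  have : Fintype p.MainLab := Fintype.ofFinite _
  have : Fintype (Stack K p.MainLab) := Fintype.ofFinite _
  let tm : FinTM2 :=
    { K := Stack K p.MainLab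
      k₀ := .inp
      k₁ := .out
      Γ := Alph Tok Γ
      Λ := p.MainLab
      main := .start
      σ := Var σ Γ
      initialState := (s₀, none, false)
      Γk₀Fin := inferInstanceAs (Fintype Tok)
      m := p.mainCode V emb s₀ acc }
  have main : ∀ w : List Tok, RunsIn tm.step (initList tm w) (some (haltList tm [f w]))
      ((3 + 2 * Polynomial.X + 2 * p.cost : Polynomial ℕ).eval w.length) := by
    intro w
    obtain ⟨h1, R1⟩ := p.runsIn_start V emb s₀ acc w (fun _ => []) 0 (s₀, none, false) rfl
    obtain ⟨h2, R2⟩ := runsIn_eval St (p.mainCode V emb s₀ acc) w.length p .run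
      (fun a b h => by simpa using h) .clean (fun l => rfl) []
      (fun _ b => if b then 0 else 0 + w.length) (fun l => by simp)
      (s₀, St.set m₀ V (w.map emb).reverse) h1
    have hget : St.get (St.set m₀ V (w.map emb).reverse) =
        Function.update (fun _ => []) V ((w.map emb).reverse ++ []) := by
      rw [St.get_set, List.append_nil, show St.get m₀ = fun _ => [] from funext hm₀]
    rw [hget] at R2
    -- No stack is higher than the input length plus the running time of the program, and no counter
    -- exceeds the input length.
    have R3 := p.runsIn_clean V emb s₀ acc
      (p.eval St w.length (s₀, St.set m₀ V (w.map emb).reverse)).1 h2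
      (w.length + p.cost.eval w.length)
      (St.get (p.eval St w.length (s₀, St.set m₀ V (w.map emb).reverse)).2)
      (fun _ b => if b then 0 else 0 + w.length) (fun k => by
        refine (length_get_eval_le St _ _ _ _).trans (Nat.add_le_add_right ?_ _)
        simp only [hget]
        by_cases hk : k = V
        · subst hk; simp
        · simp [Function.update_of_ne hk])
      (fun l b => by cases b <;> simp)
    have R := ((R1.trans R2).trans R3).mono (u := (3 + 2 * Polynomial.X + 2 * p.cost :
      Polynomial ℕ).eval w.length) (by
        simp only [Polynomial.eval_add, Polynomial.eval_mul, Polynomial.eval_X,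
          Polynomial.eval_ofNat]
        omega)
    have e1 : initList tm w = ⟨some .start, (s₀, none, false),
        contents w (fun _ => []) fun _ b => if b then 0 else 0⟩ := by
      refine congrArg (TM2.Cfg.mk (some MainLab.start) (s₀, none, false)) (funext fun k => ?_)
      cases k with
      | ctr l b => cases b <;> rfl
      | _ => rfl
    have e2 : haltList tm [f w] =
        ⟨none, (s₀, none, false), Function.update (fun _ => []) .out [f w]⟩ := by
      refine congrArg (TM2.Cfg.mk none (s₀, none, false)) (funext fun k => ?_)
      cases k with
      | _ => rfl
    rw [e1, e2, hf w]
    exact R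
  choose n hn hrun using main
  exact ⟨{
    tm := tm
    inputAlphabet := Equiv.refl Tok
    outputAlphabet := Equiv.refl Bool
    time := 3 + 2 * Polynomial.X + 2 * p.cost
    outputsFun := fun w => by
      have e1 : List.map (Equiv.refl Tok).invFun (id w) = w := by
        simp [Equiv.refl]
      exact {
        steps := n w
        evals_in_steps :=
          (congrArg (fun x => (flip bind tm.step)^[n w] (some (initList tm x))) e1).trans (hrun w)
        steps_le_m := hn w } }⟩

end

end Prog

end StackProg

namespace MDL

/-! ### Truth in the fragments without conjunction -/

/-- The truth values of a list of propositions as a vector of length `k`, the last value first. -/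
def register (k : ℕ) (l : List Bool) : Fin k → Bool := fun j => l.reverse.getD j false

/-- Padding with `false` loses no information between lists of equal length, and nothing is cut off
while the length is at most `k`. This is where the bound on the arity enters. -/
theorem register_injective {k : ℕ} {l l' : List Bool} (h : l.length = l'.length)
    (hk : l.length ≤ k) (e : register k l = register k l') : l = l' := by
  rw [← List.reverse_inj]
  refine List.ext_getElem (by simpa using h) fun i h₁ h₂ => ?_
  have := congrFun e ⟨i, by simp at h₁; omega⟩
  simpa only [register, List.getD_eq_getElem _ _ h₁, List.getD_eq_getElem _ _ h₂] using this

/-- A letter prescribes the value of the dependent proposition for all values of the others. -/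
abbrev Letter (k : ℕ) : Type := (Fin k → Bool) → Bool

open scoped Classical in
/-- Whether a disjunction covers a world, if its dependence atoms are assigned letters. -/
noncomputable def covers {AP : Type*} (k : ℕ) (v : AP → Bool) : Fml AP → List (Letter k) → Bool
  | .prop q, _ => v q
  | .nprop q, _ => !v q
  | .dep ps q, cs => cs.head?.any fun f => f (register k (ps.map v)) == v q
  | .or φ ψ, cs => covers k v φ (cs.take φ.numDep) || covers k v ψ (cs.drop φ.numDep)
  | _, _ => false

/-- Formulae built from literals and dependence atoms by the dependence disjunction. -/
def Fml.Disj {AP : Type*} : Fml AP → Prop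
  | .prop _ | .nprop _ | .dep _ _ | .ndep _ _ => True
  | .or φ ψ => φ.Disj ∧ ψ.Disj
  | _ => False

theorem disj_of_ops_subset {AP : Type*} {φ : Fml AP} (h : φ.ops ⊆ {Op.or, Op.neg, Op.dep}) :
    φ.Disj := by
  induction φ with
  | or φ ψ ih₁ ih₂ =>
    simp only [Fml.ops, Set.union_subset_iff] at h
    exact ⟨ih₁ h.1.2, ih₂ h.2⟩
  | top | bot => simp [Fml.ops] at h
  | cor | and | box | dia => simp [Fml.ops, Set.union_subset_iff, Set.insert_subset_iff] at h
  | _ => trivial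

theorem Kripke.sat_dep_iff {AP S : Type*} (W : Kripke AP S) (T : Set S) (ps : List AP) (q : AP) :
    W.Sat T (.dep ps q) ↔ ∀ s₁ ∈ T, ∀ s₂ ∈ T, (∀ p ∈ ps, p ∈ W.π s₁ ↔ p ∈ W.π s₂) →
      (q ∈ W.π s₁ ↔ q ∈ W.π s₂) := by
  simp only [Kripke.Sat]
  refine forall₂_congr fun s₁ _ => forall₂_congr fun s₂ _ => ?_
  rw [← imp_iff_not_or]
  refine imp_congr ?_ ?_
  · simp only [Set.ext_iff, Set.mem_inter_iff, Set.mem_ofPred_eq, and_congr_left_iff]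
  · simp [Set.ext_iff]

/-- With the letters fixed, coverage is tested world by world, so a splitting of the team need not
be guessed: it can be read off from which disjunct covers which world. The letters are handed to the
two sides of a disjunction in the order of the atoms. A negated atom covers no world, in accordance
with its truth in the empty team only. -/
theorem Kripke.sat_iff_exists_covers {AP S : Type*} (W : Kripke AP S) (v : S → AP → Bool)
    (hv : ∀ s p, v s p = true ↔ p ∈ W.π s) (k : ℕ) (φ : Fml AP) (hφ : φ.Disj)
    (hk : φ.ArityLE k) (T : Set S) :
    W.Sat T φ ↔ ∃ cs : List (Letter k), cs.length = φ.numDep ∧ ∀ s ∈ T, covers k (v s) φ cs := by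
  classical
  induction φ generalizing T with
  | prop q => simp [Kripke.Sat, covers, Fml.numDep, hv]
  | nprop q => simp [Kripke.Sat, covers, Fml.numDep, ← hv]
  | ndep ps q => simp [Kripke.Sat, covers, Fml.numDep, Set.eq_empty_iff_forall_notMem]
  | or φ ψ ih₁ ih₂ =>
    simp only [Kripke.Sat, ih₁ hφ.1 hk.1, ih₂ hφ.2 hk.2, Fml.numDep, covers]
    constructor
    · rintro ⟨T₁, T₂, rfl, ⟨cs₁, h₁, c₁⟩, ⟨cs₂, h₂, c₂⟩⟩
      refine ⟨cs₁ ++ cs₂, by simp [h₁, h₂], fun s hs => ?_⟩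
      rw [List.take_left' h₁, List.drop_left' h₁]
      rcases hs with hs | hs
      · simp [c₁ s hs]
      · simp [c₂ s hs]
    · rintro ⟨cs, h, c⟩
      -- Both sides of the split are taken as large as possible; they may overlap.
      refine ⟨{s ∈ T | covers k (v s) φ (cs.take φ.numDep)},
        {s ∈ T | covers k (v s) ψ (cs.drop φ.numDep)}, ?_, ⟨cs.take φ.numDep, by simp [h], ?_⟩,
        ⟨cs.drop φ.numDep, by simp [h], ?_⟩⟩
      · ext s
        have := c s
        simp only [Bool.or_eq_true] at this
        simp only [Set.mem_union, Set.mem_ofPred_eq]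
        tauto
      · exact fun s hs => hs.2
      · exact fun s hs => hs.2
  | dep ps q =>
    rw [Kripke.sat_dep_iff]
    simp only [Fml.numDep, covers]
    constructor
    · intro h
      -- The letter answers `true` on a vector iff some world of the team with this vector satisfies
      -- `q`. By the dependence, all worlds with this vector then do; vectors that do not occur get
      -- `false`.
      refine ⟨[fun r => decide (∃ s ∈ T, register k (ps.map (v s)) = r ∧ v s q)], rfl,
        fun s hs => ?_⟩
      simp only [List.head?_cons, Option.any_some, beq_iff_eq]
      rw [Bool.eq_iff_iff, decide_eq_true_iff]
      constructor
      · rintro ⟨s', hs', e, hq⟩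
        have e := register_injective (by simp) (by simpa using (show ps.length ≤ k from hk)) e
        rw [List.map_inj_left] at e
        rw [hv, ← h s' hs' s hs fun p hp => by rw [← hv, ← hv, e p hp], ← hv, hq]
      · exact fun hq => ⟨s, hs, rfl, hq⟩
    · rintro ⟨cs, hcs, c⟩ s₁ h₁ s₂ h₂ h
      obtain ⟨f, rfl⟩ := List.length_eq_one_iff.1 hcs
      have c₁ := c s₁ h₁
      have c₂ := c s₂ h₂
      simp only [List.head?_cons, Option.any_some, beq_iff_eq] at c₁ c₂
      have : ps.map (v s₁) = ps.map (v s₂) := List.map_inj_left.2 fun p hp => by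
        rw [Bool.eq_iff_iff, hv, hv, h p hp]
      rw [← hv, ← hv, ← c₁, ← c₂, this]
  | _ => exact hφ.elim

/-! ### Many dependence atoms make a disjunction true -/

/-- A disjunction is true in a subteam such that each of its positive dependence atoms halves the
rest of the team. -/
theorem Kripke.exists_sat_subset {AP S : Type*} (W : Kripke AP S) (φ : Fml AP) (hφ : φ.Disj)
    (T : Set S) (hT : T.Finite) :
    ∃ T' ⊆ T, W.Sat T' φ ∧ (T \ T').ncard * 2 ^ φ.numDep ≤ T.ncard := by
  induction φ generalizing T with
  | prop q => exact ⟨∅, by simp, by simp [Kripke.Sat], by simp [Fml.numDep]⟩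
  | nprop q => exact ⟨∅, by simp, by simp [Kripke.Sat], by simp [Fml.numDep]⟩
  | ndep ps q => exact ⟨∅, by simp, by simp [Kripke.Sat], by simp [Fml.numDep]⟩
  | or φ ψ ih₁ ih₂ =>
    obtain ⟨T₁, hT₁, s₁, c₁⟩ := ih₁ hφ.1 T hT
    -- The second disjunct only has to deal with what the first one has left, so the halvings
    -- multiply.
    obtain ⟨T₂, hT₂, s₂, c₂⟩ := ih₂ hφ.2 (T \ T₁) (hT.subset Set.sdiff_subset)
    refine ⟨T₁ ∪ T₂, Set.union_subset hT₁ (hT₂.trans Set.sdiff_subset), ⟨T₁, T₂, rfl, s₁, s₂⟩, ?_⟩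
    rw [← Set.sdiff_sdiff, Fml.numDep, add_comm, pow_add, ← mul_assoc]
    exact (Nat.mul_le_mul_right _ c₂).trans c₁
  | dep ps q =>
    -- On a subteam where `q` is constant the dependence holds, whatever the other propositions are.
    have hsat : ∀ b : Prop, W.Sat {s ∈ T | q ∈ W.π s ↔ b} (.dep ps q) := fun b => by
      rw [Kripke.sat_dep_iff]
      exact fun s₁ h₁ s₂ h₂ _ => h₁.2.trans h₂.2.symm
    have hcard : {s ∈ T | q ∈ W.π s ↔ True}.ncard + {s ∈ T | q ∈ W.π s ↔ False}.ncard =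
        T.ncard := by
      rw [← Set.ncard_union_eq (by
        rw [Set.disjoint_left]; rintro s ⟨_, h₁⟩ ⟨_, h₂⟩; tauto)
        (hT.subset (Set.sep_subset _ _)) (hT.subset (Set.sep_subset _ _))]
      congr 1
      ext s
      simp only [Set.mem_union, Set.mem_ofPred_eq]
      tauto
    have hdiff : ∀ b, (T \ {s ∈ T | q ∈ W.π s ↔ b}) = {s ∈ T | q ∈ W.π s ↔ ¬b} := by
      intro b
      ext s
      simp only [Set.mem_sdiff, Set.mem_ofPred_eq]
      tauto
    -- The larger of the two parts is absorbed, and at most half of the team remains.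
    rcases le_total {s ∈ T | q ∈ W.π s ↔ True}.ncard {s ∈ T | q ∈ W.π s ↔ False}.ncard with h | h
    · refine ⟨_, Set.sep_subset _ _, hsat False, ?_⟩
      rw [hdiff, not_false_eq_true, Fml.numDep]
      omega
    · refine ⟨_, Set.sep_subset _ _, hsat True, ?_⟩
      rw [hdiff, not_true_eq_false, Fml.numDep]
      omega
  | _ => exact hφ.elim

/-- The number of uncovered worlds, multiplied by `2 ^ φ.numDep`, is at most `|S|`, so it is zero
and the satisfying subteam is all of `T`. -/
theorem Kripke.sat_of_card_lt {AP S : Type*} [Fintype S] (W : Kripke AP S) (φ : Fml AP)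
    (hφ : φ.Disj) (h : Fintype.card S < 2 ^ φ.numDep) (T : Set S) : W.Sat T φ := by
  obtain ⟨T', hT', hs, hc⟩ := W.exists_sat_subset φ hφ T T.toFinite
  have h₁ : T.ncard ≤ Fintype.card S := by
    rw [← Nat.card_eq_fintype_card, ← Set.ncard_univ]
    exact Set.ncard_le_ncard (Set.subset_univ _)
  have h₂ : (T \ T').ncard = 0 := by
    by_contra hne
    have := Nat.le_mul_of_pos_left (2 ^ φ.numDep) (Nat.pos_of_ne_zero hne)
    omega
  rw [Set.ncard_eq_zero (T.toFinite.subset Set.sdiff_subset), Set.sdiff_eq_empty] at h₂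
  rwa [← hT'.antisymm h₂]

theorem card_lt_of_logb_lt {n m : ℕ} (hn : 0 < n) (h : Real.logb 2 n < m) : n < 2 ^ m := by
  rw [Real.logb_lt_iff_lt_rpow one_lt_two (by exact_mod_cast hn), Real.rpow_natCast] at h
  exact_mod_cast h

end MDL

namespace MDL

open StackProg

/-! ### Registers and stacks of the model checker -/

/-- The symbols on the stacks of the model checker. -/
abbrev Sym (k : ℕ) : Type := Token ⊕ Letter k

/-- The states of the parser. The arguments count the further propositions that may occur before
the separator of the current dependence atom. -/
inductive ParseState (k : ℕ)
  | start | adj | labels | label | fml | neg | name | fail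
  | deps (c : Fin (k + 1))
  | depsName (c : Fin (k + 1))
  deriving Fintype

/-- The part of a formula that is being read during its evaluation. -/
inductive Kind
  | idle | neg | lit (b : Bool) | dep | depQ | ndep | ndepQ
  deriving Fintype

/-- The part of the record of a world that is being read; the argument tells whether the world is
in the team. -/
inductive RecordPart
  | start
  | adj (b : Bool)
  | labels (b : Bool)
  | none
  deriving Fintype

/-- The registers of the model checker. -/
structure Reg (k : ℕ) where
  parse : ParseState k
  first : Bool
  kind : Kind
  vec : Fin k → Bool
  found : Bool
  mismatch : Bool
  cov : Bool
  part : RecordPart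
  allCov : Bool
  good : Bool
  overflow : Bool
  carry : Bool
  answer : Bool

instance (k : ℕ) : Finite (Reg k) := by
  refine Finite.of_injective (fun r : Reg k => ((r.parse, r.first, r.kind, r.vec, r.found,
    r.mismatch), r.cov, r.part, r.allCov, r.good, r.overflow, r.carry, r.answer)) ?_
  intro r r' h
  cases r
  cases r'
  simp only [Prod.mk.injEq] at h
  simp [h]

/-- The stacks of the model checker. -/
inductive Stk
  | inp | main | mainR | form | formR | name | nameR | labs | labsR | choice | choiceR
  | len | lenR | recs | pend
  deriving DecidableEq

instance : Finite Stk := by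
  refine Finite.of_injective (fun x => (⟨x.ctorIdx, by cases x <;> decide⟩ : Fin 15)) ?_
  intro x y h
  cases x <;> cases y <;> first | rfl | simp [Stk.ctorIdx] at h

/-- The contents of the stacks of the model checker. -/
structure Mem (k : ℕ) where
  inp : List (Sym k)
  main : List (Sym k)
  mainR : List (Sym k)
  form : List (Sym k)
  formR : List (Sym k)
  name : List (Sym k)
  nameR : List (Sym k)
  labs : List (Sym k)
  labsR : List (Sym k)
  choice : List (Sym k)
  choiceR : List (Sym k)
  len : List (Sym k)
  lenR : List (Sym k)
  recs : List (Sym k)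
  pend : List (Sym k)

namespace Mem

variable {k : ℕ}

/-- The content of a stack. -/
def get (m : Mem k) : Stk → List (Sym k)
  | .inp => m.inp
  | .main => m.main
  | .mainR => m.mainR
  | .form => m.form
  | .formR => m.formR
  | .name => m.name
  | .nameR => m.nameR
  | .labs => m.labs
  | .labsR => m.labsR
  | .choice => m.choice
  | .choiceR => m.choiceR
  | .len => m.len
  | .lenR => m.lenR
  | .recs => m.recs
  | .pend => m.pend

/-- Replaces the content of a stack. -/
def set (m : Mem k) : Stk → List (Sym k) → Mem k
  | .inp, l => { m with inp := l }
  | .main, l => { m with main := l }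
  | .mainR, l => { m with mainR := l }
  | .form, l => { m with form := l }
  | .formR, l => { m with formR := l }
  | .name, l => { m with name := l }
  | .nameR, l => { m with nameR := l }
  | .labs, l => { m with labs := l }
  | .labsR, l => { m with labsR := l }
  | .choice, l => { m with choice := l }
  | .choiceR, l => { m with choiceR := l }
  | .len, l => { m with len := l }
  | .lenR, l => { m with lenR := l }
  | .recs, l => { m with recs := l }
  | .pend, l => { m with pend := l }

theorem get_set (m : Mem k) (x : Stk) (l : List (Sym k)) :
    (m.set x l).get = Function.update m.get x l := by
  funext y
  cases x <;> cases y <;> rfl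

theorem ext_get {m m' : Mem k} (h : ∀ x, m.get x = m'.get x) : m = m' := by
  cases m
  cases m'
  simp only [mk.injEq]
  exact ⟨h .inp, h .main, h .mainR, h .form, h .formR, h .name, h .nameR, h .labs, h .labsR,
    h .choice, h .choiceR, h .len, h .lenR, h .recs, h .pend⟩

/-- The stacks as a store for programs. -/
def store (k : ℕ) : Store Stk (Sym k) (Mem k) := ⟨get, set, get_set⟩

/-- All stacks are empty. -/
def empty (k : ℕ) : Mem k := ⟨[], [], [], [], [], [], [], [], [], [], [], [], [], [], []⟩

end Mem

/-- The programs from which the model checker is built. -/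
abbrev MProg (k : ℕ) : Type := Prog (Reg k) Stk (Sym k)

namespace MProg

variable {k : ℕ}

/-- Does nothing. -/
def skip : MProg k := .load id

/-- Runs the body on the topmost symbol of a stack, if there is one, and removes it. -/
def next (x : Stk) (b : Sym k → MProg k) : MProg k := .pop x fun o => o.elim skip b

/-- Moves the content of a stack to another one, which reverses it. -/
def move (x y : Stk) : MProg k := .rep (next x fun a => .push y a)

/-- Empties a stack. -/
def clear (x : Stk) : MProg k := .rep (next x fun _ => skip)

/-- The effect of a program. -/
def run (N : ℕ) (p : MProg k) (c : Reg k × Mem k) : Reg k × Mem k := p.eval (Mem.store k) N c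

section Run

variable (N : ℕ) (r : Reg k) (m : Mem k)

theorem run_load (f : Reg k → Reg k) : run N (.load f) (r, m) = (f r, m) := rfl

theorem run_push (x : Stk) (a : Sym k) : run N (.push x a) (r, m) = (r, m.set x (a :: m.get x)) :=
  rfl

theorem run_skip (c : Reg k × Mem k) : run N skip c = c := rfl

theorem run_seq (p q : MProg k) (c : Reg k × Mem k) :
    run N (.seq p q) c = run N q (run N p c) := rfl

theorem run_rep (p : MProg k) (c : Reg k × Mem k) : run N (.rep p) c = (run N p)^[N] c := rfl

theorem run_pop_nil (x : Stk) (b : Option (Sym k) → MProg k) (h : m.get x = []) :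
    run N (.pop x b) (r, m) = run N (b none) (r, m) := by
  have e : m.set x [] = m := Mem.ext_get fun y => by
    rw [Mem.get_set]
    by_cases hy : y = x
    · subst hy; simp [h]
    · simp [Function.update_of_ne hy]
  have : run N (.pop x b) (r, m) = run N (b (m.get x).head?) (r, m.set x (m.get x).tail) := rfl
  rw [this, h, List.tail_nil, e]
  rfl

theorem run_pop_cons (x : Stk) (b : Option (Sym k) → MProg k) (a : Sym k) (l : List (Sym k))
    (h : m.get x = a :: l) : run N (.pop x b) (r, m) = run N (b (some a)) (r, m.set x l) := by
  have : run N (.pop x b) (r, m) = run N (b (m.get x).head?) (r, m.set x (m.get x).tail) := rfl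
  rw [this, h]
  rfl

theorem run_next_nil (x : Stk) (b : Sym k → MProg k) (h : m.get x = []) :
    run N (next x b) (r, m) = (r, m) := run_pop_nil N r m x _ h

theorem run_next_cons (x : Stk) (b : Sym k → MProg k) (a : Sym k) (l : List (Sym k))
    (h : m.get x = a :: l) : run N (next x b) (r, m) = run N (b a) (r, m.set x l) :=
  run_pop_cons N r m x _ a l h

/-- A loop always makes `N` rounds, but once its stack is empty the remaining rounds change nothing.
This reduces a loop over a stack to as many rounds as it takes to empty it. -/
theorem run_rep_next {x : Stk} {b : Sym k → MProg k} {c : Reg k × Mem k} {n : ℕ}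
    (h : (run N (next x b))^[n] c = (r, m)) (hn : n ≤ N) (hx : m.get x = []) :
    run N (.rep (next x b)) c = (r, m) := by
  obtain ⟨d, rfl⟩ := Nat.exists_eq_add_of_le' hn
  rw [run_rep, Function.iterate_add_apply, h]
  exact Function.iterate_fixed (run_next_nil _ r m x b hx) d

theorem run_move {x y : Stk} (hxy : x ≠ y) (h : (m.get x).length ≤ N) :
    run N (move x y) (r, m) = (r, (m.set x []).set y ((m.get x).reverse ++ m.get y)) := by
  refine run_rep_next N _ _ (n := (m.get x).length) ?_ h (by simp [Mem.get_set, hxy])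
  generalize hl : m.get x = l
  clear h
  induction l generalizing m with
  | nil =>
    refine congrArg (Prod.mk r) (Mem.ext_get fun z => ?_)
    by_cases hz : z = x
    · subst hz; simp [Mem.get_set, hxy, hl]
    · by_cases hz' : z = y
      · subst hz'; simp [Mem.get_set]
      · simp [Mem.get_set, hz, hz']
  | cons a l ih =>
    rw [List.length_cons, Function.iterate_succ_apply, run_next_cons N r m x _ a l hl, run_push,
      ih _ (by simp [Mem.get_set, hxy])]
    refine congrArg (Prod.mk r) (Mem.ext_get fun z => ?_)
    by_cases hz' : z = y
    · subst hz'; simp [Mem.get_set, Ne.symm hxy]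
    · by_cases hz : z = x
      · subst hz; simp [Mem.get_set, hxy]
      · simp [Mem.get_set, hz, hz']

theorem run_clear {x : Stk} (h : (m.get x).length ≤ N) :
    run N (clear x) (r, m) = (r, m.set x []) := by
  refine run_rep_next N _ _ (n := (m.get x).length) ?_ h (by simp [Mem.get_set])
  generalize hl : m.get x = l
  clear h
  induction l generalizing m with
  | nil =>
    refine congrArg (Prod.mk r) (Mem.ext_get fun z => ?_)
    by_cases hz : z = x
    · subst hz; simp [Mem.get_set, hl]
    · simp [Mem.get_set, hz]
  | cons a l ih =>
    rw [List.length_cons, Function.iterate_succ_apply, run_next_cons N r m x _ a l hl, run_skip,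
      ih _ (by simp [Mem.get_set])]
    refine congrArg (Prod.mk r) (Mem.ext_get fun z => ?_)
    by_cases hz : z = x
    · subst hz; simp [Mem.get_set]
    · simp [Mem.get_set, hz]

end Run

theorem iterate_trans {α : Type*} {f : α → α} {n m : ℕ} {a b c : α} (h : f^[n] a = b)
    (h' : f^[m] b = c) : f^[n + m] a = c := by
  rw [add_comm, Function.iterate_add_apply, h, h']

/-! ### Looking up a name among the labels of a world -/

/-- Compares the name on the stack `name` with the labels on the stack `labs`, symbol by symbol. -/
def compareSym : Sym k → MProg k
  | .inl (.bit b) => .pop .name fun o => match o with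
    | some (.inl (.bit b')) => .seq (.push .nameR (.inl (.bit b')))
        (.load fun r => { r with mismatch := r.mismatch || b != b' })
    | _ => .load fun r => { r with mismatch := true }
  | .inl .endName => .pop .name fun o => match o with
    | none => .seq (.load fun r => { r with found := r.found || !r.mismatch, mismatch := false })
        (move .nameR .name)
    | some x => .seq (.push .name x) (.seq (.load fun r => { r with mismatch := false })
        (move .nameR .name))
  | _ => skip

/-- The step of the loop `member`. -/
def memberStep : MProg k := next .labs fun a => .seq (.push .labsR a) (compareSym a)

/-- Decides whether the name on the stack `name` occurs on the stack `labs`. -/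
def member : MProg k := .seq (.rep memberStep) (move .labsR .labs)

/-- A string of tokens as stack content. -/
def toks (l : List Token) : List (Sym k) := l.map Sum.inl

/-- The bits of a name as stack content. -/
def bits (p : Name) : List (Sym k) := toks (p.map Token.bit)

theorem toks_append (l l' : List Token) : (toks (l ++ l') : List (Sym k)) = toks l ++ toks l' :=
  List.map_append

theorem length_toks (l : List Token) : (toks l : List (Sym k)).length = l.length :=
  List.length_map _

theorem bits_cons (b : Bool) (p : Name) : (bits (b :: p) : List (Sym k)) =
  .inl (.bit b) :: bits p := rfl

theorem length_bits (p : Name) : (bits p : List (Sym k)).length = p.length := by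
  simp [bits, toks]

theorem encodeName_cons (b : Bool) (p : Name) : encodeName (b :: p) = .bit b :: encodeName p := rfl

/-- The invariant inside a label: `x` is the unread part of the label, `p` the part of the name
still to be compared, `q` the part already moved aside, and `mi` tells whether a difference has been
seen. The end marker restores the name for the next label, whichever of the two strings is longer.
-/
theorem iterate_memberStep (N : ℕ) (x : Name) (r : Reg k) (m : Mem k) (mi : Bool) (p q : Name)
    (rest : List (Sym k)) (hN : q.length + p.length ≤ N) :
    (run N memberStep)^[(encodeName x).length]
      ({ r with mismatch := mi },
       { m with labs := toks (encodeName x) ++ rest, name := bits p, nameR := (bits q).reverse }) =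
      ({ r with mismatch := false, found := r.found || (!mi && decide (x = p)) },
       { m with labs := rest, labsR := (toks (encodeName x)).reverse ++ m.labsR,
                name := bits q ++ bits p, nameR := [] }) := by
  induction x generalizing m mi p q with
  | nil =>
    cases p with
    | nil =>
      have h1 : (run N memberStep)^[1] ({ r with mismatch := mi },
          ({ m with labs := .inl .endName :: rest, name := [], nameR := (bits q).reverse } :
            Mem k)) = run N (move .nameR .name)
          ({ r with mismatch := false, found := r.found || !mi },
          { m with labs := rest, labsR := .inl .endName :: m.labsR, name := [],
                   nameR := (bits q).reverse }) := rfl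
      refine h1.trans ?_
      rw [run_move _ _ _ (by decide) (by simpa [Mem.get, length_bits] using hN)]
      simp [Mem.get, Mem.set, bits, toks, encodeName]
    | cons b p =>
      have h1 : (run N memberStep)^[1] ({ r with mismatch := mi },
          ({ m with labs := .inl .endName :: rest, name := bits (b :: p),
                    nameR := (bits q).reverse } : Mem k)) = run N (move .nameR .name)
          ({ r with mismatch := false },
          { m with labs := rest, labsR := .inl .endName :: m.labsR, name := bits (b :: p),
                   nameR := (bits q).reverse }) := rfl
      refine h1.trans ?_
      rw [run_move _ _ _ (by decide) (by
        simp only [List.length_cons] at hN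
        simp only [Mem.get, List.length_reverse, length_bits]
        omega)]
      simp [Mem.get, Mem.set, bits, toks, encodeName]
  | cons a x ih =>
    rw [encodeName_cons, List.length_cons, Function.iterate_succ_apply]
    cases p with
    | nil =>
      have h1 : run N memberStep ({ r with mismatch := mi },
          ({ m with labs := toks (.bit a :: encodeName x) ++ rest, name := bits [],
                    nameR := (bits q).reverse } : Mem k)) = ({ r with mismatch := true },
          { m with labs := toks (encodeName x) ++ rest, labsR := .inl (.bit a) :: m.labsR,
                   name := bits [], nameR := (bits q).reverse }) := rfl
      rw [h1, ih { m with labsR := .inl (.bit a) :: m.labsR } true [] q hN]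
      simp [toks]
    | cons b p =>
      have h1 : run N memberStep ({ r with mismatch := mi },
          ({ m with labs := toks (.bit a :: encodeName x) ++ rest, name := bits (b :: p),
                    nameR := (bits q).reverse } : Mem k)) = ({ r with mismatch := mi || a != b },
          { m with labs := toks (encodeName x) ++ rest, labsR := .inl (.bit a) :: m.labsR,
                   name := bits p, nameR := .inl (.bit b) :: (bits q).reverse }) := rfl
      have h2 : (.inl (.bit b) :: (bits q).reverse : List (Sym k)) =
          (bits (q ++ [b])).reverse := by simp [bits, toks]
      rw [h1, h2, ih { m with labsR := .inl (.bit a) :: m.labsR } (mi || a != b) p (q ++ [b])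
        (by simp only [List.length_append, List.length_cons, List.length_nil] at hN ⊢; omega)]
      have h3 : (!(mi || a != b) && decide (x = p)) = (!mi && decide (a :: x = b :: p)) := by
        cases mi <;> cases a <;> cases b <;> simp
      rw [h3]
      simp [bits, toks]

/-- Each label leaves the name intact and contributes one disjunct to `found`, so the labels are
treated one by one; at the end the list of labels is moved back. -/
theorem run_member (N : ℕ) (r : Reg k) (m : Mem k) (p : Name) (ls : List Name)
    (hp : p.length ≤ N) (hls : (ls.flatMap encodeName).length ≤ N) :
    run N member ({ r with mismatch := false },
      { m with labs := toks (ls.flatMap encodeName), labsR := [], name := bits p, nameR := [] }) =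
      ({ r with mismatch := false, found := r.found || decide (p ∈ ls) },
      { m with labs := toks (ls.flatMap encodeName), labsR := [], name := bits p, nameR := [] }) := by
  have key : ∀ (ls : List Name) (r : Reg k) (m : Mem k),
      (run N memberStep)^[(ls.flatMap encodeName).length] ({ r with mismatch := false },
        { m with labs := toks (ls.flatMap encodeName), name := bits p, nameR := [] }) =
      ({ r with mismatch := false, found := r.found || decide (p ∈ ls) },
        { m with labs := [], labsR := (toks (ls.flatMap encodeName)).reverse ++ m.labsR,
                 name := bits p, nameR := [] }) := by
    intro ls
    induction ls with
    | nil => intro r m; simp [toks]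
    | cons x ls ih =>
      intro r m
      rw [List.flatMap_cons, List.length_append, toks_append]
      have h1 := iterate_memberStep N x r m false p [] (toks (ls.flatMap encodeName))
        (by simpa using hp)
      have h2 := ih { r with found := r.found || decide (x = p) }
        { m with labsR := (toks (encodeName x)).reverse ++ m.labsR }
      refine (iterate_trans h1 (by simpa [bits, toks] using h2)).trans ?_
      simp [Bool.or_assoc, eq_comm, bits, toks]
  have h1 := run_rep_next N _ _ (key ls r { m with labsR := [] }) hls rfl
  have h2 : run N member ({ r with mismatch := false },
      { m with labs := toks (ls.flatMap encodeName), labsR := [], name := bits p, nameR := [] }) =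
      run N (move .labsR .labs) (run N (.rep memberStep) ({ r with mismatch := false },
      { m with labs := toks (ls.flatMap encodeName), labsR := [], name := bits p,
               nameR := [] })) := rfl
  rw [h2, memberStep, h1, run_move _ _ _ (by decide) (by simpa [Mem.get, length_toks] using hls)]
  simp [Mem.get, Mem.set]

end MProg

end MDL

namespace MDL

open StackProg

/-- Appends a value to a vector of truth values. -/
def shift {k : ℕ} (v : Fin k → Bool) (b : Bool) : Fin k → Bool := fun j =>
  if (j : ℕ) = 0 then b else v ⟨j - 1, by omega⟩

/-- This is the purpose of listing the last value first: a value can be appended by a finite-state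
operation that does not depend on the number of values read so far. -/
theorem register_append_singleton (k : ℕ) (l : List Bool) (b : Bool) :
    register k (l ++ [b]) = shift (register k l) b := by
  funext ⟨j, hj⟩
  cases j with
  | zero => simp [register, shift]
  | succ j => simp [register, shift]

namespace MProg

variable {k : ℕ}

/-! ### Evaluation of a formula at a world -/

/-- Decides whether the name whose bits are on the stack `nameR` occurs among the labels, and
empties the stack. -/
def lookup : MProg k := .seq (move .nameR .name) (.seq member (clear .name))

theorem run_lookup (N : ℕ) (r : Reg k) (m : Mem k) (p : Name) (ls : List Name)
    (hp : p.length ≤ N) (hls : (ls.flatMap encodeName).length ≤ N) :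
    run N lookup ({ r with found := false, mismatch := false },
      { m with labs := toks (ls.flatMap encodeName), labsR := [], name := [],
               nameR := (bits p).reverse }) =
      ({ r with found := decide (p ∈ ls), mismatch := false },
      { m with labs := toks (ls.flatMap encodeName), labsR := [], name := [], nameR := [] }) := by
  rw [lookup, run_seq, run_move _ _ _ (by decide) (by simpa [Mem.get, length_bits] using hp),
    run_seq]
  simp only [Mem.get, Mem.set, List.reverse_reverse, List.append_nil]
  have h := run_member N { r with found := false } m p ls hp hls
  simp only [Bool.false_or] at h
  rw [h, run_clear _ _ _ (by simpa [Mem.get, length_bits] using hp)]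
  rfl

/-- The effect of the end of a name in a formula. -/
def evalName (r : Reg k) : MProg k :=
  match r.kind with
  | .lit b => .seq lookup
      (.load fun r => { r with kind := .idle, cov := r.cov || (r.found == b), found := false })
  | .dep => .seq lookup (.load fun r => { r with vec := shift r.vec r.found, found := false })
  | .depQ => .seq lookup (.pop .choice fun o => match o with
      | some (.inr f) => .seq (.push .choiceR (.inr f)) (.load fun r =>
          { r with kind := .idle, cov := r.cov || (f r.vec == r.found), found := false,
                   vec := fun _ => false })
      | _ => skip)
  | .ndepQ => .load fun r => { r with kind := .idle }
  | _ => skip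

/-- Processes a symbol of a formula. -/
def evalSym : Sym k → MProg k
  | .inl .prop => .load fun r => { r with kind := match r.kind with
      | .neg => .lit false
      | _ => .lit true }
  | .inl .neg => .load fun r => { r with kind := .neg }
  | .inl .dep => .load fun r => { r with kind := match r.kind with
      | .neg => .ndep
      | _ => .dep }
  | .inl .sep => .load fun r => { r with kind := match r.kind with
      | .dep => .depQ
      | .ndep => .ndepQ
      | x => x }
  | .inl (.bit b) => .cases fun r => match r.kind with
      | .lit _ | .dep | .depQ => .push .nameR (.inl (.bit b))
      | _ => skip
  | .inl .endName => .cases evalName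
  | _ => skip

/-- The step of the loop of `evalFml`. -/
def evalStep : MProg k := next .form fun a => .seq (.push .formR a) (evalSym a)

/-- Evaluates the formula on the stack `form` at the world with the labels on the stack `labs`,
with the letters on the stack `choice`. -/
def evalFml : MProg k :=
  .seq (.rep evalStep) (.seq (move .formR .form) (move .choiceR .choice))

/-- The truth values of propositions at a world. -/
def valuation (ls : List Name) : Name → Bool := fun p => decide (p ∈ ls)

/-- The states of the model checker while it evaluates a formula, between two atoms. -/
def evalState (r : Reg k) (m : Mem k) (ls : List Name) (cov : Bool) (form : List Token)
    (formR : List (Sym k)) (choice choiceR : List (Sym k)) : Reg k × Mem k :=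
  ({ r with kind := .idle, vec := fun _ => false, found := false, mismatch := false, cov := cov },
   { m with form := toks form, formR := formR, choice := choice, choiceR := choiceR,
            labs := toks (ls.flatMap encodeName), labsR := [], name := [], nameR := [] })

theorem iterate_evalStep_bits (N : ℕ) (p : Name) (r : Reg k) (m : Mem k) (rest : List (Sym k))
    (h : (∃ b, r.kind = .lit b) ∨ r.kind = .dep ∨ r.kind = .depQ) :
    (run N evalStep)^[p.length] (r, { m with form := bits p ++ rest }) =
      (r, { m with form := rest, formR := (bits p).reverse ++ m.formR,
                   nameR := (bits p).reverse ++ m.nameR }) := by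
  induction p generalizing m with
  | nil => rfl
  | cons b p ih =>
    rw [List.length_cons, Function.iterate_succ_apply]
    have h1 : run N evalStep (r, { m with form := bits (b :: p) ++ rest }) =
        run N ((match r.kind with
          | .lit _ | .dep | .depQ => .push .nameR (.inl (.bit b))
          | _ => skip : MProg k)) (r, { m with form := bits p ++ rest,
                                               formR := .inl (.bit b) :: m.formR }) := rfl
    have h2 : run N evalStep (r, { m with form := bits (b :: p) ++ rest }) =
        (r, { m with form := bits p ++ rest, formR := .inl (.bit b) :: m.formR,
                     nameR := .inl (.bit b) :: m.nameR }) := by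
      rw [h1]
      rcases h with ⟨b, h⟩ | h | h <;> rw [h] <;> rfl
    rw [h2, ih { m with formR := .inl (.bit b) :: m.formR, nameR := .inl (.bit b) :: m.nameR }]
    simp [bits_cons]

/-- Reading a name when the truth value of the proposition is needed. -/
theorem iterate_evalStep_name (N : ℕ) (p : Name) (r : Reg k) (m : Mem k) (rest : List (Sym k))
    (h : (∃ b, r.kind = .lit b) ∨ r.kind = .dep ∨ r.kind = .depQ) :
    (run N evalStep)^[(encodeName p).length]
      (r, { m with form := toks (encodeName p) ++ rest, nameR := [] }) =
    run N (evalName r) (r, { m with form := rest, formR := (toks (encodeName p)).reverse ++ m.formR,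
                                    nameR := (bits p).reverse }) := by
  have e : (toks (encodeName p) ++ rest : List (Sym k)) = bits p ++ .inl .endName :: rest := by
    simp [encodeName, bits, toks]
  have h1 := iterate_evalStep_bits N p r { m with nameR := [] } (.inl .endName :: rest) h
  have h2 : (encodeName p).length = p.length + 1 := by simp [encodeName]
  rw [e, h2]
  refine iterate_trans h1 ?_
  have h3 : (run N evalStep)^[1] (r, ({ m with
      form := .inl .endName :: rest, formR := (bits p).reverse ++ m.formR,
      nameR := (bits p).reverse ++ [] } : Mem k)) =
    run N (evalName r) (r, { m with form := rest,
                                    formR := .inl .endName :: ((bits p).reverse ++ m.formR),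
                                    nameR := (bits p).reverse ++ [] }) := rfl
  refine h3.trans ?_
  simp [encodeName, bits, toks]

/-- Tokens without effect in the given state of evaluation. -/
theorem iterate_evalStep_skip (N : ℕ) (l : List Token) (r : Reg k) (m : Mem k)
    (rest : List (Sym k)) (h : ∀ t ∈ l, ∀ m : Mem k, run N (evalSym (.inl t)) (r, m) = (r, m)) :
    (run N evalStep)^[l.length] (r, { m with form := toks l ++ rest }) =
      (r, { m with form := rest, formR := (toks l).reverse ++ m.formR }) := by
  induction l generalizing m with
  | nil => rfl
  | cons t l ih =>
    rw [List.length_cons, Function.iterate_succ_apply]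
    have h1 : run N evalStep (r, { m with form := toks (t :: l) ++ rest }) =
        run N (evalSym (.inl t)) (r, { m with form := toks l ++ rest,
                                              formR := .inl t :: m.formR }) := rfl
    rw [h1, h t (by simp), ih { m with formR := .inl t :: m.formR }
      fun t ht => h t (List.mem_cons_of_mem _ ht)]
    simp [toks]

/-- The values of the arguments read so far are `l`; every name is looked up and its truth value is
shifted into the vector. The vector lives in a register, which is possible since `k` is fixed. -/
theorem iterate_evalStep_args (N : ℕ) (ps : List Name) (l : List Bool) (r : Reg k) (m : Mem k)
    (ls : List Name) (rest : List (Sym k)) (hN : (ps.flatMap encodeName).length ≤ N)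
    (hls : (ls.flatMap encodeName).length ≤ N) :
    (run N evalStep)^[(ps.flatMap encodeName).length]
      ({ r with kind := .dep, vec := register k l, found := false, mismatch := false },
       { m with form := toks (ps.flatMap encodeName) ++ rest,
                labs := toks (ls.flatMap encodeName), labsR := [], name := [], nameR := [] }) =
      ({ r with kind := .dep, vec := register k (l ++ ps.map (valuation ls)), found := false,
                mismatch := false },
       { m with form := rest, formR := (toks (ps.flatMap encodeName)).reverse ++ m.formR,
                labs := toks (ls.flatMap encodeName), labsR := [], name := [], nameR := [] }) := by
  induction ps generalizing l m with
  | nil => simp [toks]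
  | cons p ps ih =>
    rw [List.flatMap_cons, List.length_append] at hN
    rw [List.flatMap_cons, List.length_append, toks_append, List.append_assoc]
    have h1 := iterate_evalStep_name N p
      { r with kind := .dep, vec := register k l, found := false, mismatch := false }
      { m with labs := toks (ls.flatMap encodeName), labsR := [], name := [] }
      (toks (ps.flatMap encodeName) ++ rest) (by simp)
    refine (iterate_trans h1 rfl).trans ?_
    have hp : p.length ≤ N := by
      have : (encodeName p).length = p.length + 1 := by simp [encodeName]
      omega
    have h2 := run_lookup N { r with kind := .dep, vec := register k l }
      { m with form := toks (ps.flatMap encodeName) ++ rest,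
               formR := (toks (encodeName p)).reverse ++ m.formR } p ls hp hls
    simp only [evalName, run_seq]
    simp only at h2
    rw [h2, run_load]
    simp only
    rw [← register_append_singleton]
    refine (ih (l ++ [decide (p ∈ ls)]) { m with
      formR := (toks (encodeName p)).reverse ++ m.formR } (by omega)).trans ?_
    simp [valuation]

/-- A string of letters as stack content. -/
def letters (cs : List (Letter k)) : List (Sym k) := cs.map Sum.inr

/-- In prefix notation the atoms appear in the order in which `covers` distributes the letters, so a
single pass suffices: each positive atom consumes the topmost letter, and each disjunct adds its
verdict to `cov`. No stack for the nesting of disjunctions is needed. -/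
theorem iterate_evalStep (N : ℕ) (φ : Fml Name) (hφ : φ.Disj) (r : Reg k) (m : Mem k)
    (ls : List Name) (cov : Bool) (rest : List Token) (formR : List (Sym k))
    (cs : List (Letter k)) (choice choiceR : List (Sym k)) (hcs : cs.length = φ.numDep)
    (hN : (encodeFml φ).length ≤ N) (hls : (ls.flatMap encodeName).length ≤ N) :
    (run N evalStep)^[(encodeFml φ).length]
      (evalState r m ls cov (encodeFml φ ++ rest) formR (letters cs ++ choice) choiceR) =
      evalState r m ls (cov || covers k (valuation ls) φ cs) rest
        ((toks (encodeFml φ)).reverse ++ formR) choice ((letters cs).reverse ++ choiceR) := by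
  have hname : ∀ q : Name, (encodeName q).length = q.length + 1 := fun q => by simp [encodeName]
  induction φ generalizing cov rest formR cs choice choiceR with
  | prop q =>
    obtain rfl : cs = [] := by simpa [Fml.numDep] using hcs
    simp only [encodeFml, List.length_cons] at hN ⊢
    rw [Function.iterate_succ_apply]
    have h1 := iterate_evalStep_name N q
      { r with kind := .lit true, vec := fun _ => false, found := false, mismatch := false,
               cov := cov }
      { m with formR := .inl .prop :: formR, choice := choice, choiceR := choiceR,
               labs := toks (ls.flatMap encodeName), labsR := [], name := [] }
      (toks rest) (by simp)
    rw [← toks_append] at h1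
    refine h1.trans ?_
    have h2 := run_lookup N
      { r with kind := .lit true, vec := fun _ => false, cov := cov }
      { m with form := toks rest, formR := (toks (encodeName q)).reverse ++ .inl .prop :: formR,
               choice := choice, choiceR := choiceR } q ls (by rw [hname] at hN; omega) hls
    simp only [evalName, run_seq]
    simp only at h2
    rw [h2, run_load]
    simp [evalState, covers, valuation, letters, toks]
  | nprop q =>
    obtain rfl : cs = [] := by simpa [Fml.numDep] using hcs
    simp only [encodeFml, List.length_cons] at hN ⊢
    rw [Function.iterate_succ_apply, Function.iterate_succ_apply]
    have h1 := iterate_evalStep_name N q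
      { r with kind := .lit false, vec := fun _ => false, found := false, mismatch := false,
               cov := cov }
      { m with formR := .inl .prop :: .inl .neg :: formR, choice := choice, choiceR := choiceR,
               labs := toks (ls.flatMap encodeName), labsR := [], name := [] }
      (toks rest) (by simp)
    rw [← toks_append] at h1
    refine h1.trans ?_
    have h2 := run_lookup N
      { r with kind := .lit false, vec := fun _ => false, cov := cov }
      { m with form := toks rest,
               formR := (toks (encodeName q)).reverse ++ .inl .prop :: .inl .neg :: formR,
               choice := choice, choiceR := choiceR } q ls (by rw [hname] at hN; omega) hls
    simp only [evalName, run_seq]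
    simp only at h2
    rw [h2, run_load]
    simp [evalState, covers, valuation, letters, toks]
  | dep ps q =>
    obtain ⟨f, rfl⟩ := List.length_eq_one_iff.1 (by simpa [Fml.numDep] using hcs)
    have e : encodeFml (.dep ps q) = .dep :: (ps.flatMap encodeName ++ .sep :: encodeName q) := rfl
    simp only [e, List.length_cons, List.length_append] at hN ⊢
    rw [Function.iterate_succ_apply]
    have h1 : run N evalStep (evalState r m ls cov
        (.dep :: (ps.flatMap encodeName ++ .sep :: encodeName q) ++ rest) formR
        (letters [f] ++ choice) choiceR) =
      ({ r with kind := .dep, vec := fun _ => false, found := false, mismatch := false,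
                cov := cov },
       { m with form := toks ((ps.flatMap encodeName ++ .sep :: encodeName q) ++ rest),
                formR := .inl .dep :: formR, choice := letters [f] ++ choice, choiceR := choiceR,
                labs := toks (ls.flatMap encodeName), labsR := [], name := [], nameR := [] }) :=
      rfl
    rw [h1, List.append_assoc, toks_append]
    have h2 := iterate_evalStep_args N ps [] { r with cov := cov }
      { m with formR := .inl .dep :: formR, choice := letters [f] ++ choice, choiceR := choiceR }
      ls (toks (.sep :: encodeName q ++ rest)) (by omega) hls
    refine iterate_trans h2 ?_
    rw [Function.iterate_succ_apply]
    have h3 := iterate_evalStep_name N q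
      { r with kind := .depQ, vec := register k ([] ++ ps.map (valuation ls)), found := false,
               mismatch := false, cov := cov }
      { m with formR := .inl .sep :: ((toks (ps.flatMap encodeName)).reverse ++ .inl .dep :: formR),
               choice := letters [f] ++ choice, choiceR := choiceR,
               labs := toks (ls.flatMap encodeName), labsR := [], name := [] }
      (toks rest) (by simp)
    rw [← toks_append] at h3
    refine h3.trans ?_
    have h4 := run_lookup N
      { r with kind := .depQ, vec := register k ([] ++ ps.map (valuation ls)), cov := cov }
      { m with form := toks rest,
               formR := (toks (encodeName q)).reverse ++ .inl .sep ::
                 ((toks (ps.flatMap encodeName)).reverse ++ .inl .dep :: formR),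
               choice := letters [f] ++ choice, choiceR := choiceR }
      q ls (by rw [hname] at hN; omega) hls
    simp only [evalName, run_seq]
    simp only at h4
    rw [h4, run_pop_cons _ _ _ _ _ (.inr f) choice rfl]
    simp only [run_seq, run_push, run_load]
    simp [evalState, covers, valuation, letters, toks, Mem.get, Mem.set]
  | ndep ps q =>
    obtain rfl : cs = [] := by simpa [Fml.numDep] using hcs
    -- A negated atom covers nothing, so its names are skipped without lookup. The last end marker
    -- is split off because it alone brings the evaluator back to the idle state.
    have e : encodeFml (.ndep ps q) =
      .neg :: .dep :: (ps.flatMap encodeName ++ .sep :: (q.map .bit ++ [.endName])) := rfl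
    simp only [e, List.length_cons, List.length_append, List.length_nil] at hN ⊢
    rw [Function.iterate_succ_apply, Function.iterate_succ_apply]
    have h1 : run N evalStep (run N evalStep (evalState r m ls cov
        (.neg :: .dep :: (ps.flatMap encodeName ++ .sep :: (q.map .bit ++ [.endName])) ++ rest)
        formR (letters [] ++ choice) choiceR)) =
      ({ r with kind := .ndep, vec := fun _ => false, found := false, mismatch := false,
                cov := cov },
       { m with form := toks
                  ((ps.flatMap encodeName ++ .sep :: (q.map .bit ++ [.endName])) ++ rest),
                formR := .inl .dep :: .inl .neg :: formR, choice := choice, choiceR := choiceR,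
                labs := toks (ls.flatMap encodeName), labsR := [], name := [], nameR := [] }) :=
      rfl
    rw [h1, List.append_assoc, toks_append]
    have h2 := iterate_evalStep_skip N (ps.flatMap encodeName)
      { r with kind := .ndep, vec := fun _ => false, found := false, mismatch := false,
               cov := cov }
      { m with formR := .inl .dep :: .inl .neg :: formR, choice := choice, choiceR := choiceR,
               labs := toks (ls.flatMap encodeName), labsR := [], name := [], nameR := [] }
      (toks ((.sep :: (q.map .bit ++ [.endName])) ++ rest)) (by
        intro t ht m
        simp only [List.mem_flatMap, encodeName, List.mem_append, List.mem_map,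
          List.mem_singleton] at ht
        obtain ⟨_, _, ⟨b, _, rfl⟩ | rfl⟩ := ht <;> rfl)
    refine iterate_trans h2 ?_
    rw [Function.iterate_succ_apply]
    have h3 := iterate_evalStep_skip N (q.map .bit)
      { r with kind := .ndepQ, vec := fun _ => false, found := false, mismatch := false,
               cov := cov }
      { m with formR := .inl .sep ::
                 ((toks (ps.flatMap encodeName)).reverse ++ .inl .dep :: .inl .neg :: formR),
               choice := choice, choiceR := choiceR,
               labs := toks (ls.flatMap encodeName), labsR := [], name := [], nameR := [] }
      (toks (.endName :: rest)) (by
        intro t ht m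
        simp only [List.mem_map] at ht
        obtain ⟨b, _, rfl⟩ := ht
        rfl)
    rw [← toks_append] at h3
    have e2 : (.sep :: (q.map .bit ++ [.endName])) ++ rest =
      .sep :: (q.map .bit ++ .endName :: rest) := by simp
    rw [e2]
    refine iterate_trans h3 ?_
    have h4 : ∀ m : Mem k, (run N evalStep)^[1]
      ({ r with kind := .ndepQ, vec := fun _ => false, found := false, mismatch := false,
                cov := cov }, { m with form := toks (.endName :: rest) }) =
      ({ r with kind := .idle, vec := fun _ => false, found := false, mismatch := false,
                cov := cov }, { m with form := toks rest, formR := .inl .endName :: m.formR }) :=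
      fun m => rfl
    refine (h4 { m with
      formR := (toks (q.map .bit)).reverse ++ .inl .sep ::
        ((toks (ps.flatMap encodeName)).reverse ++ .inl .dep :: .inl .neg :: formR),
      choice := choice, choiceR := choiceR, labs := toks (ls.flatMap encodeName), labsR := [],
      name := [], nameR := [] }).trans ?_
    simp [evalState, covers, letters, toks]
  | or φ ψ ih₁ ih₂ =>
    have e : encodeFml (.or φ ψ) = .or :: (encodeFml φ ++ encodeFml ψ) := rfl
    simp only [e, List.length_cons, List.length_append] at hN ⊢
    rw [Function.iterate_succ_apply]
    simp only [Fml.numDep] at hcs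
    have hl : letters cs = letters (cs.take φ.numDep) ++ letters (cs.drop φ.numDep) := by
      simp only [letters, ← List.map_append, List.take_append_drop]
    have h0 : letters cs ++ choice = letters (cs.take φ.numDep) ++
        (letters (cs.drop φ.numDep) ++ choice) := by rw [hl, List.append_assoc]
    have h1 : run N evalStep (evalState r m ls cov
        (.or :: (encodeFml φ ++ encodeFml ψ) ++ rest) formR (letters cs ++ choice) choiceR) =
      evalState r m ls cov (encodeFml φ ++ (encodeFml ψ ++ rest)) (.inl .or :: formR)
        (letters (cs.take φ.numDep) ++ (letters (cs.drop φ.numDep) ++ choice)) choiceR := by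
      rw [← h0, ← List.append_assoc]
      rfl
    rw [h1]
    refine iterate_trans (ih₁ hφ.1 _ _ _ _ _ _ (by simp; omega) (by omega)) ?_
    refine (ih₂ hφ.2 _ _ _ _ _ _ (by simp; omega) (by omega)).trans ?_
    rw [hl]
    simp [covers, toks, Bool.or_assoc]
  | _ => exact hφ.elim

/-- The tokens that occur in the records of worlds. -/
def IsRecordToken : Token → Prop
  | .bit _ | .endName | .sep => True
  | _ => False

/-- The stack `form` holds the whole input. The records of worlds in front of the formula consist of
tokens that are ignored in the idle state, so the formula need not be cut out. Formula and letters
are moved back for the next world. -/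
theorem run_evalFml (N : ℕ) (φ : Fml Name) (hφ : φ.Disj) (r : Reg k) (m : Mem k)
    (ls : List Name) (cov : Bool) (ws : List Token) (hws : ∀ t ∈ ws, IsRecordToken t)
    (cs : List (Letter k)) (hcs : cs.length = φ.numDep) (hcs' : cs.length ≤ N)
    (hN : (ws ++ encodeFml φ).length ≤ N) (hls : (ls.flatMap encodeName).length ≤ N) :
    run N evalFml (evalState r m ls cov (ws ++ encodeFml φ) [] (letters cs) []) =
      evalState r m ls (cov || covers k (valuation ls) φ cs) (ws ++ encodeFml φ) []
        (letters cs) [] := by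
  have h1 := iterate_evalStep_skip N ws
    { r with kind := .idle, vec := fun _ => false, found := false, mismatch := false, cov := cov }
    { m with formR := [], choice := letters cs, choiceR := [],
             labs := toks (ls.flatMap encodeName), labsR := [], name := [], nameR := [] }
    (toks (encodeFml φ)) (by
      intro t ht m
      have := hws t ht
      cases t <;> first | rfl | exact this.elim)
  rw [← toks_append] at h1
  have h2 := iterate_evalStep N φ hφ r m ls cov [] (toks ws).reverse cs [] [] hcs
    (by simp at hN; omega) hls
  simp only [List.append_nil] at h2
  simp only [List.append_nil] at h1
  have h3 := iterate_trans h1 h2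
  rw [← List.length_append] at h3
  have h4 : run N (.rep evalStep) _ = _ := run_rep_next N _ _ h3 hN rfl
  simp only at h4
  simp only [evalState]
  rw [evalFml, run_seq, h4, run_seq,
    run_move _ _ _ (x := .formR) (by decide) (by simpa [Mem.get, length_toks, add_comm] using hN),
    run_move _ _ _ (x := .choiceR) (by decide)
      (by simpa [Mem.get, Mem.set, letters] using hcs')]
  simp [Mem.get, Mem.set, toks]

end MProg

end MDL

namespace MDL

open StackProg

/-! ### Enumeration of the strings of letters -/

/-- A numbering of the letters. -/
noncomputable def letterEquiv (k : ℕ) : Letter k ≃ Fin (2 ^ 2 ^ k) :=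
  Fintype.equivFinOfCardEq (by simp)

/-- The first letter. -/
noncomputable def firstLetter (k : ℕ) : Letter k := (letterEquiv k).symm 0

/-- The cyclic successor of a letter. -/
noncomputable def nextLetter {k : ℕ} (f : Letter k) : Letter k :=
  (letterEquiv k).symm (letterEquiv k f + 1)

/-- The number that a string of letters denotes, with the least significant letter first. -/
noncomputable def lettersVal {k : ℕ} (cs : List (Letter k)) : ℕ :=
  Nat.ofDigits (2 ^ 2 ^ k) (cs.map fun f => (letterEquiv k f : ℕ))

open scoped Classical in
/-- The successor of a string of letters as a number, and whether there was an overflow. -/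
noncomputable def increment {k : ℕ} : List (Letter k) → List (Letter k) × Bool
  | [] => ([], true)
  | f :: cs => if nextLetter f = firstLetter k
      then (nextLetter f :: (increment cs).1, (increment cs).2) else (nextLetter f :: cs, false)

section Increment

variable {k : ℕ}

theorem length_increment (cs : List (Letter k)) : (increment cs).1.length = cs.length := by
  induction cs with
  | nil => rfl
  | cons f cs ih =>
    rw [increment]
    split <;> simp [ih]

theorem one_lt_two_pow_two_pow : 1 < 2 ^ 2 ^ k := Nat.one_lt_two_pow (by positivity)

theorem lettersVal_lt (cs : List (Letter k)) : lettersVal cs < (2 ^ 2 ^ k) ^ cs.length := by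
  have := Nat.ofDigits_lt_base_pow_length (b := 2 ^ 2 ^ k)
    (l := cs.map fun f => (letterEquiv k f : ℕ)) one_lt_two_pow_two_pow (by simp)
  simpa [lettersVal] using this

theorem lettersVal_injective {cs cs' : List (Letter k)} (hl : cs.length = cs'.length)
    (h : lettersVal cs = lettersVal cs') : cs = cs' := by
  have := Nat.ofDigits_inj_of_len_eq (b := 2 ^ 2 ^ k) one_lt_two_pow_two_pow (by simpa using hl)
    (by simp) (by simp) h
  exact List.map_injective_iff.2 (fun a b e => (letterEquiv k).injective (Fin.ext e)) this

/-- Addition of one with carry in base `2 ^ 2 ^ k`: the carry goes on exactly if the digit wraps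
around to zero, and an overflow accounts for one full cycle. -/
theorem lettersVal_increment (cs : List (Letter k)) :
    lettersVal (increment cs).1 + (if (increment cs).2 then (2 ^ 2 ^ k) ^ cs.length else 0) =
      lettersVal cs + 1 := by
  induction cs with
  | nil => simp [increment, lettersVal]
  | cons f cs ih =>
    have hv : ∀ (g : Letter k) l, lettersVal (g :: l) =
        letterEquiv k g + 2 ^ 2 ^ k * lettersVal l := fun g l => by
      simp [lettersVal, Nat.ofDigits_cons]
    have hlt := (letterEquiv k f).isLt
    have hnext : (letterEquiv k (nextLetter f) : ℕ) =
        if (letterEquiv k f : ℕ) + 1 = 2 ^ 2 ^ k then (0 : ℕ) else (letterEquiv k f : ℕ) + 1 := by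
      have h1 : 1 % 2 ^ 2 ^ k = 1 := Nat.mod_eq_of_lt one_lt_two_pow_two_pow
      rw [nextLetter, Equiv.apply_symm_apply, Fin.val_add, Fin.val_one', h1]
      split
      · rename_i h; rw [h, Nat.mod_self]
      · exact Nat.mod_eq_of_lt (by omega)
    rw [increment]
    split
    · rename_i h
      have h0 : (letterEquiv k (nextLetter f) : ℕ) = 0 := by simp [h, firstLetter]
      have h1 : (letterEquiv k f : ℕ) + 1 = 2 ^ 2 ^ k := by
        by_contra hne
        rw [if_neg hne] at hnext
        omega
      rw [hv, hv, h0, List.length_cons, pow_succ]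
      have : lettersVal cs + 1 = lettersVal (increment cs).1 +
        (if (increment cs).2 then (2 ^ 2 ^ k) ^ cs.length else 0) := ih.symm
      calc _ = 2 ^ 2 ^ k * (lettersVal (increment cs).1 +
            (if (increment cs).2 then (2 ^ 2 ^ k) ^ cs.length else 0)) := by
            split <;> ring
        _ = 2 ^ 2 ^ k * (lettersVal cs + 1) := by rw [this]
        _ = ((letterEquiv k f : ℕ) + 1) + 2 ^ 2 ^ k * lettersVal cs := by rw [h1]; ring
        _ = _ := by ring
    · rename_i h
      have h1 : (letterEquiv k f : ℕ) + 1 ≠ 2 ^ 2 ^ k := by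
        intro he
        rw [if_pos he] at hnext
        apply h
        rw [firstLetter, Equiv.eq_symm_apply]
        exact Fin.ext (by rw [hnext]; simp)
      rw [if_neg h1] at hnext
      rw [hv, hv, hnext]
      simp
      ring

/-! ### Exhaustive search through the strings of letters -/

variable (chk : List (Letter k) → Bool)

/-- One step of the search for a string of letters that passes a test. -/
noncomputable def searchStep (x : List (Letter k) × Bool × Bool) : List (Letter k) × Bool × Bool :=
  ((increment x.1).1, x.2.1 || chk x.1, x.2.2 || (increment x.1).2)

/-- Until the counter overflows, the string reached after `n` steps has the value `n`. Thus the
overflow occurs only after all strings have been tested, and up to then exactly the strings of value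
less than `n` have been. -/
theorem searchStep_iterate (ℓ n : ℕ) :
    ((searchStep chk)^[n] (List.replicate ℓ (firstLetter k), false, false)).1.length = ℓ ∧
    (n < (2 ^ 2 ^ k) ^ ℓ →
      ((searchStep chk)^[n] (List.replicate ℓ (firstLetter k), false, false)).2.2 = false ∧
      lettersVal ((searchStep chk)^[n] (List.replicate ℓ (firstLetter k), false, false)).1 = n) ∧
    ((2 ^ 2 ^ k) ^ ℓ ≤ n →
      ((searchStep chk)^[n] (List.replicate ℓ (firstLetter k), false, false)).2.2 = true) ∧
    (((searchStep chk)^[n] (List.replicate ℓ (firstLetter k), false, false)).2.1 = true →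
      ∃ cs, cs.length = ℓ ∧ chk cs = true) ∧
    ∀ cs, cs.length = ℓ → lettersVal cs < n → n ≤ (2 ^ 2 ^ k) ^ ℓ → chk cs = true →
      ((searchStep chk)^[n] (List.replicate ℓ (firstLetter k), false, false)).2.1 = true := by
  induction n with
  | zero =>
    refine ⟨by simp, fun _ => ⟨rfl, ?_⟩, fun h => ?_, by simp, by simp⟩
    · simp only [Function.iterate_zero, id, lettersVal, List.map_replicate, firstLetter,
        Equiv.apply_symm_apply, Fin.val_zero]
      induction ℓ with
      | zero => rfl
      | succ ℓ ih => simp [List.replicate_succ, Nat.ofDigits_cons]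
    · have : 0 < (2 ^ 2 ^ k) ^ ℓ := by positivity
      omega
  | succ n ih =>
    rw [Function.iterate_succ_apply']
    set x := (searchStep chk)^[n] (List.replicate ℓ (firstLetter k), false, false) with hx
    obtain ⟨h1, h2, h3, h4, h5⟩ := ih
    have hinc := lettersVal_increment x.1
    have hlt := lettersVal_lt (increment x.1).1
    rw [length_increment, h1] at hlt
    rw [h1] at hinc
    refine ⟨by rw [searchStep, length_increment, h1], fun hn => ?_, fun hn => ?_, fun h => ?_,
      fun cs hcs hv hn hc => ?_⟩
    · obtain ⟨e1, e2⟩ := h2 (by omega)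
      have : (increment x.1).2 = false := by
        by_contra hne
        simp only [Bool.not_eq_false] at hne
        rw [hne, if_pos rfl] at hinc
        omega
      rw [this] at hinc
      simp only [Bool.false_eq_true, if_false, add_zero] at hinc
      exact ⟨by simp [searchStep, e1, this], by simp only [searchStep]; omega⟩
    · by_cases hn' : (2 ^ 2 ^ k) ^ ℓ ≤ n
      · simp [searchStep, h3 hn']
      · obtain ⟨e1, e2⟩ := h2 (by omega)
        have : (increment x.1).2 = true := by
          by_contra hne
          rw [if_neg hne] at hinc
          omega
        simp [searchStep, this]
    · simp only [searchStep, Bool.or_eq_true] at h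
      rcases h with h | h
      · exact h4 h
      · exact ⟨x.1, h1, h⟩
    · simp only [searchStep, Bool.or_eq_true]
      rcases Nat.lt_succ_iff_lt_or_eq.1 hv with hv | hv
      · exact Or.inl (h5 cs hcs hv (by omega) hc)
      · refine Or.inr ?_
        obtain ⟨_, e2⟩ := h2 (by omega)
        rwa [← lettersVal_injective (hcs.trans h1.symm) (by omega)]

/-- An absent overflow means that there were too few steps to try all strings; otherwise the search
was exhaustive and the flag `good` is reliable. -/
theorem searchStep_iterate_iff (ℓ n : ℕ) :
    (((searchStep chk)^[n] (List.replicate ℓ (firstLetter k), false, false)).2.1 ||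
      !((searchStep chk)^[n] (List.replicate ℓ (firstLetter k), false, false)).2.2) = true ↔
    (∃ cs, cs.length = ℓ ∧ chk cs = true) ∨ n < (2 ^ 2 ^ k) ^ ℓ := by
  obtain ⟨_, h2, h3, h4, _⟩ := searchStep_iterate chk ℓ n
  constructor
  · intro h
    by_cases hn : n < (2 ^ 2 ^ k) ^ ℓ
    · exact Or.inr hn
    · rw [h3 (by omega)] at h
      exact Or.inl (h4 (by simpa using h))
  · intro h
    by_cases hn : n < (2 ^ 2 ^ k) ^ ℓ
    · simp [(h2 hn).1]
    · obtain ⟨cs, hcs, hc⟩ := h.resolve_right hn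
      obtain ⟨d, rfl⟩ := Nat.exists_eq_add_of_le' (not_lt.1 hn)
      -- After a full cycle the strings are merely tested again; a success, once recorded, is kept.
      have mono : ∀ (d : ℕ) x, x.2.1 = true → ((searchStep chk)^[d] x).2.1 = true := by
        intro d
        induction d with
        | zero => exact fun x h => h
        | succ d ih => exact fun x h => ih _ (by simp [searchStep, h])
      rw [Function.iterate_add_apply, mono]
      · rfl
      · exact (searchStep_iterate chk ℓ ((2 ^ 2 ^ k) ^ ℓ)).2.2.2.2 cs hcs
          (hcs ▸ lettersVal_lt cs) le_rfl hc

end Increment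

namespace MProg

variable {k : ℕ}

/-! ### The test of a string of letters at all worlds -/

/-- The data in the record of a world: membership in the team, adjacency, labels. -/
structure WorldRecord where
  team : Bool
  adj : List Bool
  labels : List Name

/-- The tokens of the record of a world. -/
def WorldRecord.encode (x : WorldRecord) : List Token :=
  .bit x.team :: x.adj.map .bit ++ .sep :: x.labels.flatMap encodeName ++ [.sep]

/-- Processes a symbol of the input. -/
def worldSym (a : Sym k) : MProg k := .cases fun r => match r.part, a with
  | .start, .inl (.bit b) => .load fun r => { r with part := .adj b }
  | .start, _ => .load fun r => { r with part := .none }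
  | .adj b, .inl .sep => .load fun r => { r with part := .labels b }
  | .labels b, .inl .sep => .seq (move .labsR .labs) (.seq
      (bif b then .seq evalFml (.load fun r => { r with allCov := r.allCov && r.cov, cov := false })
        else skip)
      (.seq (clear .labs) (.load fun r => { r with part := .start })))
  | .labels _, _ => .push .labsR a
  | _, _ => skip

/-- The step of the loop of `testWorlds`. -/
def worldStep : MProg k := next .main fun a => .seq (.push .mainR a) (worldSym a)

/-- Tests whether all worlds of the team are covered with the letters on the stack `choice`. -/
def testWorlds : MProg k :=
  .seq (.rep worldStep) (.seq (move .mainR .main) (.load fun r => { r with part := .start }))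

/-- The states of the model checker during a test, between the records of two worlds. -/
def testState (r : Reg k) (m : Mem k) (w : List Token) (part : RecordPart) (allCov : Bool)
    (main : List Token) (mainR : List (Sym k)) (labsR : List (Sym k)) (cs : List (Letter k)) :
    Reg k × Mem k :=
  ({ r with kind := .idle, vec := fun _ => false, found := false, mismatch := false, cov := false,
            part := part, allCov := allCov },
   { m with main := toks main, mainR := mainR, form := toks w, formR := [], choice := letters cs,
            choiceR := [], labs := [], labsR := labsR, name := [], nameR := [] })

/-- Tokens that are not stored. -/
theorem iterate_worldStep_skip (N : ℕ) (l : List Token) (r : Reg k) (m : Mem k) (w : List Token)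
    (part : RecordPart) (allCov : Bool) (rest : List Token) (mainR : List (Sym k))
    (cs : List (Letter k))
    (h : part = .none ∨ (∃ b, part = .adj b) ∧ ∀ t ∈ l, ∃ b, t = .bit b) :
    (run N worldStep)^[l.length] (testState r m w part allCov (l ++ rest) mainR [] cs) =
      testState r m w part allCov rest ((toks l).reverse ++ mainR) [] cs := by
  induction l generalizing mainR with
  | nil => rfl
  | cons t l ih =>
    rw [List.length_cons, Function.iterate_succ_apply]
    have h1 : run N worldStep (testState r m w part allCov (t :: l ++ rest) mainR [] cs) =
        testState r m w part allCov (l ++ rest) (.inl t :: mainR) [] cs := by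
      rcases h with rfl | ⟨⟨b, rfl⟩, h⟩
      · rfl
      · obtain ⟨b', rfl⟩ := h t (by simp)
        rfl
    rw [h1, ih _ (h.imp_right fun h => ⟨h.1, fun t ht => h.2 t (List.mem_cons_of_mem _ ht)⟩)]
    simp [toks]

theorem iterate_worldStep_labels (N : ℕ) (l : List Token) (r : Reg k) (m : Mem k) (w : List Token)
    (b : Bool) (allCov : Bool) (rest : List Token) (mainR labsR : List (Sym k))
    (cs : List (Letter k)) (h : ∀ t ∈ l, (∃ b, t = .bit b) ∨ t = .endName) :
    (run N worldStep)^[l.length]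
      (testState r m w (.labels b) allCov (l ++ rest) mainR labsR cs) =
      testState r m w (.labels b) allCov rest ((toks l).reverse ++ mainR)
        ((toks l).reverse ++ labsR) cs := by
  induction l generalizing mainR labsR with
  | nil => rfl
  | cons t l ih =>
    rw [List.length_cons, Function.iterate_succ_apply]
    have h1 : run N worldStep
        (testState r m w (.labels b) allCov (t :: l ++ rest) mainR labsR cs) =
        testState r m w (.labels b) allCov (l ++ rest) (.inl t :: mainR) (.inl t :: labsR) cs := by
      rcases h t (by simp) with ⟨b', rfl⟩ | rfl <;> rfl
    rw [h1, ih _ _ fun t ht => h t (List.mem_cons_of_mem _ ht)]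
    simp [toks]

theorem mem_flatMap_encodeName {ls : List Name} {t : Token} (h : t ∈ ls.flatMap encodeName) :
    (∃ b, t = .bit b) ∨ t = .endName := by
  simp only [List.mem_flatMap, encodeName, List.mem_append, List.mem_map, List.mem_singleton] at h
  obtain ⟨_, _, ⟨b, _, rfl⟩ | rfl⟩ := h
  · exact Or.inl ⟨b, rfl⟩
  · exact Or.inr rfl

variable (N : ℕ) (φ : Fml Name) (hφ : φ.Disj) (r : Reg k) (m : Mem k) (ws : List Token)
  (hws : ∀ t ∈ ws, IsRecordToken t) (cs : List (Letter k)) (hcs : cs.length = φ.numDep)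
  (hcs' : cs.length ≤ N) (hN : (ws ++ encodeFml φ).length ≤ N)

include hφ hws hcs hcs' hN

/-- The bit for the team is remembered in the state, the row of the adjacency matrix is ignored for
want of modalities, and the labels are collected. The closing separator triggers the evaluation of
the formula if the world is in the team. -/
theorem iterate_worldStep_record (x : WorldRecord) (hx : x.encode.length ≤ N) (allCov : Bool)
    (rest : List Token) (mainR : List (Sym k)) :
    (run N worldStep)^[x.encode.length] (testState r m (ws ++ encodeFml φ) .start allCov
      (x.encode ++ rest) mainR [] cs) =
    testState r m (ws ++ encodeFml φ) .start
      (allCov && (!x.team || covers k (valuation x.labels) φ cs)) rest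
      ((toks x.encode).reverse ++ mainR) [] cs := by
  obtain ⟨t, adj, ls⟩ := x
  set w := ws ++ encodeFml φ with hw
  have e : WorldRecord.encode ⟨t, adj, ls⟩ =
    [.bit t] ++ (adj.map .bit ++ ([.sep] ++ (ls.flatMap encodeName ++ [.sep]))) := by
    simp [WorldRecord.encode]
  rw [e] at hx ⊢
  simp only [List.length_append] at hx
  simp only [List.append_assoc]
  rw [List.length_append]
  refine iterate_trans (b := testState r m w (.adj t) allCov
    (adj.map .bit ++ ([.sep] ++ (ls.flatMap encodeName ++ ([.sep] ++ rest))))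
    (.inl (.bit t) :: mainR) [] cs) rfl ?_
  rw [List.length_append]
  refine iterate_trans (iterate_worldStep_skip N _ r m w _ allCov _ _ cs
    (Or.inr ⟨⟨t, rfl⟩, fun t ht => ?_⟩)) ?_
  · obtain ⟨b, _, rfl⟩ := List.mem_map.1 ht
    exact ⟨b, rfl⟩
  rw [List.length_append]
  refine iterate_trans (b := testState r m w (.labels t) allCov
    (ls.flatMap encodeName ++ ([.sep] ++ rest))
    (.inl .sep :: ((toks (adj.map .bit)).reverse ++ .inl (.bit t) :: mainR)) [] cs) rfl ?_
  rw [List.length_append]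
  refine iterate_trans (iterate_worldStep_labels N _ r m w t allCov _ _ [] cs
    fun t ht => mem_flatMap_encodeName ht) ?_
  have hls : (ls.flatMap encodeName).length ≤ N := by omega
  -- All the work is done in the one step that reads the closing separator.
  have h1 : ∀ (mainR labsR : List (Sym k)), (run N worldStep)^[[Token.sep].length]
      (testState r m w (.labels t) allCov ([.sep] ++ rest) mainR labsR cs) =
    run N (.seq (move .labsR .labs) (.seq (bif t then .seq evalFml
        (.load fun r => { r with allCov := r.allCov && r.cov, cov := false }) else skip)
      (.seq (clear .labs) (.load fun r => { r with part := .start }))))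
      (testState r m w (.labels t) allCov rest (.inl .sep :: mainR) labsR cs) :=
    fun _ _ => rfl
  rw [h1, run_seq]
  simp only [testState, List.append_nil]
  rw [run_move _ _ _ (by decide) (by simpa [Mem.get, length_toks] using hls)]
  simp only [Mem.get, Mem.set, List.append_nil, List.reverse_reverse, run_seq]
  cases t with
  | false =>
    simp only [cond_false, run_skip]
    rw [run_clear _ _ _ (by simpa [Mem.get, length_toks] using hls), run_load]
    simp [Mem.set, toks]
  | true =>
    simp only [cond_true, run_seq]
    have h2 := run_evalFml N φ hφ { r with part := .labels true, allCov := allCov }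
      { m with main := toks rest, mainR := .inl .sep :: ((toks (ls.flatMap encodeName)).reverse ++
        .inl .sep :: ((toks (adj.map .bit)).reverse ++ .inl (.bit true) :: mainR)) }
      ls false ws hws cs hcs hcs' hN hls
    simp only [evalState, ← hw] at h2
    rw [h2]
    simp only [run_load]
    rw [run_clear _ _ _ (by simpa [Mem.get, length_toks] using hls)]
    simp [Mem.set, toks, run_load]

theorem run_testWorlds (xs : List WorldRecord) (hxs : ws = xs.flatMap WorldRecord.encode) :
    run N testWorlds (testState r m (ws ++ encodeFml φ) .start true (ws ++ encodeFml φ) [] [] cs) =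
      testState r m (ws ++ encodeFml φ) .start
        (xs.all fun x => !x.team || covers k (valuation x.labels) φ cs)
        (ws ++ encodeFml φ) [] [] cs := by
  have h1 : ∀ (xs : List WorldRecord) (_ : (xs.flatMap WorldRecord.encode).length ≤ N)
      (allCov : Bool) (rest : List Token) (mainR : List (Sym k)),
      (run N worldStep)^[(xs.flatMap WorldRecord.encode).length]
        (testState r m (ws ++ encodeFml φ) .start allCov
          (xs.flatMap WorldRecord.encode ++ rest) mainR [] cs) =
      testState r m (ws ++ encodeFml φ) .start
        (allCov && xs.all fun x => !x.team || covers k (valuation x.labels) φ cs)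
        rest ((toks (xs.flatMap WorldRecord.encode)).reverse ++ mainR) [] cs := by
    intro xs
    induction xs with
    | nil => intros; simp [toks]
    | cons x xs ih =>
      intro hN' allCov rest mainR
      rw [List.flatMap_cons, List.length_append] at hN' ⊢
      rw [List.append_assoc]
      refine iterate_trans (iterate_worldStep_record N φ hφ r m ws hws cs hcs hcs' hN x
        (by omega) allCov _ mainR) ?_
      rw [ih (by omega)]
      simp [toks, Bool.and_assoc]
  -- Records begin with a bit and formulae do not, so the first token of the formula switches off
  -- the treatment of records for good.
  have h2 : ∃ t l, encodeFml φ = t :: l ∧ ∀ b, t ≠ .bit b := by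
    cases φ <;> exact ⟨_, _, rfl, by simp⟩
  have h3 : ∀ allCov mainR, (run N worldStep)^[(encodeFml φ).length]
      (testState r m (ws ++ encodeFml φ) .start allCov (encodeFml φ) mainR [] cs) =
      testState r m (ws ++ encodeFml φ) .none allCov [] ((toks (encodeFml φ)).reverse ++ mainR)
        [] cs := by
    intro allCov mainR
    generalize hw : ws ++ encodeFml φ = w
    obtain ⟨t, l, e, ht⟩ := h2
    have h4 : run N worldStep (testState r m w .start allCov (t :: l) mainR [] cs) =
        testState r m w .none allCov l (.inl t :: mainR) [] cs := by
      cases t <;> first | rfl | exact absurd rfl (ht _)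
    rw [e, List.length_cons, Function.iterate_succ_apply, h4]
    have h5 := iterate_worldStep_skip N l r m w .none allCov [] (.inl t :: mainR) cs (Or.inl rfl)
    rw [List.append_nil] at h5
    rw [h5]
    simp [toks]
  subst hxs
  have h4 := iterate_trans (h1 xs (by simp at hN ⊢; omega) true (encodeFml φ) []) (h3 _ _)
  rw [← List.length_append] at h4
  have h5 : run N (.rep worldStep) _ = _ := run_rep_next N _ _ h4 hN rfl
  rw [testWorlds, run_seq, h5, run_seq, testState,
    run_move _ _ _ (by decide) (by simpa [Mem.get, length_toks, add_comm] using hN), run_load]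
  simp [Mem.get, Mem.set, toks]

omit hφ hws hcs hcs' hN

/-! ### The search -/

open scoped Classical in
/-- The step of the loop of `incChoice`. -/
noncomputable def incStep : MProg k := .cases fun r => bif r.carry then
    .pop .choice fun o => match o with
    | some (.inr f) => .seq (.push .choiceR (.inr (nextLetter f)))
        (.load fun r => { r with carry := decide (nextLetter f = firstLetter k) })
    | _ => .load fun r => { r with overflow := true, carry := false }
  else skip

/-- Replaces the string of letters on the stack `choice` by the next one. -/
noncomputable def incChoice : MProg k :=
  .seq (.load fun r => { r with carry := true }) (.seq (.rep incStep) (move .choiceR .choice))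

/-- The extra round in `hcs'` is the one that finds the stack empty while the carry is still set,
and so detects the overflow. -/
theorem run_incChoice (hcs' : cs.length + 1 ≤ N) :
    run N incChoice (r, { m with choice := letters cs, choiceR := [] }) =
      ({ r with carry := false, overflow := r.overflow || (increment cs).2 },
       { m with choice := letters (increment cs).1, choiceR := [] }) := by
  classical
  have fix : ∀ (n : ℕ) (r : Reg k) (m : Mem k), (run N incStep)^[n] ({ r with carry := false }, m) =
      ({ r with carry := false }, m) := fun n r m => Function.iterate_fixed rfl n
  -- The carry may die out in the middle of the string. Then the changed letters are reversed on
  -- `choiceR` (as `Y`) and the others remain on `choice` (as `X`); only their concatenation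
  -- matters, since the final move restores it.
  have key : ∀ (cs : List (Letter k)) (n : ℕ) (_ : cs.length + 1 ≤ n) (R : List (Sym k)),
      ∃ X Y, Y.length ≤ cs.length + R.length ∧
        Y.reverse ++ X = R.reverse ++ letters (increment cs).1 ∧
        (run N incStep)^[n] ({ r with carry := true },
          { m with choice := letters cs, choiceR := R }) =
        ({ r with carry := false, overflow := r.overflow || (increment cs).2 },
          { m with choice := X, choiceR := Y }) := by
    intro cs
    induction cs with
    | nil =>
      intro n hn R
      obtain ⟨n, rfl⟩ := Nat.exists_eq_add_of_le' hn
      refine ⟨[], R, by simp, by simp [letters, increment], ?_⟩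
      rw [List.length_nil, zero_add, Function.iterate_succ_apply]
      refine (fix n { r with overflow := true } _).trans ?_
      simp only [increment, Bool.or_true]
      rfl
    | cons f cs ih =>
      intro n hn R
      obtain ⟨n, rfl⟩ := Nat.exists_eq_add_of_le' (Nat.le_of_add_left_le hn)
      rw [Function.iterate_succ_apply]
      have h1 : run N incStep ({ r with carry := true },
          { m with choice := letters (f :: cs), choiceR := R }) =
        ({ r with carry := decide (nextLetter f = firstLetter k) },
         { m with choice := letters cs, choiceR := .inr (nextLetter f) :: R }) := rfl
      rw [h1]
      by_cases h : nextLetter f = firstLetter k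
      · obtain ⟨X, Y, h2, h3, h4⟩ := ih n (by simpa using hn) (.inr (nextLetter f) :: R)
        refine ⟨X, Y, by simp at h2 ⊢; omega, ?_, ?_⟩
        · rw [h3, increment, if_pos h]
          simp [letters]
        · rw [decide_eq_true h, h4, increment, if_pos h]
      · refine ⟨letters cs, .inr (nextLetter f) :: R, by simp, ?_, ?_⟩
        · rw [increment, if_neg h]
          simp [letters]
        · rw [decide_eq_false h, fix, increment, if_neg h]
          simp
  obtain ⟨X, Y, h1, h2, h3⟩ := key cs N hcs' []
  rw [incChoice, run_seq, run_load, run_seq, run_rep, h3,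
    run_move _ _ _ (by decide) (by simp [Mem.get] at h1 ⊢; omega)]
  simp only [List.reverse_nil, List.nil_append] at h2
  simp [Mem.get, Mem.set, h2]

/-- Tests the current string of letters and passes to the next one. -/
noncomputable def searchBody : MProg k :=
  .seq testWorlds (.seq (.load fun r => { r with good := r.good || r.allCov, allCov := true })
    incChoice)

/-- A nest of loops. -/
def repPow (p : MProg k) : ℕ → MProg k
  | 0 => p
  | d + 1 => .rep (repPow p d)

/-- Nesting makes the exponent of the number of rounds grow by one per loop; as the depth is a
constant, the time stays polynomial. -/
theorem run_repPow (p : MProg k) (d : ℕ) (c : Reg k × Mem k) :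
    run N (repPow p d) c = (run N p)^[N ^ d] c := by
  induction d generalizing c with
  | zero => simp [repPow]
  | succ d ih =>
    rw [repPow, run_rep, pow_succ, Function.iterate_mul]
    congr 2
    funext c
    exact ih c

/-- The states of the model checker during the search. -/
def searchState (r : Reg k) (m : Mem k) (w : List Token) (x : List (Letter k) × Bool × Bool) :
    Reg k × Mem k :=
  testState { r with good := x.2.1, overflow := x.2.2, carry := false } m w .start true w [] [] x.1

/-- The program follows the abstract search step by step: all scratch stacks and registers are back
in their initial state after every test, and only the string and the two flags evolve. -/
theorem iterate_searchBody (hφ : φ.Disj) (xs : List WorldRecord)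
    (hxs : ws = xs.flatMap WorldRecord.encode) (hws : ∀ t ∈ ws, IsRecordToken t)
    (hN : (ws ++ encodeFml φ).length ≤ N) (hd : φ.numDep + 1 ≤ N) (n : ℕ)
    (x : List (Letter k) × Bool × Bool) (hx : x.1.length = φ.numDep) :
    (run N searchBody)^[n] (searchState r m (ws ++ encodeFml φ) x) =
      searchState r m (ws ++ encodeFml φ) ((searchStep fun cs => xs.all fun x => !x.team ||
        covers k (valuation x.labels) φ cs)^[n] x) := by
  induction n generalizing x with
  | zero => rfl
  | succ n ih =>
    rw [Function.iterate_succ_apply, Function.iterate_succ_apply,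
      ← ih _ (by simpa [searchStep, length_increment] using hx)]
    congr 1
    rw [searchBody, run_seq, searchState, run_testWorlds N φ hφ _ m ws hws x.1 hx (by omega) hN xs
      hxs, run_seq]
    simp only [testState]
    rw [run_load]
    have h := run_incChoice N
      { r with kind := .idle, vec := fun _ => false, found := false, mismatch := false,
               cov := false, part := .start, allCov := true, good := x.2.1 || xs.all fun y =>
                 !y.team || covers k (valuation y.labels) φ x.1, overflow := x.2.2 }
      { m with main := toks (ws ++ encodeFml φ), mainR := [], form := toks (ws ++ encodeFml φ),
               formR := [], labs := [], labsR := [], name := [], nameR := [] } x.1 (by omega)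
    exact h.trans rfl

end MProg

end MDL

namespace MDL

open StackProg

namespace MProg

variable {k : ℕ}

/-! ### The complete search -/

/-- Processes a symbol of the input when the initial string of letters is written. -/
noncomputable def choiceSym : Sym k → MProg k
  | .inl .neg => .load fun r => { r with kind := .neg }
  | .inl .prop => .load fun r => { r with kind := .idle }
  | .inl .dep => .cases fun r => match r.kind with
      | .neg => .load fun r => { r with kind := .idle }
      | _ => .push .choice (.inr (firstLetter k))
  | _ => skip

/-- The step of the loop of `initChoice`. -/
noncomputable def choiceStep : MProg k := next .main fun a => .seq (.push .mainR a) (choiceSym a)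

/-- Writes a letter for each positive dependence atom of the input to the stack `choice`. -/
noncomputable def initChoice : MProg k := .seq (.rep choiceStep) (move .mainR .main)

theorem iterate_choiceStep_skip (N : ℕ) (l : List Token) (r : Reg k) (m : Mem k)
    (rest : List (Sym k)) (h : ∀ t ∈ l, IsRecordToken t) :
    (run N choiceStep)^[l.length] (r, { m with main := toks l ++ rest }) =
      (r, { m with main := rest, mainR := (toks l).reverse ++ m.mainR }) := by
  induction l generalizing m with
  | nil => rfl
  | cons t l ih =>
    rw [List.length_cons, Function.iterate_succ_apply]
    have h1 : run N choiceStep (r, { m with main := toks (t :: l) ++ rest }) =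
        (r, { m with main := toks l ++ rest, mainR := .inl t :: m.mainR }) := by
      have := h t (by simp)
      cases t <;> first | rfl | exact this.elim
    rw [h1, ih { m with mainR := .inl t :: m.mainR } fun t ht => h t (List.mem_cons_of_mem _ ht)]
    simp [toks]

theorem isRecordToken_of_mem_encodeName {p : Name} {t : Token} (h : t ∈ encodeName p) :
    IsRecordToken t := by
  simp only [encodeName, List.mem_append, List.mem_map, List.mem_singleton] at h
  obtain ⟨b, _, rfl⟩ | rfl := h <;> trivial

theorem isRecordToken_of_mem_args {ps : List Name} {q : Name} {t : Token}
    (h : t ∈ ps.flatMap encodeName ++ .sep :: encodeName q) : IsRecordToken t := by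
  simp only [List.mem_append, List.mem_flatMap, List.mem_cons] at h
  obtain ⟨_, _, h⟩ | rfl | h := h
  · exact isRecordToken_of_mem_encodeName h
  · trivial
  · exact isRecordToken_of_mem_encodeName h

/-- The register `kind` remembers whether the preceding token was a negation, so only positive atoms
receive a letter. All letters are equal, so the order in which they are pushed is immaterial. -/
theorem iterate_choiceStep (N : ℕ) (φ : Fml Name) (hφ : φ.Disj) (r : Reg k) (m : Mem k)
    (rest : List (Sym k)) :
    (run N choiceStep)^[(encodeFml φ).length]
      ({ r with kind := .idle }, { m with main := toks (encodeFml φ) ++ rest }) =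
      ({ r with kind := .idle },
       { m with main := rest, mainR := (toks (encodeFml φ)).reverse ++ m.mainR,
                choice := letters (List.replicate φ.numDep (firstLetter k)) ++ m.choice }) := by
  induction φ generalizing m rest with
  | prop q =>
    rw [encodeFml, List.length_cons, Function.iterate_succ_apply]
    refine (iterate_choiceStep_skip N (encodeName q) { r with kind := .idle }
      { m with mainR := .inl .prop :: m.mainR } rest
      fun t ht => isRecordToken_of_mem_encodeName ht).trans ?_
    simp [Fml.numDep, letters, toks]
  | nprop q =>
    rw [encodeFml, List.length_cons, List.length_cons, Function.iterate_succ_apply,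
      Function.iterate_succ_apply]
    refine (iterate_choiceStep_skip N (encodeName q) { r with kind := .idle }
      { m with mainR := .inl .prop :: .inl .neg :: m.mainR } rest
      fun t ht => isRecordToken_of_mem_encodeName ht).trans ?_
    simp [Fml.numDep, letters, toks]
  | dep ps q =>
    have e : encodeFml (.dep ps q) = .dep :: (ps.flatMap encodeName ++ .sep :: encodeName q) := rfl
    rw [e, List.length_cons, Function.iterate_succ_apply]
    refine (iterate_choiceStep_skip N _ { r with kind := .idle }
      { m with mainR := .inl .dep :: m.mainR, choice := .inr (firstLetter k) :: m.choice } rest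
      fun t ht => isRecordToken_of_mem_args ht).trans ?_
    simp [Fml.numDep, letters, toks]
  | ndep ps q =>
    have e : encodeFml (.ndep ps q) =
      .neg :: .dep :: (ps.flatMap encodeName ++ .sep :: encodeName q) := rfl
    rw [e, List.length_cons, List.length_cons, Function.iterate_succ_apply,
      Function.iterate_succ_apply]
    refine (iterate_choiceStep_skip N _ { r with kind := .idle }
      { m with mainR := .inl .dep :: .inl .neg :: m.mainR } rest
      fun t ht => isRecordToken_of_mem_args ht).trans ?_
    simp [Fml.numDep, letters, toks]
  | or φ ψ ih₁ ih₂ =>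
    have e : encodeFml (.or φ ψ) = .or :: (encodeFml φ ++ encodeFml ψ) := rfl
    rw [e, List.length_cons, Function.iterate_succ_apply, List.length_append]
    have h1 : run N choiceStep ({ r with kind := .idle },
        { m with main := toks (.or :: (encodeFml φ ++ encodeFml ψ)) ++ rest }) =
      ({ r with kind := .idle }, { m with main := toks (encodeFml φ) ++ (toks (encodeFml ψ) ++ rest),
                                          mainR := .inl .or :: m.mainR }) := by
      rw [← List.append_assoc, ← toks_append]
      rfl
    rw [h1]
    refine iterate_trans (ih₁ hφ.1 { m with mainR := .inl .or :: m.mainR } _) ?_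
    refine (ih₂ hφ.2 { m with
      mainR := (toks (encodeFml φ)).reverse ++ .inl .or :: m.mainR,
      choice := letters (List.replicate φ.numDep (firstLetter k)) ++ m.choice } _).trans ?_
    simp only [Fml.numDep, add_comm φ.numDep, letters, List.map_replicate, ← List.append_assoc,
      List.replicate_append_replicate]
    simp [toks]
  | _ => exact hφ.elim

/-- Decides the truth of the formula in the team, for correct inputs. -/
noncomputable def search (k : ℕ) : MProg k :=
  .seq initChoice (.seq (repPow searchBody (2 ^ k))
    -- Without an overflow the search is inconclusive, but then there are so many dependence atoms
    -- that the formula is true anyway.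
    (.load fun r => { r with answer := r.good || !r.overflow }))

/-- The initial values of the registers. -/
def initReg (k : ℕ) : Reg k :=
  { parse := .start, first := true, kind := .idle, vec := fun _ => false, found := false,
    mismatch := false, cov := false, part := .start, allCov := true, good := false,
    overflow := false, carry := false, answer := false }

theorem numDep_lt_length_encodeFml (φ : Fml Name) : φ.numDep < (encodeFml φ).length := by
  induction φ <;> simp only [Fml.numDep, encodeFml, List.length_cons, List.length_append,
    List.length_nil] <;> omega

/-- The search begins in the state in which the parser ends; the values `r` and `m` left over from
parsing have no influence on the answer. -/
theorem run_search_answer (N : ℕ) (φ : Fml Name) (hφ : φ.Disj) (r : Reg k) (m : Mem k)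
    (xs : List WorldRecord) (w : List Token) (hw : w = xs.flatMap WorldRecord.encode ++ encodeFml φ)
    (hN : w.length ≤ N) :
    (run N (search k) ({ initReg k with parse := r.parse, first := r.first },
      { Mem.empty k with main := toks w, form := toks w, len := m.len, lenR := m.lenR,
                         recs := m.recs, pend := m.pend })).1.answer = true ↔
      (∃ cs : List (Letter k), cs.length = φ.numDep ∧
        (xs.all fun x => !x.team || covers k (valuation x.labels) φ cs) = true) ∨
      N ^ 2 ^ k < (2 ^ 2 ^ k) ^ φ.numDep := by
  subst hw
  have hws : ∀ t ∈ xs.flatMap WorldRecord.encode, IsRecordToken t := by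
    intro t ht
    simp only [WorldRecord.encode, List.mem_flatMap, List.mem_append, List.mem_cons,
      List.mem_map, List.not_mem_nil, or_false] at ht
    obtain ⟨x, _, ((rfl | ⟨b, _, rfl⟩) | rfl | ⟨p, _, hp⟩) | rfl⟩ := ht
    · trivial
    · trivial
    · trivial
    · exact isRecordToken_of_mem_encodeName hp
    · trivial
  set ws := xs.flatMap WorldRecord.encode with hws'
  have hlen := numDep_lt_length_encodeFml φ
  set m₀ : Mem k :=
    { Mem.empty k with
      main := toks (ws ++ encodeFml φ)
      form := toks (ws ++ encodeFml φ)
      len := m.len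
      lenR := m.lenR
      recs := m.recs
      pend := m.pend } with hm₀
  have h1 := iterate_choiceStep_skip N ws { initReg k with parse := r.parse, first := r.first }
    m₀ (toks (encodeFml φ)) hws
  have h2 := iterate_choiceStep N φ hφ { initReg k with parse := r.parse, first := r.first }
    { m₀ with mainR := (toks ws).reverse ++ m₀.mainR } []
  rw [List.append_nil] at h2
  rw [← toks_append] at h1
  have h3 := iterate_trans h1 h2
  rw [← List.length_append] at h3
  have h4 : run N (.rep choiceStep) _ = _ := run_rep_next N _ _ h3 hN rfl
  have h5 : run N initChoice ({ initReg k with parse := r.parse, first := r.first }, m₀) =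
      searchState { initReg k with parse := r.parse, first := r.first } m₀
        (ws ++ encodeFml φ) (List.replicate φ.numDep (firstLetter k), false, false) := by
    refine (congrArg (run N (move .mainR .main)) h4).trans ?_
    rw [run_move _ _ _ (by decide) (by
      simp only [List.length_append] at hN
      simp only [Mem.get, List.length_append, List.length_reverse, length_toks, hm₀, Mem.empty,
        List.length_nil]
      omega)]
    simp [Mem.get, Mem.set, searchState, testState, toks, hm₀, Mem.empty, initReg]
  rw [search, run_seq, h5, run_seq, run_repPow, iterate_searchBody N φ _ _ ws hφ xs hws' hws hN
    (by simp at hN; omega) _ _ (by simp), searchState, testState, run_load]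
  exact searchStep_iterate_iff _ _ _

end MProg

/-! ### Correctness of the search -/

/-- The records of the worlds of an input. -/
def Input.records (I : Input) : List MProg.WorldRecord :=
  (List.finRange I.n).map fun i => ⟨I.team i, List.ofFn (I.adj i), I.labels i⟩

theorem Input.encode_eq (I : Input) :
    I.encode = I.records.flatMap MProg.WorldRecord.encode ++ encodeFml I.fml := by
  have : ∀ i, I.encodeWorld i =
      MProg.WorldRecord.encode ⟨I.team i, List.ofFn (I.adj i), I.labels i⟩ := fun i => by
    simp only [Input.encodeWorld, MProg.WorldRecord.encode, List.map_ofFn]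
    rfl
  rw [Input.encode, Input.records, List.flatMap_map]
  congr 2
  funext i
  exact this i

/-- The first alternative is the characterisation by letters. The second one, which the algorithm
also accepts, is harmless: it forces more than `log₂` of the number of worlds many positive atoms.
-/
theorem Input.sat_iff (I : Input) (k : ℕ) (hφ : I.fml.Disj) (hk : I.fml.ArityLE k) (N : ℕ)
    (hN : I.encode.length ≤ N) :
    I.kripke.Sat I.teamSet I.fml ↔
      (∃ cs : List (Letter k), cs.length = I.fml.numDep ∧
        (I.records.all fun x => !x.team || covers k (MProg.valuation x.labels) I.fml cs) = true) ∨
      N ^ 2 ^ k < (2 ^ 2 ^ k) ^ I.fml.numDep := by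
  have h1 := I.kripke.sat_iff_exists_covers (fun i => MProg.valuation (I.labels i))
    (fun i p => by simp [MProg.valuation, Input.kripke]) k I.fml hφ hk I.teamSet
  have h2 : ∀ cs : List (Letter k),
      (I.records.all fun x => !x.team || covers k (MProg.valuation x.labels) I.fml cs) = true ↔
      ∀ i ∈ I.teamSet, covers k (MProg.valuation (I.labels i)) I.fml cs = true := fun cs => by
    simp only [Input.records, List.all_map, List.all_eq_true, List.mem_finRange, Function.comp,
      Bool.or_eq_true, Bool.not_eq_true', true_imp_iff, Input.teamSet, Set.mem_ofPred_eq]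
    refine forall_congr' fun i => ?_
    cases I.team i <;> simp
  simp only [h2, ← h1]
  refine ⟨Or.inl, fun h => h.elim id fun h => ?_⟩
  refine I.kripke.sat_of_card_lt I.fml hφ ?_ _
  -- The number of strings is `(2 ^ d) ^ 2 ^ k`, so taking roots leaves `N < 2 ^ d` for the number
  -- `d` of positive atoms.
  rw [← pow_mul, mul_comm, pow_mul] at h
  have h3 := lt_of_pow_lt_pow_left₀ _ (by positivity) h
  rw [Fintype.card_fin]
  refine lt_of_le_of_lt (le_trans ?_ hN) h3
  rw [Input.encode_eq, List.length_append, List.length_flatMap]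
  have h4 : I.n = I.records.length := by simp [Input.records]
  -- Every record has at least one token, so the input is at least as long as there are worlds.
  have h5 : I.records.length * 1 ≤ (I.records.map fun x => x.encode.length).sum := by
    have := List.card_nsmul_le_sum (I.records.map fun x => x.encode.length) 1 (by
      intro y hy
      obtain ⟨x, _, rfl⟩ := List.mem_map.1 hy
      simp [MProg.WorldRecord.encode])
    simpa using this
  omega

end MDL

namespace MDL

/-! ### Parsing -/

/-- The configurations of the parser: its state, whether no world has been read, the numbers of
entries of the current row of the adjacency matrix that are still to be read and that have been
read, and the numbers of worlds and of formulae that are still to be read. -/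
structure Config (k : ℕ) where
  q : ParseState k
  first : Bool
  len : ℕ
  lenR : ℕ
  recs : ℕ
  pend : ℕ

namespace Config

variable {k : ℕ}

/-- Reads the first symbol of a formula or of a negated atom. -/
def atomStep (ok : Bool) (q : ParseState k) (c : Config k) : Config k :=
  bif ok then { c with q := q } else { c with q := .fail }

open scoped Classical in
/-- Reads a symbol where a formula begins. -/
noncomputable def fmlStep (M : Set Op) (c : Config k) (t : Token) : Config k :=
  match c.pend with
  | 0 => { c with q := .fail }
  | d + 1 => match t with
    | .or => bif decide (Op.or ∈ M) then { c with q := .fml, pend := d + 2 }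
        else { c with q := .fail, pend := d }
    | .prop => { c with q := .name, pend := d }
    | .neg => atomStep (decide (Op.neg ∈ M)) .neg { c with pend := d }
    | .dep => atomStep (decide (Op.dep ∈ M)) (.deps (Fin.last k)) { c with pend := d }
    | _ => { c with q := .fail, pend := d }

/-- Reads a symbol where the record of a world or the formula begins. -/
noncomputable def startStep (M : Set Op) (c : Config k) (t : Token) : Config k :=
  match t with
  | .bit _ => { c with q := .adj }
  | t => bif c.first then { c with q := .fail } else match c.recs with
    | 0 => fmlStep M c t
    | n + 1 => { c with q := .fail, recs := n }

/-- Reads a symbol in a row of the adjacency matrix. -/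
def adjStep (c : Config k) (t : Token) : Config k :=
  match t with
  | .bit _ => bif c.first then { c with lenR := c.lenR + 1, recs := c.recs + 1 } else
      match c.len with
      | 0 => { c with q := .fail }
      | n + 1 => { c with len := n, lenR := c.lenR + 1 }
  | .sep => match c.len with
      | 0 => match c.recs with
        | 0 => { c with q := .fail }
        | n + 1 => { c with q := .labels, first := false, len := c.lenR, lenR := 0, recs := n }
      | n + 1 => { c with q := .fail, len := n }
  | _ => { c with q := .fail }

/-- The state in which a further argument of a dependence atom is being read. -/
def depsState (f : Fin (k + 1) → ParseState k) (c : Fin (k + 1)) : ParseState k :=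
  if h : 0 < (c : ℕ) then f ⟨c - 1, by omega⟩ else .fail

/-- The next state of the parser if it does not depend on the counters. -/
noncomputable def nextState : ParseState k → Token → ParseState k
  | .labels, .bit _ => .label
  | .labels, .endName => .labels
  | .labels, .sep => .start
  | .label, .bit _ => .label
  | .label, .endName => .labels
  | .name, .bit _ => .name
  | .name, .endName => .fml
  | .deps _, .sep => .name
  | .deps c, .bit _ => depsState .depsName c
  | .deps c, .endName => depsState .deps c
  | .depsName c, .bit _ => .depsName c
  | .depsName c, .endName => .deps c
  | _, _ => .fail

open scoped Classical in
/-- Reads a symbol after a negation. -/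
noncomputable def negStep (M : Set Op) (c : Config k) (t : Token) : Config k :=
  match t with
  | .prop => { c with q := .name }
  | .dep => atomStep (decide (Op.dep ∈ M)) (.deps (Fin.last k)) c
  | _ => { c with q := .fail }

/-- Reads a symbol. -/
noncomputable def step (M : Set Op) (c : Config k) (t : Token) : Config k :=
  match c.q with
  | .start => startStep M c t
  | .adj => adjStep c t
  | .fml => fmlStep M c t
  | .neg => negStep M c t
  | q => { c with q := nextState q t }

/-- The parser accepts a string. -/
def Accepts (M : Set Op) (c : Config k) (w : List Token) : Prop :=
  (w.foldl (step (k := k) M) c).q = .fml ∧ (w.foldl (step (k := k) M) c).pend = 0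

/-! ### Every accepted string is an encoding -/

variable {M : Set Op} {c : Config k}

theorem foldl_step_fail (h : c.q = .fail) (w : List Token) : w.foldl (step M) c = c := by
  induction w with
  | nil => rfl
  | cons t w ih =>
    have e : step M c t = c := by
      cases c
      cases h
      rfl
    rw [List.foldl_cons, e, ih]

theorem not_accepts_fail (h : c.q = .fail) (w : List Token) : ¬ Accepts M c w := by
  rw [Accepts, foldl_step_fail h, h]
  simp

theorem not_accepts_cons {t : Token} {w : List Token} (h : Accepts M c (t :: w))
    (e : (step M c t).q = .fail) : False := not_accepts_fail e w h

theorem not_accepts_nil (h : c.q ≠ .fml) : ¬ Accepts M c [] := fun h' => h h'.1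

theorem accepts_fml_zero {w : List Token}
    (h : Accepts (k := k) M { c with q := .fml, pend := 0 } w) :
    w = [] := by
  cases w with
  | nil => rfl
  | cons t w => exact (not_accepts_cons h rfl).elim

theorem accepts_name {w : List Token} (h : Accepts (k := k) M { c with q := .name } w) :
    ∃ p r, w = encodeName p ++ r ∧
        Accepts (k := k) M { c with q := .fml } r := by
  induction w with
  | nil => exact (not_accepts_nil (by simp) h).elim
  | cons t w ih =>
    cases t with
    | bit b =>
      obtain ⟨p, r, rfl, hr⟩ := ih h
      exact ⟨b :: p, r, rfl, hr⟩
    | endName => exact ⟨[], w, rfl, h⟩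
    | _ => exact (not_accepts_cons h rfl).elim

/-- Two states have to be treated in one induction, between two names and inside a name; in the
second one, `p` is the rest of the current name. -/
theorem accepts_labels {w : List Token} :
    (Accepts (k := k) M { c with q := .labels } w → ∃ (ls : List Name) (r : List Token),
      w = ls.flatMap encodeName ++ .sep :: r ∧ Accepts (k := k) M { c with q := .start } r) ∧
    (Accepts (k := k) M { c with q := .label } w →
      ∃ (p : Name) (ls : List Name) (r : List Token),
      w = encodeName p ++ ls.flatMap encodeName ++ .sep :: r ∧
        Accepts (k := k) M { c with q := .start } r) := by
  induction w with
  | nil => exact ⟨fun h => (not_accepts_nil (by simp) h).elim,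
      fun h => (not_accepts_nil (by simp) h).elim⟩
  | cons t w ih =>
    constructor
    · intro h
      cases t with
      | bit b =>
        obtain ⟨p, ls, r, rfl, hr⟩ := ih.2 h
        exact ⟨(b :: p) :: ls, r, rfl, hr⟩
      | endName =>
        obtain ⟨ls, r, rfl, hr⟩ := ih.1 h
        exact ⟨[] :: ls, r, rfl, hr⟩
      | sep => exact ⟨[], w, rfl, h⟩
      | _ => exact (not_accepts_cons h rfl).elim
    · intro h
      cases t with
      | bit b =>
        obtain ⟨p, ls, r, rfl, hr⟩ := ih.2 h
        exact ⟨b :: p, ls, r, rfl, hr⟩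
      | endName =>
        obtain ⟨ls, r, rfl, hr⟩ := ih.1 h
        exact ⟨[], ls, r, rfl, hr⟩
      | _ => exact (not_accepts_cons h rfl).elim

/-- The index `i` is the number of arguments that may still begin. It drops with the first token of
each name, which for the empty name is the end marker, so the arity bound is enforced by finitely
many states. -/
theorem accepts_deps {w : List Token} : ∀ i : Fin (k + 1),
    (Accepts (k := k) M { c with q := .deps i } w → ∃ (ps : List Name) (r : List Token),
      ps.length ≤ i ∧ w = ps.flatMap encodeName ++ .sep :: r ∧
        Accepts (k := k) M { c with q := .name } r) ∧
    (Accepts (k := k) M { c with q := .depsName i } w →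
      ∃ (p : Name) (ps : List Name) (r : List Token),
      ps.length ≤ i ∧ w = encodeName p ++ ps.flatMap encodeName ++ .sep :: r ∧
        Accepts (k := k) M { c with q := .name } r) := by
  induction w with
  | nil => exact fun i => ⟨fun h => (not_accepts_nil (by simp) h).elim,
      fun h => (not_accepts_nil (by simp) h).elim⟩
  | cons t w ih =>
    intro i
    constructor
    · intro h
      cases t with
      | bit b =>
        have h' : Accepts (k := k) M { c with q := depsState .depsName i } w := h
        by_cases hi : 0 < (i : ℕ)
        · rw [depsState, dif_pos hi] at h'
          obtain ⟨p, ls, r, hl, rfl, hr⟩ := (ih _).2 h'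
          refine ⟨(b :: p) :: ls, r, ?_, rfl, hr⟩
          simp only [List.length_cons] at hl ⊢
          omega
        · rw [depsState, dif_neg hi] at h'
          exact (not_accepts_fail rfl _ h').elim
      | endName =>
        have h' : Accepts (k := k) M { c with q := depsState .deps i } w := h
        by_cases hi : 0 < (i : ℕ)
        · rw [depsState, dif_pos hi] at h'
          obtain ⟨ls, r, hl, rfl, hr⟩ := (ih _).1 h'
          refine ⟨[] :: ls, r, ?_, rfl, hr⟩
          simp only [List.length_cons] at hl ⊢
          omega
        · rw [depsState, dif_neg hi] at h'
          exact (not_accepts_fail rfl _ h').elim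
      | sep => exact ⟨[], w, by simp, rfl, h⟩
      | _ => exact (not_accepts_cons h rfl).elim
    · intro h
      cases t with
      | bit b =>
        obtain ⟨p, ls, r, hl, rfl, hr⟩ := (ih i).2 h
        exact ⟨b :: p, ls, r, hl, rfl, hr⟩
      | endName =>
        obtain ⟨ls, r, hl, rfl, hr⟩ := (ih i).1 h
        exact ⟨[], ls, r, hl, rfl, hr⟩
      | _ => exact (not_accepts_cons h rfl).elim

theorem accepts_atomStep {ok : Bool} {q : ParseState k} {w : List Token}
    (h : Accepts M (atomStep ok q c) w) : ok = true ∧ Accepts (k := k) M { c with q := q } w := by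
  cases ok with
  | false => exact (not_accepts_fail rfl _ h).elim
  | true => exact ⟨rfl, h⟩

theorem accepts_args {w : List Token}
    (h : Accepts (k := k) M { c with q := .deps (Fin.last k) } w) :
    ∃ (ps : List Name) (p : Name) (r : List Token), ps.length ≤ k ∧
      w = ps.flatMap encodeName ++ .sep :: encodeName p ++ r ∧
        Accepts (k := k) M { c with q := .fml } r := by
  obtain ⟨ps, r, hl, rfl, hr⟩ := (accepts_deps _).1 h
  obtain ⟨p, r', rfl, hr'⟩ := accepts_name hr
  exact ⟨ps, p, r', hl, by simp, hr'⟩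

open scoped Classical in
-- The counter `pend` replaces a parse stack: a disjunction trades one pending formula for two. The
-- induction is on the length, because the second disjunct starts at whatever the first one has
-- left.
theorem accepts_fml {w : List Token} {d : ℕ}
    (h : Accepts (k := k) M { c with q := .fml, pend := d + 1 } w) :
    ∃ (φ : Fml Name) (r : List Token), w = encodeFml φ ++ r ∧ φ ∈ fragment Name k M ∧
      Accepts (k := k) M { c with q := .fml, pend := d } r := by
  induction hn : w.length using Nat.strong_induction_on generalizing w d with
  | _ n ih =>
    cases w with
    | nil => exact absurd h.2 (by simp)
    | cons t w =>
      cases t with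
      | or =>
        by_cases ho : Op.or ∈ M
        · have h' : Accepts M (bif decide (Op.or ∈ M) then { c with q := .fml, pend := d + 2 }
            else { c with q := .fail, pend := d }) w := h
          rw [decide_eq_true ho] at h'
          obtain ⟨φ, r, rfl, hφ, hr⟩ := ih w.length (by simp [← hn]) h' rfl
          obtain ⟨ψ, r, rfl, hψ, hr⟩ := ih r.length (by simp [← hn]) hr rfl
          refine ⟨.or φ ψ, r, by simp [encodeFml], ⟨?_, hφ.2, hψ.2⟩, hr⟩
          exact Set.union_subset (Set.union_subset (by simpa using ho) hφ.1) hψ.1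
        · have h' : Accepts M (bif decide (Op.or ∈ M) then { c with q := .fml, pend := d + 2 }
            else { c with q := .fail, pend := d }) w := h
          rw [decide_eq_false ho] at h'
          exact (not_accepts_fail rfl _ h').elim
      | prop =>
        obtain ⟨p, r, rfl, hr⟩ := accepts_name (c := { c with pend := d }) h
        exact ⟨.prop p, r, rfl, ⟨Set.empty_subset _, trivial⟩, hr⟩
      | neg =>
        obtain ⟨ho, h⟩ := accepts_atomStep (c := { c with pend := d }) h
        have ho := of_decide_eq_true ho
        cases w with
        | nil => exact (not_accepts_nil (by simp) h).elim
        | cons t w =>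
          cases t with
          | prop =>
            obtain ⟨p, r, rfl, hr⟩ := accepts_name (c := { c with pend := d }) h
            exact ⟨.nprop p, r, rfl, ⟨by simpa [Fml.ops] using ho, trivial⟩, hr⟩
          | dep =>
            obtain ⟨ho', h⟩ := accepts_atomStep (c := { c with q := .neg, pend := d }) h
            have ho' := of_decide_eq_true ho'
            obtain ⟨ps, p, r, hl, rfl, hr⟩ := accepts_args (c := { c with pend := d }) h
            refine ⟨.ndep ps p, r, rfl, ⟨?_, hl⟩, hr⟩
            rintro x (rfl | rfl) <;> assumption
          | _ => exact (not_accepts_cons h rfl).elim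
      | dep =>
        obtain ⟨ho, h⟩ := accepts_atomStep (c := { c with q := .fml, pend := d }) h
        have ho := of_decide_eq_true ho
        obtain ⟨ps, p, r, hl, rfl, hr⟩ := accepts_args (c := { c with pend := d }) h
        exact ⟨.dep ps p, r, rfl, ⟨by simpa [Fml.ops] using ho, hl⟩, hr⟩
      | _ => exact (not_accepts_cons h rfl).elim

/-- The first row of the matrix determines the number of worlds, both as the length of the later
rows and as the number of records. The record being read is already one of them, which is why `n'`
is smaller by one; an empty row is rejected, so there is at least one world. -/
theorem accepts_adj_first {w : List Token} {l n : ℕ}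
    (h : Accepts (k := k) M { c with q := .adj, first := true, len := 0, lenR := l, recs := n } w) :
    ∃ (bs : List Bool) (r : List Token) (n' : ℕ), w = bs.map Token.bit ++ .sep :: r ∧
      n + bs.length = n' + 1 ∧
      Accepts (k := k) M { c with q := .labels, first := false, len := l + bs.length, lenR := 0,
                                  recs := n' } r := by
  induction w generalizing l n with
  | nil => exact (not_accepts_nil (by simp) h).elim
  | cons t w ih =>
    cases t with
    | bit b =>
      obtain ⟨bs, r, n', rfl, hn, hr⟩ := ih (l := l + 1) (n := n + 1) h
      refine ⟨b :: bs, r, n', rfl, by simp; omega, ?_⟩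
      rwa [List.length_cons, add_comm bs.length, ← add_assoc]
    | sep =>
      cases n with
      | zero => exact (not_accepts_cons h rfl).elim
      | succ n => exact ⟨[], w, n, rfl, rfl, h⟩
    | _ => exact (not_accepts_cons h rfl).elim

/-- A later row counts `len` down to zero and `lenR` up at the same time, so that the row length is
available again for the next record. -/
theorem accepts_adj {w : List Token} {l l' n : ℕ}
    (h : Accepts (k := k) M
      { c with q := .adj, first := false, len := l, lenR := l', recs := n } w) :
    ∃ (bs : List Bool) (r : List Token) (n' : ℕ), w = bs.map Token.bit ++ .sep :: r ∧
      n = n' + 1 ∧ bs.length = l ∧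
      Accepts (k := k) M { c with q := .labels, first := false, len := l' + l, lenR := 0,
                                  recs := n' } r := by
  induction w generalizing l l' with
  | nil => exact (not_accepts_nil (by simp) h).elim
  | cons t w ih =>
    cases t with
    | bit b =>
      cases l with
      | zero => exact (not_accepts_cons h rfl).elim
      | succ l =>
        obtain ⟨bs, r, n', rfl, hn, hl, hr⟩ := ih (l := l) (l' := l' + 1) h
        refine ⟨b :: bs, r, n', rfl, hn, by simp [hl], ?_⟩
        rwa [add_comm l, ← add_assoc]
    | sep =>
      cases l with
      | zero =>
        cases n with
        | zero => exact (not_accepts_cons h rfl).elim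
        | succ n => exact ⟨[], w, n, rfl, rfl, rfl, h⟩
      | succ l => exact (not_accepts_cons h rfl).elim
    | _ => exact (not_accepts_cons h rfl).elim

/-- Some formula of the fragment is encoded by the string. -/
theorem accepts_fml_one {w : List Token}
    (h : Accepts (k := k) M { c with q := .fml, pend := 1 } w) :
    ∃ φ ∈ fragment Name k M, w = encodeFml φ := by
  obtain ⟨φ, r, rfl, hφ, hr⟩ := accepts_fml h
  obtain rfl := accepts_fml_zero hr
  exact ⟨φ, hφ, by simp⟩

/-- The initial configuration. -/
def init (k : ℕ) : Config k := ⟨.start, true, 0, 0, 0, 1⟩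

/-- The formula may begin only when no record is outstanding. -/
theorem accepts_start_of_ne {w : List Token} {l l' n : ℕ} {t : Token} (ht : ∀ b, t ≠ .bit b)
    (h : Accepts (k := k) M ⟨.start, false, l, l', n, 1⟩ (t :: w)) :
    n = 0 ∧ ∃ φ ∈ fragment Name k M, t :: w = encodeFml φ := by
  cases n with
  | zero =>
    refine ⟨rfl, accepts_fml_one (c := ⟨.fml, false, l, l', 0, 1⟩) ?_⟩
    cases t <;> first | exact (ht _ rfl).elim | exact h
  | succ n =>
    cases t <;> first | exact (ht _ rfl).elim | exact (not_accepts_cons h rfl).elim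

theorem accepts_start {w : List Token} {l n : ℕ}
    (h : Accepts (k := k) M ⟨.start, false, l, 0, n, 1⟩ w) :
    ∃ xs : List MProg.WorldRecord, xs.length = n ∧ (∀ x ∈ xs, x.adj.length = l) ∧
      ∃ φ ∈ fragment Name k M, w = xs.flatMap MProg.WorldRecord.encode ++ encodeFml φ := by
  induction n generalizing w with
  | zero =>
    cases w with
    | nil => exact (not_accepts_nil (by simp) h).elim
    | cons t w =>
      by_cases ht : ∃ b, t = .bit b
      · obtain ⟨b, rfl⟩ := ht
        -- A further record would have to be counted off from `0`.
        obtain ⟨bs, r, n', rfl, hn, -⟩ := accepts_adj (c := init k) (l := l) (l' := 0) (n := 0) h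
        omega
      · obtain ⟨-, φ, hφ, e⟩ := accepts_start_of_ne (fun b hb => ht ⟨b, hb⟩) h
        exact ⟨[], rfl, by simp, φ, hφ, e⟩
  | succ n ih =>
    cases w with
    | nil => exact (not_accepts_nil (by simp) h).elim
    | cons t w =>
      by_cases ht : ∃ b, t = .bit b
      · obtain ⟨b, rfl⟩ := ht
        obtain ⟨bs, r, n', rfl, hn, hl, h⟩ := accepts_adj (c := init k) (l := l) (l' := 0)
          (n := n + 1) h
        obtain rfl : n = n' := by omega
        rw [zero_add] at h
        obtain ⟨ls, r, rfl, h'⟩ := (accepts_labels (c := ⟨.start, false, l, 0, n, 1⟩)).1 h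
        obtain ⟨xs, hxs, hxs', φ, hφ, rfl⟩ := ih h'
        refine ⟨⟨b, bs, ls⟩ :: xs, by simp [hxs], ?_, φ, hφ, by simp [MProg.WorldRecord.encode]⟩
        rintro x (_ | ⟨_, hx⟩)
        exacts [hl, hxs' x hx]
      · obtain ⟨hn, -⟩ := accepts_start_of_ne (fun b hb => ht ⟨b, hb⟩) h
        omega

theorem accepts_init {w : List Token} (h : Accepts M (init k) w) :
    ∃ xs : List MProg.WorldRecord, xs ≠ [] ∧ (∀ x ∈ xs, x.adj.length = xs.length) ∧
      ∃ φ ∈ fragment Name k M, w = xs.flatMap MProg.WorldRecord.encode ++ encodeFml φ := by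
  cases w with
  | nil => exact (not_accepts_nil (by simp [init]) h).elim
  | cons t w =>
    cases t with
    | bit b =>
      obtain ⟨bs, r, n, rfl, hn, h⟩ := accepts_adj_first (c := init k) h
      obtain ⟨ls, r, rfl, h'⟩ :=
        (accepts_labels (c := ⟨.start, false, 0 + bs.length, 0, n, 1⟩)).1 h
      obtain ⟨xs, hxs, hxs', φ, hφ, rfl⟩ := accepts_start h'
      refine ⟨⟨b, bs, ls⟩ :: xs, by simp, ?_, φ, hφ, by simp [MProg.WorldRecord.encode]⟩
      rintro x (_ | ⟨_, hx⟩)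
      · rw [List.length_cons, hxs]
        exact (Nat.zero_add _).symm.trans hn
      · rw [hxs' x hx, List.length_cons, hxs, zero_add]
        exact (Nat.zero_add _).symm.trans hn
    | _ => exact (not_accepts_cons h rfl).elim

/-! ### Every encoding is accepted -/

theorem foldl_trans {c c' c'' : Config k} {w w' : List Token} (h : w.foldl (step M) c = c')
    (h' : w'.foldl (step M) c' = c'') : (w ++ w').foldl (step M) c = c'' := by
  rw [List.foldl_append, h, h']

theorem foldl_encodeName (c : Config k) (p : Name) :
    (encodeName p).foldl (step (k := k) M) { c with q := .name } = { c with q := .fml } := by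
  induction p with
  | nil => rfl
  | cons b p ih => exact ih

theorem foldl_encodeName_labels (c : Config k) (p : Name) :
    (encodeName p).foldl (step (k := k) M) { c with q := .label } = { c with q := .labels } := by
  induction p with
  | nil => rfl
  | cons b p ih => exact ih

theorem foldl_encodeName_depsName (c : Config k) (i : Fin (k + 1)) (p : Name) :
    (encodeName p).foldl (step (k := k) M) { c with q := .depsName i } =
      { c with q := .deps i } := by
  induction p with
  | nil => rfl
  | cons b p ih => exact ih

theorem foldl_labels (c : Config k) (ls : List Name) :
    (ls.flatMap encodeName ++ [Token.sep]).foldl (step (k := k) M) { c with q := .labels } =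
      { c with q := .start } := by
  induction ls with
  | nil => rfl
  | cons p ls ih =>
    rw [List.flatMap_cons, List.append_assoc]
    cases p with
    | nil => exact ih
    | cons b p => exact foldl_trans (foldl_encodeName_labels c p) ih

theorem foldl_args (c : Config k) (ps : List Name) (p : Name) (i : Fin (k + 1))
    (h : ps.length ≤ i) :
    (ps.flatMap encodeName ++ .sep :: encodeName p).foldl (step (k := k) M)
        { c with q := .deps i } =
      { c with q := .fml } := by
  induction ps generalizing i with
  | nil => exact foldl_encodeName c p
  | cons x ps ih =>
    rw [List.flatMap_cons, List.append_assoc, List.foldl_append]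
    have hi : 0 < (i : ℕ) := lt_of_lt_of_le (by simp) h
    have ih' := ih ⟨i - 1, by omega⟩ (by simp only [List.length_cons] at h ⊢; omega)
    cases x with
    | nil =>
      have e : (encodeName []).foldl (step (k := k) M) { c with q := .deps i } =
        { c with q := depsState .deps i } := rfl
      rw [e, depsState, dif_pos hi]
      exact ih'
    | cons b x =>
      have e : (encodeName (b :: x)).foldl (step (k := k) M) { c with q := .deps i } =
        (encodeName x).foldl (step (k := k) M) { c with q := depsState .depsName i } := rfl
      rw [e, depsState, dif_pos hi, foldl_encodeName_depsName]
      exact ih'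

open scoped Classical in
-- A complete formula settles exactly one pending formula. `Disj` is needed because the parser
-- rejects the other connectives even if they belong to `M`.
theorem foldl_encodeFml (φ : Fml Name) (hφ : φ.Disj) (hM : φ ∈ fragment Name k M) (c : Config k)
    (d : ℕ) : (encodeFml φ).foldl (step (k := k) M) { c with q := .fml, pend := d + 1 } =
      { c with q := .fml, pend := d } := by
  obtain ⟨hM, hk⟩ := hM
  induction φ generalizing d with
  | prop p => exact foldl_encodeName { c with pend := d } p
  | nprop p =>
    have hn : Op.neg ∈ M := by simpa [Fml.ops] using hM
    have e : step (k := k) M { c with q := .fml, pend := d + 1 } .neg =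
        atomStep (decide (Op.neg ∈ M)) .neg { c with q := .fml, pend := d } := rfl
    rw [encodeFml, List.foldl_cons, e, decide_eq_true hn]
    exact foldl_encodeName { c with pend := d } p
  | dep ps p =>
    have hd : Op.dep ∈ M := by simpa [Fml.ops] using hM
    have e : step (k := k) M { c with q := .fml, pend := d + 1 } .dep =
        atomStep (decide (Op.dep ∈ M)) (.deps (Fin.last k)) { c with q := .fml, pend := d } := rfl
    have e' : encodeFml (.dep ps p) = .dep :: (ps.flatMap encodeName ++ .sep :: encodeName p) := rfl
    rw [e', List.foldl_cons, e, decide_eq_true hd]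
    exact foldl_args { c with pend := d } ps p _ hk
  | ndep ps p =>
    have hn : Op.neg ∈ M := hM (by simp [Fml.ops])
    have hd : Op.dep ∈ M := hM (by simp [Fml.ops])
    have e : step (k := k) M { c with q := .fml, pend := d + 1 } .neg =
        atomStep (decide (Op.neg ∈ M)) .neg { c with q := .fml, pend := d } := rfl
    have e₂ : step (k := k) M { c with q := .neg, pend := d } .dep =
        atomStep (decide (Op.dep ∈ M)) (.deps (Fin.last k)) { c with q := .neg, pend := d } := rfl
    have e' : encodeFml (.ndep ps p) =
      .neg :: .dep :: (ps.flatMap encodeName ++ .sep :: encodeName p) := rfl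
    rw [e', List.foldl_cons, e, decide_eq_true hn, List.foldl_cons]
    rw [decide_eq_true hd] at e₂
    refine (congrArg (fun x => List.foldl (step M) x _) e₂).trans ?_
    exact foldl_args { c with pend := d } ps p _ hk
  | or φ ψ ih₁ ih₂ =>
    have ho : Op.or ∈ M := hM (by simp [Fml.ops])
    have e : step (k := k) M { c with q := .fml, pend := d + 1 } .or =
        bif decide (Op.or ∈ M) then { c with q := .fml, pend := d + 2 }
        else { c with q := .fail, pend := d } := rfl
    have e' : encodeFml (.or φ ψ) = .or :: (encodeFml φ ++ encodeFml ψ) := rfl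
    rw [e', List.foldl_cons, e, decide_eq_true ho]
    refine foldl_trans (ih₁ hφ.1 (d + 1) (fun x hx => hM ?_) hk.1)
      (ih₂ hφ.2 d (fun x hx => hM ?_) hk.2)
    · exact Or.inl (Or.inr hx)
    · exact Or.inr hx
  | _ => exact hφ.elim

theorem foldl_adj_first (c : Config k) (bs : List Bool) (l n : ℕ) :
    (bs.map Token.bit).foldl (step (k := k) M)
        { c with q := .adj, first := true, lenR := l, recs := n } =
      { c with q := .adj, first := true, lenR := l + bs.length, recs := n + bs.length } := by
  induction bs generalizing l n with
  | nil => rfl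
  | cons b bs ih =>
    refine (ih (l + 1) (n + 1)).trans ?_
    simp only [List.length_cons, Nat.add_right_comm, Nat.add_assoc]

theorem foldl_adj (c : Config k) (bs : List Bool) (l : ℕ) :
    (bs.map Token.bit).foldl (step (k := k) M)
        { c with q := .adj, first := false, len := bs.length, lenR := l } =
      { c with q := .adj, first := false, len := 0, lenR := l + bs.length } := by
  induction bs generalizing l with
  | nil => rfl
  | cons b bs ih =>
    refine (ih (l + 1)).trans ?_
    simp only [List.length_cons, Nat.add_assoc, Nat.add_comm 1]

theorem foldl_encode (c : Config k) (x : MProg.WorldRecord) (n : ℕ) :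
    x.encode.foldl (step (k := k) M)
        { c with q := .start, first := false, len := x.adj.length, lenR := 0, recs := n + 1 } =
      { c with q := .start, first := false, len := x.adj.length, lenR := 0, recs := n } := by
  rw [MProg.WorldRecord.encode, List.append_assoc, List.cons_append, List.foldl_cons]
  refine foldl_trans (foldl_adj { c with recs := n + 1 } x.adj 0) ?_
  rw [zero_add]
  exact foldl_labels { c with first := false, len := x.adj.length, lenR := 0, recs := n } x.labels

theorem foldl_flatMap_encode (c : Config k) (xs : List MProg.WorldRecord) (l : ℕ)
    (h : ∀ x ∈ xs, x.adj.length = l) :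
    (xs.flatMap MProg.WorldRecord.encode).foldl (step (k := k) M)
        { c with q := .start, first := false, len := l, lenR := 0, recs := xs.length } =
      { c with q := .start, first := false, len := l, lenR := 0, recs := 0 } := by
  induction xs with
  | nil => rfl
  | cons x xs ih =>
    rw [List.flatMap_cons, ← h x (by simp)]
    refine foldl_trans (foldl_encode c x xs.length) ?_
    rw [h x (by simp)]
    exact ih fun y hy => h y (List.mem_cons_of_mem _ hy)

theorem accepts_of_records {xs : List MProg.WorldRecord} (hxs : xs ≠ [])
    (h : ∀ x ∈ xs, x.adj.length = xs.length) {φ : Fml Name} (hφ : φ.Disj)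
    (hM : φ ∈ fragment Name k M) :
    Accepts M (init k) (xs.flatMap MProg.WorldRecord.encode ++ encodeFml φ) := by
  obtain ⟨x, xs, rfl⟩ := List.exists_cons_of_ne_nil hxs
  have e : ((x :: xs).flatMap MProg.WorldRecord.encode).foldl (step (k := k) M) (init k) =
      { init k with first := false, len := xs.length + 1 } := by
    have hx' : x.encode = .bit x.team ::
        (x.adj.map Token.bit ++ (.sep :: x.labels.flatMap encodeName ++ [Token.sep])) := by
      simp [MProg.WorldRecord.encode]
    rw [List.flatMap_cons, hx', List.cons_append, List.foldl_cons]
    have hx : x.adj.length = xs.length + 1 := h x (by simp)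
    have h' := foldl_adj_first (M := M) (init k) x.adj 0 0
    rw [zero_add, hx] at h'
    have h₂ : (Token.sep :: x.labels.flatMap encodeName ++ [Token.sep]).foldl (step (k := k) M)
        ⟨.adj, true, 0, xs.length + 1, xs.length + 1, 1⟩ =
        ⟨.start, false, xs.length + 1, 0, xs.length, 1⟩ :=
      foldl_labels (M := M) ⟨.start, false, xs.length + 1, 0, xs.length, 1⟩ x.labels
    refine foldl_trans (foldl_trans h' h₂) ?_
    exact foldl_flatMap_encode (init k) xs _ fun y hy => h y (List.mem_cons_of_mem _ hy)
  -- With no record outstanding, the state `start` treats the first token of a formula just as `fml`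
  -- does.
  have e' : (encodeFml φ).foldl (step (k := k) M)
        { init k with first := false, len := xs.length + 1 } =
      { init k with q := .fml, first := false, len := xs.length + 1, pend := 0 } := by
    refine Eq.trans ?_ (foldl_encodeFml φ hφ hM { init k with first := false,
                                                              len := xs.length + 1 } 0)
    cases φ <;> rfl
  rw [Accepts, List.foldl_append, e, e']
  exact ⟨rfl, rfl⟩

end Config

/-- The input with the given records of worlds. -/
theorem Input.exists_records_eq {xs : List MProg.WorldRecord} (hxs : xs ≠ [])
    (h : ∀ x ∈ xs, x.adj.length = xs.length) (φ : Fml Name) :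
    ∃ I : Input, I.records = xs ∧ I.fml = φ := by
  have hl : ∀ i j : Fin xs.length, (j : ℕ) < xs[i].adj.length := fun i j =>
    j.2.trans_eq (h _ (List.getElem_mem _)).symm
  refine ⟨⟨xs.length, List.length_pos_iff.2 hxs, fun i j => xs[i].adj[j]'(hl i j),
    fun i => xs[i].labels, fun i => xs[i].team, φ⟩, ?_, rfl⟩
  refine List.ext_getElem (by simp [records]) fun i h₁ h₂ => ?_
  have e : List.ofFn (fun j : Fin xs.length => xs[i].adj[(j : ℕ)]'(hl ⟨i, h₂⟩ j)) = xs[i].adj :=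
    List.ext_getElem (by simp [h _ (List.getElem_mem h₂)]) fun j _ _ => by simp
  simp only [records, List.getElem_map, List.getElem_finRange, Fin.getElem_fin]
  exact congrArg (fun l => (⟨xs[i].team, l, xs[i].labels⟩ : MProg.WorldRecord)) e

/-- Accepted strings consist of records with rows as long as there are records, and such records are
those of an input; conversely the records of an input have this shape and its formula is a
disjunction. -/
theorem Input.accepts_iff {M : Set Op} (hM : M ⊆ {Op.or, Op.neg, Op.dep}) (k : ℕ)
    (w : List Token) : Config.Accepts M (Config.init k) w ↔
      ∃ I : Input, I.encode = w ∧ I.fml ∈ fragment Name k M := by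
  constructor
  · intro h
    obtain ⟨xs, hxs, hl, φ, hφ, rfl⟩ := Config.accepts_init h
    obtain ⟨I, rfl, rfl⟩ := Input.exists_records_eq hxs hl φ
    exact ⟨I, I.encode_eq, hφ⟩
  · rintro ⟨I, rfl, hφ⟩
    rw [I.encode_eq]
    refine Config.accepts_of_records ?_ ?_ (disj_of_ops_subset (hφ.1.trans hM)) hφ
    · simpa [records, List.map_eq_nil_iff] using I.n_pos.ne'
    · simp [records]

end MDL

namespace MDL

open StackProg

namespace MProg

variable {k : ℕ}

/-! ### The parser as a program -/

/-- The stack content that represents a number. -/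
def ticks (n : ℕ) : List (Sym k) := List.replicate n (.inl .sep)

/-- The representation of a configuration of the parser. -/
def parserState (c : Config k) (m : Mem k) : Reg k × Mem k :=
  ({ initReg k with parse := c.q, first := c.first },
   { m with len := ticks c.len, lenR := ticks c.lenR, recs := ticks c.recs, pend := ticks c.pend })

/-- Changes the state of the parser. -/
def goto (q : ParseState k) : MProg k := .load fun r => { r with parse := q }

/-- Adds one to a number. -/
def tick (x : Stk) : MProg k := .push x (.inl .sep)

/-- Tests whether a number is zero, and decreases it otherwise. -/
def countdown (x : Stk) (p p' : MProg k) : MProg k := .pop x fun o => o.elim p fun _ => p'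

open scoped Classical in
/-- The program for `Config.fmlStep`. -/
noncomputable def fmlProg (M : Set Op) (t : Token) : MProg k :=
  countdown .pend (goto .fail) (match t with
    | .or => bif decide (Op.or ∈ M) then .seq (tick .pend) (.seq (tick .pend) (goto .fml))
        else goto .fail
    | .prop => goto .name
    | .neg => goto (bif decide (Op.neg ∈ M) then .neg else .fail)
    | .dep => goto (bif decide (Op.dep ∈ M) then .deps (Fin.last k) else .fail)
    | _ => goto .fail)

/-- The program for `Config.startStep`. -/
noncomputable def startProg (M : Set Op) : Token → MProg k
  | .bit _ => goto .adj
  | t => .cases fun r => bif r.first then goto .fail else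
      countdown .recs (fmlProg M t) (goto .fail)

/-- The program for `Config.adjStep`. -/
def adjProg : Token → MProg k
  | .bit _ => .cases fun r => bif r.first then .seq (tick .lenR) (tick .recs) else
      countdown .len (goto .fail) (tick .lenR)
  | .sep => countdown .len (countdown .recs (goto .fail) (.seq (move .lenR .len)
      (.load fun r => { r with parse := .labels, first := false }))) (goto .fail)
  | _ => goto .fail

open scoped Classical in
/-- The program for `Config.negStep`. -/
noncomputable def negProg (M : Set Op) : Token → MProg k
  | .prop => goto .name
  | .dep => goto (bif decide (Op.dep ∈ M) then .deps (Fin.last k) else .fail)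
  | _ => goto .fail

/-- The program for `Config.step`. -/
noncomputable def parseTok (M : Set Op) (t : Token) : MProg k := .cases fun r => match r.parse with
  | .start => startProg M t
  | .adj => adjProg t
  | .fml => fmlProg M t
  | .neg => negProg M t
  | q => goto (Config.nextState q t)

variable {N : ℕ} {M : Set Op}

theorem run_goto_bif (b : Bool) (q : ParseState k) (c : Config k) (m : Mem k) :
    run N (goto (bif b then q else .fail)) (parserState c m) =
      parserState (Config.atomStep b q c) m := by
  cases b <;> rfl

open scoped Classical in
theorem run_fmlProg (c : Config k) (m : Mem k) (t : Token) :
    run N (fmlProg M t) (parserState c m) = parserState (Config.fmlStep M c t) m := by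
  obtain ⟨q, first, len, lenR, recs, _ | d⟩ := c
  · rfl
  · cases t with
    | neg => exact run_goto_bif (N := N) _ _ ⟨q, first, len, lenR, recs, d⟩ m
    | dep => exact run_goto_bif (N := N) _ _ ⟨q, first, len, lenR, recs, d⟩ m
    | or =>
      simp only [fmlProg, Config.fmlStep]
      generalize decide (Op.or ∈ M) = b
      cases b <;> rfl
    | _ => rfl

theorem startStep_of_ne {t : Token} (ht : ∀ b, t ≠ .bit b) (c : Config k) :
    Config.startStep M c t = bif c.first then { c with q := .fail } else match c.recs with
      | 0 => Config.fmlStep M c t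
      | n + 1 => { c with q := .fail, recs := n } := by
  cases t <;> first | rfl | exact (ht _ rfl).elim

theorem run_startProg (c : Config k) (m : Mem k) (t : Token) :
    run N (startProg M t) (parserState c m) = parserState (Config.startStep M c t) m := by
  by_cases ht : ∃ b, t = .bit b
  · obtain ⟨b, rfl⟩ := ht
    rfl
  have e : startProg (k := k) M t = .cases fun r => bif r.first then goto .fail else
      countdown .recs (fmlProg M t) (goto .fail) := by
    cases t <;> first | rfl | exact (ht ⟨_, rfl⟩).elim
  rw [e, startStep_of_ne fun b hb => ht ⟨b, hb⟩]
  obtain ⟨q, _ | _, len, lenR, _ | n, pend⟩ := c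
  · exact run_fmlProg ⟨q, false, len, lenR, 0, pend⟩ m t
  all_goals rfl

/-- The bound `hc` is needed for the separator, where the row length is moved back by a loop of only
`N` rounds. -/
theorem run_adjProg (c : Config k) (m : Mem k) (t : Token) (hc : c.lenR ≤ N) :
    run N (adjProg t) (parserState c m) = parserState (Config.adjStep c t) m := by
  cases t with
  | bit b => obtain ⟨q, _ | _, _ | len, lenR, recs, pend⟩ := c <;> rfl
  | sep =>
    obtain ⟨q, first, _ | len, lenR, _ | n, pend⟩ := c
    · rfl
    · have e : run N (move .lenR .len)
          (parserState ⟨q, first, 0, lenR, n, pend⟩ m) =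
          parserState ⟨q, first, lenR, 0, n, pend⟩ m := by
        rw [parserState, run_move _ _ _ (by decide) (by simpa [Mem.get, ticks] using hc)]
        simp [Mem.get, Mem.set, parserState, ticks]
      exact congrArg (run N (.load fun r => { r with parse := .labels, first := false })) e
    · rfl
    · rfl
  | _ => rfl

theorem run_parseTok (c : Config k) (m : Mem k) (t : Token) (hc : c.lenR ≤ N) :
    run N (parseTok M t) (parserState c m) = parserState (Config.step M c t) m := by
  rcases hq : c.q <;> obtain ⟨q, first, len, lenR, recs, pend⟩ := c <;> cases hq
  case start => exact run_startProg ⟨.start, first, len, lenR, recs, pend⟩ m t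
  case adj => exact run_adjProg ⟨.adj, first, len, lenR, recs, pend⟩ m t hc
  case fml => exact run_fmlProg ⟨.fml, first, len, lenR, recs, pend⟩ m t
  case neg =>
    cases t with
    | dep => exact run_goto_bif (N := N) _ _ ⟨.neg, first, len, lenR, recs, pend⟩ m
    | _ => rfl
  all_goals rfl

theorem lenR_atomStep (ok : Bool) (q : ParseState k) (c : Config k) :
    (Config.atomStep ok q c).lenR = c.lenR := by
  cases ok <;> rfl

theorem lenR_fmlStep (c : Config k) (t : Token) : (Config.fmlStep M c t).lenR = c.lenR := by
  rw [Config.fmlStep]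
  split
  · rfl
  · cases t with
    | neg => exact lenR_atomStep _ _ _
    | dep => exact lenR_atomStep _ _ _
    | or => exact (Bool.apply_cond Config.lenR).trans (by simp)
    | _ => rfl

/-- It follows that `lenR` never exceeds the length of the input, as the simulation of the parser
requires. -/
theorem lenR_step_le (c : Config k) (t : Token) : (Config.step M c t).lenR ≤ c.lenR + 1 := by
  obtain ⟨q, first, len, lenR, recs, pend⟩ := c
  cases q with
  | start =>
    by_cases ht : ∃ b, t = .bit b
    · obtain ⟨b, rfl⟩ := ht
      exact Nat.le_succ _
    · have e := startStep_of_ne (k := k) (M := M) (fun b hb => ht ⟨b, hb⟩)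
        ⟨.start, first, len, lenR, recs, pend⟩
      refine (congrArg Config.lenR e).trans_le ?_
      cases first <;> cases recs
      · exact (lenR_fmlStep _ _).trans_le (Nat.le_succ _)
      all_goals exact Nat.le_succ _
  | adj =>
    cases t with
    | bit => cases first <;> cases len <;> first | exact Nat.le_succ _ | exact le_rfl
    | sep => cases len <;> cases recs <;> first | exact Nat.le_succ _ | exact Nat.zero_le _
    | _ => exact Nat.le_succ _
  | fml => exact (lenR_fmlStep (M := M) _ _).trans_le (Nat.le_succ _)
  | neg =>
    cases t with
    | dep => exact (lenR_atomStep _ _ _).trans_le (Nat.le_succ _)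
    | _ => exact Nat.le_succ _
  | _ => exact Nat.le_succ _

/-- The step of the main loop of the parser. -/
noncomputable def parseStep (M : Set Op) : MProg k := next .main fun a =>
  .seq (.push .mainR a) (a.elim (parseTok M) fun _ => skip)

theorem iterate_parseStep (w : List Token) (c : Config k) (m : Mem k) (hc : c.lenR + w.length ≤ N) :
    (run N (parseStep M))^[w.length] (parserState c { m with main := toks w }) =
      parserState (w.foldl (Config.step M) c)
        { m with main := [], mainR := (toks w).reverse ++ m.mainR } := by
  induction w generalizing c m with
  | nil => rfl
  | cons t w ih =>
    rw [List.length_cons] at hc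
    rw [List.length_cons, Function.iterate_succ_apply]
    have h1 : run N (parseStep M) (parserState c { m with main := toks (t :: w) }) =
        parserState (Config.step M c t) { m with main := toks w, mainR := .inl t :: m.mainR } :=
      run_parseTok c { m with main := toks w, mainR := .inl t :: m.mainR } t (by omega)
    rw [h1, ih (Config.step M c t) { m with mainR := .inl t :: m.mainR }
      (by have := lenR_step_le (M := M) c t; omega)]
    simp [toks]

/-! ### The model checker -/

/-- The step of the loop that copies the input. -/
def copyStep : MProg k := next .inp fun a => .seq (.push .main a) (.push .form a)

theorem iterate_copyStep (l : List (Sym k)) (r : Reg k) (m : Mem k) :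
    (run N copyStep)^[l.length] (r, { m with inp := l }) =
      (r, { m with inp := [], main := l.reverse ++ m.main, form := l.reverse ++ m.form }) := by
  induction l generalizing m with
  | nil => rfl
  | cons a l ih =>
    rw [List.length_cons, Function.iterate_succ_apply]
    refine (ih { m with main := a :: m.main, form := a :: m.form }).trans ?_
    simp

/-- Runs a program if the input has been accepted by the parser. -/
def ifAccepted (p : MProg k) : MProg k := .cases fun r => match r.parse with
  | .fml => countdown .pend p skip
  | _ => skip

/-- Decides the model checking problem. -/
noncomputable def modelChecker (k : ℕ) (M : Set Op) : MProg k :=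
  .seq (.rep copyStep) (.seq (tick .pend) (.seq (.rep (parseStep M)) (.seq (move .mainR .main)
    (ifAccepted (search k)))))

theorem run_modelChecker (w : List Token) :
    run w.length (modelChecker k M)
      (initReg k, { Mem.empty k with inp := (toks w).reverse }) =
    run w.length (ifAccepted (search k)) (parserState (w.foldl (Config.step M) (Config.init k))
      { Mem.empty k with main := toks w, form := toks w }) := by
  have h1 := iterate_copyStep (N := w.length) (toks w).reverse (initReg k) (Mem.empty k)
  rw [List.length_reverse, length_toks, List.reverse_reverse] at h1
  have h1' : run w.length (.rep copyStep) _ = _ := run_rep_next _ _ _ h1 le_rfl rfl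
  have h2 := iterate_parseStep (M := M) (N := w.length) w (Config.init k)
    { Mem.empty k with form := toks w } (by simp [Config.init])
  have h2' : run w.length (.rep (parseStep M)) _ = _ := run_rep_next _ _ _ h2 le_rfl rfl
  have h3 : run w.length (tick .pend) (initReg k,
      { Mem.empty k with
        inp := []
        main := toks w ++ (Mem.empty k).main
        form := toks w ++ (Mem.empty k).form }) = parserState (Config.init k)
      { Mem.empty k with form := toks w, main := toks w } := by
    simp only [Mem.empty, List.append_nil]
    rfl
  rw [modelChecker, run_seq, h1', run_seq, h3, run_seq]
  refine congrArg _ ((congrArg (run _ (move .mainR .main)) h2').trans ?_)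
  rw [parserState, run_move _ _ _ (by decide) (by simp [Mem.get, length_toks, Mem.empty])]
  simp [Mem.get, Mem.set, Mem.empty]

/-- The search gives the right answer for every input that the string encodes, and rejected strings
leave the answer at its initial value `false`. -/
theorem run_modelChecker_answer (hM : M ⊆ {Op.or, Op.neg, Op.dep}) (w : List Token) :
    (run w.length (modelChecker k M)
      (initReg k, { Mem.empty k with inp := (toks w).reverse })).1.answer = true ↔
    w ∈ modelChecking k M := by
  rw [run_modelChecker]
  set c := w.foldl (Config.step M) (Config.init k) with hc
  have hacc := Input.accepts_iff hM k w
  rw [Config.Accepts, ← hc] at hacc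
  by_cases h : c.q = .fml ∧ c.pend = 0
  · obtain ⟨I, rfl, hI⟩ := hacc.1 h
    have hd := disj_of_ops_subset (hI.1.trans hM)
    have e : run I.encode.length (ifAccepted (search k)) (parserState c
        { Mem.empty k with main := toks I.encode, form := toks I.encode }) =
        run I.encode.length (search k) (parserState c
        { Mem.empty k with main := toks I.encode, form := toks I.encode }) := by
      obtain ⟨hq, hp⟩ := h
      generalize c = c at hq hp
      obtain ⟨q, first, len, lenR, recs, pend⟩ := c
      cases hq
      cases hp
      rfl
    rw [e]
    have h1 := run_search_answer I.encode.length I.fml hd (parserState c (Mem.empty k)).1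
      (parserState c (Mem.empty k)).2 I.records I.encode I.encode_eq le_rfl
    refine h1.trans ((I.sat_iff k hd hI.2 _ le_rfl).symm.trans ⟨fun hs => ⟨I, rfl, hI, hs⟩, ?_⟩)
    -- Unique readability of the encoding is not needed: if the string also encodes `J`, the truth
    -- for `I` and for `J` are both equivalent to the same answer of the machine.
    rintro ⟨J, hJ, hJ', hs⟩
    rw [J.sat_iff k (disj_of_ops_subset (hJ'.1.trans hM)) hJ'.2 _ le_rfl] at hs
    rw [I.sat_iff k hd hI.2 _ le_rfl, ← h1]
    have h2 := run_search_answer J.encode.length J.fml (disj_of_ops_subset (hJ'.1.trans hM))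
      (parserState c (Mem.empty k)).1 (parserState c (Mem.empty k)).2 J.records J.encode
      J.encode_eq le_rfl
    rw [← h2] at hs
    rwa [hJ] at hs
  -- The test of `pend` may remove a tick from its stack, but the registers keep the values that
  -- parsing left.
  · have e : run w.length (ifAccepted (search k)) (parserState c
        { Mem.empty k with main := toks w, form := toks w }) = run w.length skip (parserState c
        { Mem.empty k with main := toks w, form := toks w }) ∨ ∃ m, 
        run w.length (ifAccepted (search k)) (parserState c
        { Mem.empty k with main := toks w, form := toks w }) = ((parserState c m).1, m) := by
      generalize c = c at h
      obtain ⟨q, first, len, lenR, recs, pend⟩ := c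
      cases q with
      | fml =>
        cases pend with
        | zero => exact (h ⟨rfl, rfl⟩).elim
        | succ n => exact Or.inr ⟨_, rfl⟩
      | _ => exact Or.inl rfl
    refine iff_of_false ?_ fun ⟨I, hI, hI', _⟩ => h (hacc.2 ⟨I, hI, hI'⟩)
    obtain e | ⟨m, e⟩ := e <;> rw [e] <;> exact Bool.false_ne_true

end MProg

/-- The model checking problem is in `P` for the fragments without conjunction. -/
theorem inP_modelChecking {M : Set Op} (hM : M ⊆ {Op.or, Op.neg, Op.dep}) (k : ℕ) :
    InP (modelChecking k M) := by
  classical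
  have : Fintype (Reg k) := Fintype.ofFinite _
  have : Inhabited (Sym k) := ⟨.inl .sep⟩
  refine ⟨fun w => decide (w ∈ modelChecking k M), fun w => by simp, ?_⟩
  refine Prog.nonempty_tm2ComputableInPolyTime (MProg.modelChecker k M) Stk.inp Sum.inl
    (MProg.initReg k) Reg.answer (Mem.store k) (Mem.empty k) (by rintro (_ | _) <;> rfl) _ fun w => ?_
  rw [Bool.eq_iff_iff, decide_eq_true_iff]
  exact (MProg.run_modelChecker_answer hM w).symm

end MDL

theorem theorem4p5 (M : Set MDL.Op) (hM : M ⊆ {MDL.Op.or, MDL.Op.neg, MDL.Op.dep}) (k : ℕ) :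
    MDL.InP (MDL.modelChecking k M) ∧
      ∀ (AP : Type*) (S : Type*) [Fintype S] [Nonempty S] (W : MDL.Kripke AP S) (φ : MDL.Fml AP),
        φ ∈ MDL.fragment AP k M → Real.logb 2 (Fintype.card S) < φ.numDep →
          ∀ T : Set S, W.Sat T φ :=
  ⟨MDL.inP_modelChecking hM k, fun _ _ _ _ W φ hφ h T =>
    W.sat_of_card_lt φ (MDL.disj_of_ops_subset (hφ.1.trans hM))
      (MDL.card_lt_of_logb_lt Fintype.card_pos h) T⟩
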